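/- Conventions. Everything is over $\mathbb{C}$; $A$ is a Hopf $*$-algebra (with bijective antipode $S$, counit $\epsilon$, and Sweedler notation $\Delta a=a_{(1)}\otimes a_{(2)}$), $B$ is a left $A$-comodule $*$-algebra, and $(\Omega^\bullet,\wedge,d)$, $\Omega^0=B$, is an $A$-covariant $*$-differential calculus over $B$: a differential graded algebra generated by $B$ and $dB$, with a coaction $\omega\mapsto\omega_{(-1)}\otimes\omega_{(0)}$ of $A$ on each $\Omega^k$ for which $\wedge$ and $d$ are covariant, and a conjugate linear involution $*$ satisfying $(d\omega)^*=d(\omega^*)$, $(\omega\wedge\eta)^*=(-1)^{kl}\eta^*\wedge\omega^*$ for $\omega\in\Omega^k,\eta\in\Omega^l$, and $(\omega^*)_{(-1)}\otimes(\omega^*)_{(0)}=\omega_{(-1)}^*\otimes\omega_{(0)}^*$. A real $A$-covariant metric is a pair $(g,(\,,))$ with $g\in\Omega^1\otimes_B\Omega^1$ and $(\,,):\Omega^1\otimes_B\Omega^1\to B$ a $B$-bilinear map such that $((\omega,\,)\otimes\mathrm{id})g=\omega=(\mathrm{id}\otimes(\,,\omega))g$ for all $\omega\in\Omega^1$, both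 $(\,,)$ and $b\mapsto bg$ are $A$-covariant, and $g=\sum_i\eta_i^*\otimes\omega_i^*$ whenever $g=\sum_i\omega_i\otimes\eta_i$. Let $\overline{\Omega^1}$ be the conjugate bimodule, with $b\cdot\overline\omega=\overline{\omega b^*}$, $\overline\omega\cdot b=\overline{b^*\omega}$ and coaction $\overline\omega\mapsto\omega_{(-1)}^*\otimes\overline{\omega_{(0)}}$. Let ${}_B\mathrm{Hom}(\Omega^1,B)$ be the space of left $B$-linear maps, with $(b\cdot f)(e)=f(eb)$, $(f\cdot b)(e)=f(e)b$ and coaction $f_{(-1)}\otimes f_{(0)}(e)=S(e_{(-1)})[f(e_{(0)})]_{(-1)}\otimes[f(e_{(0)})]_{(0)}$. If $\Omega^1$ is finitely generated projective as a left $B$-module, an $A$-covariant Hermitian metric on $\Omega^1$ is an $A$-covariant isomorphism of $B$-bimodules $\mathfrak h:\overline{\Omega^1}\to{}_B\mathrm{Hom}(\Omega^1,B)$ with $(\mathfrak h(\overline x)(y))^*=\mathfrak h(\overline y)(x)$ for all $x,y\in\Omega^1$. To a real covariant metric one associates $\mathfrak h_g(\overline\omega)(\eta)=(\eta,\omega^*)$.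 A unital 2-cocycle is a convolution invertible functional $\gamma$ on $A\otimes A$, with convolution inverse $\bar\gamma$, such that $\gamma(g_{(1)}\otimes h_{(1)})\gamma(g_{(2)}h_{(2)}\otimes k)=\gamma(h_{(1)}\otimes k_{(1)})\gamma(g\otimes h_{(2)}k_{(2)})$ and $\gamma(h\otimes1)=\epsilon(h)=\gamma(1\otimes h)$. It is unitary if $\overline{\gamma(a\otimes b)}=\bar\gamma(S(a)^*\otimes S(b)^*)$. Put $U(k)=\gamma(k_{(1)}\otimes S(k_{(2)}))$, $\bar U(k)=\bar\gamma(S(k_{(1)})\otimes k_{(2)})$, $V=U\circ S^{-1}$ and $\bar V=\bar U\circ S^{-1}$. The twisted Hopf $*$-algebra $A_\gamma$ is the coalgebra $A$ with $h\cdot_\gamma k=\gamma(h_{(1)}\otimes k_{(1)})h_{(2)}k_{(2)}\bar\gamma(h_{(3)}\otimes k_{(3)})$, $S_\gamma(h)=U(h_{(1)})S(h_{(2)})\bar U(h_{(3)})$ and $h^{*_\gamma}=\bar V(h_{(1)}^*)h_{(2)}^*V(h_{(3)}^*)$. The twisted calculus $(\Omega^\bullet_\gamma,\wedge_\gamma,d)$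 over $B_\gamma=\Omega^0_\gamma$ has the same underlying spaces, coaction and $d$, with $\omega\wedge_\gamma\eta=\gamma(\omega_{(-1)}\otimes\eta_{(-1)})\,\omega_{(0)}\wedge\eta_{(0)}$ and $\omega^{*_\gamma}=\bar V(\omega_{(-1)}^*)\,\omega_{(0)}^*$. The map $\varphi(\omega\otimes\eta)=\gamma(\omega_{(-1)}\otimes\eta_{(-1)})\,\omega_{(0)}\otimes\eta_{(0)}$ is an isomorphism $\Omega^1_\gamma\otimes_{B_\gamma}\Omega^1_\gamma\to\Omega^1\otimes_B\Omega^1$; the twisted metric is $g_\gamma=\varphi^{-1}(g)$, $(\,,)_\gamma=(\,,)\circ\varphi$. The $\gamma$-deformation of a Hermitian metric $\mathfrak h$ on $\Omega^1$ is $\mathfrak h_\gamma=\mathfrak S\circ\mathfrak h\circ\mathfrak N$, where $\mathfrak N(\overline e)=\bar V(e_{(-1)}^*)\,\overline{e_{(0)}}$ and $\mathfrak S(f)(v)=\gamma\big(v_{(-2)}\otimes S(v_{(-1)})[f(v_{(0)})]_{(-1)}\big)[f(v_{(0)})]_{(0)}$. Theorem. Let $(g,(\,,))$ be a real $A$-covariant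 metric on $\Omega^1$ and $\gamma$ a unitary 2-cocycle on $A$. Then $(g_\gamma,(\,,)_\gamma)$ is a real $A_\gamma$-covariant metric on $\Omega^1_\gamma$, the associated maps $\mathfrak h_g$ and $\mathfrak h_{g_\gamma}$ are $A$- and $A_\gamma$-covariant Hermitian metrics on $\Omega^1$ and $\Omega^1_\gamma$ respectively, and $$\mathfrak h_{g_\gamma}=(\mathfrak h_g)_\gamma .$$ -/

import Mathlib

open scoped TensorProduct
open Coalgebra WithConv

noncomputable section

namespace CocycleTwist

universe u v w

/-! ### Hopf `*`-algebras and unitary 2-cocycles -/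

/-- `A` is a Hopf `*`-algebra: a complex Hopf algebra which is a `*`-algebra (a `StarRing` with
conjugate linear star) whose coproduct is a `*`-homomorphism, for the involution
`(a ⊗ b)^* = a^* ⊗ b^*` on `A ⊗ A`. As usual the antipode is taken to be bijective. -/
class IsHopfStarAlgebra (A : Type u) [Ring A] [HopfAlgebra ℂ A] [StarRing A] [StarModule ℂ A] :
    Prop where
  comul_star : ∀ a : A, comul (R := ℂ) (star a) = star (comul (R := ℂ) a)
  antipode_bijective : Function.Bijective (HopfAlgebra.antipode ℂ : A →ₗ[ℂ] A)

/-- The inverse `S⁻¹` of the antipode. -/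
def antipodeInv (A : Type u) [Ring A] [HopfAlgebra ℂ A] [StarRing A] [StarModule ℂ A]
    [IsHopfStarAlgebra A] : A →ₗ[ℂ] A :=
  (LinearEquiv.ofBijective (HopfAlgebra.antipode ℂ : A →ₗ[ℂ] A)
    IsHopfStarAlgebra.antipode_bijective).symm.toLinearMap

/-- A (unital) 2-cocycle `γ` on a Hopf algebra, with its convolution inverse `inv`, written `γ̄`
in the comments. The products in `mul_inv`, `inv_mul` and `cocycle` are convolution products of
functionals on the coalgebra `A ⊗ A`. -/
structure TwoCocycle (A : Type u) [Ring A] [HopfAlgebra ℂ A] where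
  /-- the cocycle `γ` -/
  γ : A ⊗[ℂ] A →ₗ[ℂ] ℂ
  /-- its convolution inverse `γ̄` -/
  inv : A ⊗[ℂ] A →ₗ[ℂ] ℂ
  mul_inv : toConv γ * toConv inv = 1
  inv_mul : toConv inv * toConv γ = 1
  /-- `γ(g₁ ⊗ h₁) γ(g₂h₂ ⊗ k) = γ(h₁ ⊗ k₁) γ(g ⊗ h₂k₂)` -/
  cocycle : ∀ g h k : A,
    (toConv γ * toConv (γ ∘ₗ (TensorProduct.mk ℂ A A).flip k ∘ₗ LinearMap.mul' ℂ A)) (g ⊗ₜ h) =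
      (toConv γ * toConv (γ ∘ₗ TensorProduct.mk ℂ A A g ∘ₗ LinearMap.mul' ℂ A)) (h ⊗ₜ k)
  unital_right : ∀ h : A, γ (h ⊗ₜ 1) = counit (R := ℂ) h
  unital_left : ∀ h : A, γ (1 ⊗ₜ h) = counit (R := ℂ) h

namespace TwoCocycle

variable {A : Type u} [Ring A] [HopfAlgebra ℂ A] (c : TwoCocycle A)

/-- `U(k) = γ(k₁ ⊗ S(k₂))`. -/
def U : A →ₗ[ℂ] ℂ := c.γ ∘ₗ (HopfAlgebra.antipode ℂ : A →ₗ[ℂ] A).lTensor A ∘ₗ comul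

/-- `Ū(k) = γ̄(S(k₁) ⊗ k₂)`. -/
def Ubar : A →ₗ[ℂ] ℂ := c.inv ∘ₗ (HopfAlgebra.antipode ℂ : A →ₗ[ℂ] A).rTensor A ∘ₗ comul

variable [StarRing A] [StarModule ℂ A]

/-- `γ` is unitary: the complex conjugate of `γ(a ⊗ b)` is `γ̄(S(a)^* ⊗ S(b)^*)`. -/
def IsUnitary : Prop := ∀ a b : A, starRingEnd ℂ (c.γ (a ⊗ₜ b)) =
  c.inv (star (HopfAlgebra.antipode ℂ a) ⊗ₜ star (HopfAlgebra.antipode ℂ b))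

variable [IsHopfStarAlgebra A]

/-- `V = U ∘ S⁻¹`. -/
def V : A →ₗ[ℂ] ℂ := c.U ∘ₗ antipodeInv A

/-- `V̄ = Ū ∘ S⁻¹`. -/
def Vbar : A →ₗ[ℂ] ℂ := c.Ubar ∘ₗ antipodeInv A

end TwoCocycle

/-- The conjugate linear involution of a `*`-algebra. -/
def starMap (A : Type u) [Ring A] [Algebra ℂ A] [StarRing A] [StarModule ℂ A] :
    A →ₛₗ[starRingEnd ℂ] A where
  toFun := star
  map_add' := star_add
  map_smul' c a := by simp [star_smul]

/-- The operations of a Hopf `*`-algebra, other than its coalgebra structure, on a coalgebra `A`.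
Since a cocycle twist keeps the underlying coalgebra, `A` and `A_γ` are two such systems of
operations on the same coalgebra. -/
structure HopfStarData (A : Type u) [AddCommGroup A] [Module ℂ A] where
  mul : A →ₗ[ℂ] A →ₗ[ℂ] A
  one : A
  antipode : A →ₗ[ℂ] A
  star : A →ₛₗ[starRingEnd ℂ] A

section HopfData

variable (A : Type u) [Ring A] [HopfAlgebra ℂ A] [StarRing A] [StarModule ℂ A]

/-- The operations of the Hopf `*`-algebra `A` itself. -/
def HopfStarData.of : HopfStarData A where
  mul := LinearMap.mul ℂ A
  one := 1
  antipode := HopfAlgebra.antipode ℂ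
  star := starMap A

variable {A} [IsHopfStarAlgebra A]

/-- The operations of the twisted Hopf `*`-algebra `A_γ` (the products are convolution products):
* `h ·_γ k = γ(h₁ ⊗ k₁) h₂k₂ γ̄(h₃ ⊗ k₃)`,
* `S_γ(h) = U(h₁) S(h₂) Ū(h₃)`,
* `h^{*_γ} = V̄(h₁^*) h₂^* V(h₃^*)`. -/
def TwoCocycle.twistedHopf (c : TwoCocycle A) : HopfStarData A where
  mul := TensorProduct.curry
    (toConv (Algebra.linearMap ℂ A ∘ₗ c.γ) * toConv (LinearMap.mul' ℂ A) *
      toConv (Algebra.linearMap ℂ A ∘ₗ c.inv)).ofConv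
  one := 1
  antipode :=
    (toConv (Algebra.linearMap ℂ A ∘ₗ c.U) * toConv (HopfAlgebra.antipode ℂ) *
      toConv (Algebra.linearMap ℂ A ∘ₗ c.Ubar)).ofConv
  star :=
    (toConv (Algebra.linearMap ℂ A ∘ₗ c.Vbar) * toConv (LinearMap.id : A →ₗ[ℂ] A) *
      toConv (Algebra.linearMap ℂ A ∘ₗ c.V)).ofConv ∘ₛₗ starMap A

end HopfData

/-! ### Operations built from coactions -/

section Coactions

variable {A : Type u} [AddCommGroup A] [Module ℂ A]
variable {M : Type v} [AddCommMonoid M] [Module ℂ M] {N : Type w} [AddCommMonoid N] [Module ℂ N]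

/-- For a coaction `δ(m) = m₍₋₁₎ ⊗ m₍₀₎`, the map `m ↦ f(m₍₋₁₎) m₍₀₎`. -/
def slice (f : A →ₗ[ℂ] ℂ) : A ⊗[ℂ] M →ₗ[ℂ] M :=
  (TensorProduct.lid ℂ M).toLinearMap ∘ₗ f.rTensor M

/-- `m ⊗ n ↦ (m₍₋₁₎ ⊗ n₍₋₁₎) ⊗ (m₍₀₎ ⊗ n₍₀₎)`. -/
def legs (δM : M →ₗ[ℂ] A ⊗[ℂ] M) (δN : N →ₗ[ℂ] A ⊗[ℂ] N) :
    M ⊗[ℂ] N →ₗ[ℂ] (A ⊗[ℂ] A) ⊗[ℂ] (M ⊗[ℂ] N) :=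
  (TensorProduct.tensorTensorTensorComm ℂ A M A N).toLinearMap ∘ₗ TensorProduct.map δM δN

/-- `m ⊗ n ↦ F(m₍₋₁₎ ⊗ n₍₋₁₎) m₍₀₎ ⊗ n₍₀₎`. -/
def twistOp (F : A ⊗[ℂ] A →ₗ[ℂ] ℂ) (δM : M →ₗ[ℂ] A ⊗[ℂ] M) (δN : N →ₗ[ℂ] A ⊗[ℂ] N) :
    M ⊗[ℂ] N →ₗ[ℂ] M ⊗[ℂ] N :=
  slice F ∘ₗ legs δM δN

/-- The tensor product coaction `m ⊗ n ↦ m₍₋₁₎ n₍₋₁₎ ⊗ (m₍₀₎ ⊗ n₍₀₎)`. -/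
def tensorCoact (H : HopfStarData A) (δM : M →ₗ[ℂ] A ⊗[ℂ] M) (δN : N →ₗ[ℂ] A ⊗[ℂ] N) :
    M ⊗[ℂ] N →ₗ[ℂ] A ⊗[ℂ] (M ⊗[ℂ] N) :=
  (TensorProduct.lift H.mul).rTensor (M ⊗[ℂ] N) ∘ₗ legs δM δN

end Coactions

/-! ### Covariant `*`-differential calculi -/

/-- The operations of an `A`-covariant `*`-differential calculus `(Ω^•, ∧, d)`; the
algebra `B` is `Ω 0`, and its product and the bimodule structures of the `Ω k` are `∧`. -/
structure CalculusData (A : Type u) [AddCommGroup A] [Module ℂ A]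
    (Ω : ℕ → Type v) [∀ k, AddCommGroup (Ω k)] [∀ k, Module ℂ (Ω k)] where
  wedge : ∀ k l, Ω k →ₗ[ℂ] Ω l →ₗ[ℂ] Ω (k + l)
  one : Ω 0
  d : ∀ k, Ω k →ₗ[ℂ] Ω (k + 1)
  coact : ∀ k, Ω k →ₗ[ℂ] A ⊗[ℂ] Ω k
  star : ∀ k, Ω k →ₛₗ[starRingEnd ℂ] Ω k

namespace CalculusData

section Axioms

variable {A : Type u} [AddCommGroup A] [Module ℂ A] [Coalgebra ℂ A]
variable {Ω : ℕ → Type v} [∀ k, AddCommGroup (Ω k)] [∀ k, Module ℂ (Ω k)]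

/-- The element of `⨁ k, Ω k` given by a homogeneous form. It is used to compare forms whose
degrees are equal but not syntactically so. -/
abbrev form {Ω : ℕ → Type v} [∀ k, AddCommGroup (Ω k)] [∀ k, Module ℂ (Ω k)] (k : ℕ) (ω : Ω k) :
    DirectSum ℕ Ω := DirectSum.lof ℂ ℕ Ω k ω

/-- The axioms of an `A`-covariant `*`-differential calculus over the left `A`-comodule
`*`-algebra `B = Ω 0`, where the Hopf `*`-algebra structure of `A` is given by `H`. -/
structure IsCovariantStarCalculus (H : HopfStarData A) (C : CalculusData A Ω) : Prop where
  /- `(Ω^•, ∧)` is a unital associative algebra, and `d` is a differential on it. -/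
  wedge_assoc : ∀ (k l j : ℕ) (ω : Ω k) (η : Ω l) (θ : Ω j),
    form (k + l + j) (C.wedge (k + l) j (C.wedge k l ω η) θ) =
      form (k + (l + j)) (C.wedge k (l + j) ω (C.wedge l j η θ))
  one_wedge : ∀ (k : ℕ) (ω : Ω k), form (0 + k) (C.wedge 0 k C.one ω) = form k ω
  wedge_one : ∀ (k : ℕ) (ω : Ω k), form (k + 0) (C.wedge k 0 ω C.one) = form k ω
  d_d : ∀ (k : ℕ) (ω : Ω k), C.d (k + 1) (C.d k ω) = 0
  leibniz : ∀ (k l : ℕ) (ω : Ω k) (η : Ω l),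
    form (k + l + 1) (C.d (k + l) (C.wedge k l ω η)) =
      form (k + 1 + l) (C.wedge (k + 1) l (C.d k ω) η) +
        (-1 : ℂ) ^ k • form (k + (l + 1)) (C.wedge k (l + 1) ω (C.d l η))
  /- `Ω^•` is generated as an algebra by `B` and `dB`. -/
  generated : ∀ P : ∀ k, Submodule ℂ (Ω k), P 0 = ⊤ → (∀ b : Ω 0, C.d 0 b ∈ P 1) →
    (∀ (k l : ℕ) (ω : Ω k) (η : Ω l), ω ∈ P k → η ∈ P l → C.wedge k l ω η ∈ P (k + l)) →
    ∀ k, P k = ⊤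
  /- Each `Ω k` is a left `A`-comodule; `∧`, the unit and `d` are covariant. -/
  coact_coassoc : ∀ (k : ℕ) (ω : Ω k),
    TensorProduct.assoc ℂ A A (Ω k) ((comul (R := ℂ)).rTensor (Ω k) (C.coact k ω)) =
      (C.coact k).lTensor A (C.coact k ω)
  coact_counit : ∀ (k : ℕ) (ω : Ω k), slice (counit (R := ℂ)) (C.coact k ω) = ω
  coact_wedge : ∀ (k l : ℕ) (ω : Ω k) (η : Ω l),
    C.coact (k + l) (C.wedge k l ω η) = (TensorProduct.lift (C.wedge k l)).lTensor A
      (tensorCoact H (C.coact k) (C.coact l) (ω ⊗ₜ η))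
  coact_one : C.coact 0 C.one = H.one ⊗ₜ C.one
  coact_d : ∀ (k : ℕ) (ω : Ω k), C.coact (k + 1) (C.d k ω) = (C.d k).lTensor A (C.coact k ω)
  /- `*` is a conjugate linear graded involution compatible with `∧`, `d` and the coaction. -/
  star_star : ∀ (k : ℕ) (ω : Ω k), C.star k (C.star k ω) = ω
  star_wedge : ∀ (k l : ℕ) (ω : Ω k) (η : Ω l),
    form (k + l) (C.star (k + l) (C.wedge k l ω η)) =
      (-1 : ℂ) ^ (k * l) • form (l + k) (C.wedge l k (C.star l η) (C.star k ω))
  star_d : ∀ (k : ℕ) (ω : Ω k), C.star (k + 1) (C.d k ω) = C.d k (C.star k ω)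
  coact_star : ∀ (k : ℕ) (ω : Ω k),
    C.coact k (C.star k ω) = TensorProduct.map H.star (C.star k) (C.coact k ω)

end Axioms

section FirstOrder

variable {A : Type u} [AddCommGroup A] [Module ℂ A]
variable {Ω : ℕ → Type v} [∀ k, AddCommGroup (Ω k)] [∀ k, Module ℂ (Ω k)]
variable (C : CalculusData A Ω)

/-- The product of `B = Ω 0`. -/
def mulB : Ω 0 →ₗ[ℂ] Ω 0 →ₗ[ℂ] Ω 0 := C.wedge 0 0

/-- The left action `b · ω` of `B` on one-forms. -/
def lact : Ω 0 →ₗ[ℂ] Ω 1 →ₗ[ℂ] Ω 1 := C.wedge 0 1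

/-- The right action `ω · b` of `B` on one-forms. -/
def ract : Ω 1 →ₗ[ℂ] Ω 0 →ₗ[ℂ] Ω 1 := C.wedge 1 0

/-- The relations `ω·b ⊗ η = ω ⊗ b·η`. -/
def balanced : Submodule ℂ (Ω 1 ⊗[ℂ] Ω 1) :=
  Submodule.span ℂ {t | ∃ (ω : Ω 1) (b : Ω 0) (η : Ω 1),
    t = C.ract ω b ⊗ₜ η - ω ⊗ₜ C.lact b η}

/-- `Ω^1 ⊗_B Ω^1`, as a quotient of the tensor product over `ℂ`. -/
def FormTensor : Type v := (Ω 1 ⊗[ℂ] Ω 1) ⧸ C.balanced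

instance : AddCommGroup C.FormTensor := inferInstanceAs (AddCommGroup ((Ω 1 ⊗[ℂ] Ω 1) ⧸ C.balanced))

instance : Module ℂ C.FormTensor := inferInstanceAs (Module ℂ ((Ω 1 ⊗[ℂ] Ω 1) ⧸ C.balanced))

/-- The projection `Ω^1 ⊗ Ω^1 → Ω^1 ⊗_B Ω^1`. -/
def proj : Ω 1 ⊗[ℂ] Ω 1 →ₗ[ℂ] C.FormTensor := C.balanced.mkQ

/-- The left dual `Hom_B(Ω^1, B)` of left `B`-linear maps, inside the `ℂ`-linear maps. -/
def leftHom : Submodule ℂ (Ω 1 →ₗ[ℂ] Ω 0) where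
  carrier := {f | ∀ (b : Ω 0) (ω : Ω 1), f (C.lact b ω) = C.mulB b (f ω)}
  add_mem' hf hg b ω := by simp [hf b ω, hg b ω]
  zero_mem' b ω := by simp
  smul_mem' c f hf b ω := by simp [hf b ω]

/-- The map `ω ⊗ η ↦ η^* ⊗ ω^*`. -/
def flipStar : Ω 1 ⊗[ℂ] Ω 1 →ₛₗ[starRingEnd ℂ] Ω 1 ⊗[ℂ] Ω 1 :=
  (TensorProduct.comm ℂ (Ω 1) (Ω 1)).toLinearMap ∘ₛₗ TensorProduct.map (C.star 1) (C.star 1)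

/-- The map `b ↦ b · t` for `t ∈ Ω^1 ⊗ Ω^1`. -/
def actOn (t : Ω 1 ⊗[ℂ] Ω 1) : Ω 0 →ₗ[ℂ] Ω 1 ⊗[ℂ] Ω 1 :=
  (LinearMap.rTensorHom (R := ℂ) (Ω 1) ∘ₗ C.lact).flip t

/-! ### Metrics -/

/-- The data `(g, ( , ))` of a metric on `Ω^1`. -/
structure MetricData where
  g : C.FormTensor
  pair : C.FormTensor →ₗ[ℂ] Ω 0

variable {C}

namespace MetricData

variable (m : C.MetricData)

/-- `(ω, η)` -/
def ip : Ω 1 →ₗ[ℂ] Ω 1 →ₗ[ℂ] Ω 0 := TensorProduct.curry (m.pair ∘ₗ C.proj)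

/-- `(ω, ·) ⊗ id : x ⊗ y ↦ (ω, x) · y` -/
def contractLeft (ω : Ω 1) : Ω 1 ⊗[ℂ] Ω 1 →ₗ[ℂ] Ω 1 := TensorProduct.lift (C.lact ∘ₗ m.ip ω)

/-- `id ⊗ (·, ω) : x ⊗ y ↦ x · (y, ω)` -/
def contractRight (ω : Ω 1) : Ω 1 ⊗[ℂ] Ω 1 →ₗ[ℂ] Ω 1 :=
  TensorProduct.lift (C.ract.compl₂ (m.ip.flip ω))

/-- `(g, ( , ))` is a real `A`-covariant metric on `Ω^1`. Here `t` runs over the representatives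
in `Ω^1 ⊗ Ω^1` of `g ∈ Ω^1 ⊗_B Ω^1`. -/
structure IsRealCovariantMetric (H : HopfStarData A) (m : C.MetricData) : Prop where
  /- `( , ) : Ω^1 ⊗_B Ω^1 → B` is `B`-bilinear. -/
  left_linear : ∀ (b : Ω 0) (ω η : Ω 1), m.ip (C.lact b ω) η = C.mulB b (m.ip ω η)
  right_linear : ∀ (b : Ω 0) (ω η : Ω 1), m.ip ω (C.ract η b) = C.mulB (m.ip ω η) b
  /- `((ω, ) ⊗ id) g = ω = (id ⊗ ( , ω)) g`. -/
  contract_left : ∀ t, C.proj t = m.g → ∀ ω, m.contractLeft ω t = ω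
  contract_right : ∀ t, C.proj t = m.g → ∀ ω, m.contractRight ω t = ω
  /- Covariance of `( , )` and of `coev_g : b ↦ b · g`. -/
  pair_covariant : ∀ t : Ω 1 ⊗[ℂ] Ω 1, C.coact 0 (m.pair (C.proj t)) =
    (m.pair ∘ₗ C.proj).lTensor A (tensorCoact H (C.coact 1) (C.coact 1) t)
  coev_covariant : ∀ t, C.proj t = m.g → ∀ b : Ω 0,
    C.proj.lTensor A (tensorCoact H (C.coact 1) (C.coact 1) (C.actOn t b)) =
      (C.proj ∘ₗ C.actOn t).lTensor A (C.coact 0 b)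
  /- Reality: if `g = ∑ ωᵢ ⊗ ηᵢ` then `g = ∑ ηᵢ^* ⊗ ωᵢ^*`. -/
  real : ∀ t, C.proj t = m.g → C.proj (C.flipStar t) = m.g

end MetricData

end FirstOrder

end CalculusData

/-! ### Hermitian metrics -/

/-- The conjugate vector space `M̄`: the same additive group with `c · m̄` the class of `c̄ m`. -/
def Bar (M : Type v) : Type v := M

instance {M : Type v} [AddCommGroup M] : AddCommGroup (Bar M) := inferInstanceAs (AddCommGroup M)

instance {M : Type v} [AddCommGroup M] [Module ℂ M] : Module ℂ (Bar M) :=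
  Module.compHom M (starRingEnd ℂ)

/-- The conjugate linear bijection `m ↦ m̄`. -/
def toBar (M : Type v) [AddCommGroup M] [Module ℂ M] : M ≃ₛₗ[starRingEnd ℂ] Bar M where
  toFun m := m
  invFun m := m
  map_add' _ _ := rfl
  map_smul' c m := by
    change c • m = (starRingEnd ℂ) ((starRingEnd ℂ) c) • m
    simp
  left_inv _ := rfl
  right_inv _ := rfl

/-- The inverse `m̄ ↦ m` of `toBar`. -/
def fromBar (M : Type v) [AddCommGroup M] [Module ℂ M] : Bar M →ₛₗ[starRingEnd ℂ] M :=
  (toBar M).symm.toLinearMap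

namespace CalculusData

section Hermitian

variable {A : Type u} [AddCommGroup A] [Module ℂ A]
variable {Ω : ℕ → Type v} [∀ k, AddCommGroup (Ω k)] [∀ k, Module ℂ (Ω k)]
variable (H : HopfStarData A) (C : CalculusData A Ω)

/-- The coaction on the conjugate comodule: `m̄ ↦ (m₍₋₁₎)^* ⊗` the class of `m₍₀₎`. -/
def barCoact : Bar (Ω 1) →ₗ[ℂ] A ⊗[ℂ] Bar (Ω 1) :=
  TensorProduct.map H.star (toBar (Ω 1)).toLinearMap ∘ₛₗ (C.coact 1 ∘ₛₗ fromBar (Ω 1))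

/-- The coaction on `Hom_B(Ω^1, B)`: for `f` this is the map
`e ↦ f₍₋₁₎ ⊗ f₍₀₎(e) = S(e₍₋₁₎) f(e₍₀₎)₍₋₁₎ ⊗ f(e₍₀₎)₍₀₎`. -/
def homCoact : (Ω 1 →ₗ[ℂ] Ω 0) →ₗ[ℂ] (Ω 1 →ₗ[ℂ] A ⊗[ℂ] Ω 0) where
  toFun f := (TensorProduct.lift H.mul).rTensor (Ω 0) ∘ₗ
    (TensorProduct.assoc ℂ A A (Ω 0)).symm.toLinearMap ∘ₗ
      TensorProduct.map H.antipode (C.coact 0 ∘ₗ f) ∘ₗ C.coact 1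
  map_add' f g := by
    ext; simp [LinearMap.comp_add, TensorProduct.map_add_right]
  map_smul' c f := by
    ext; simp [LinearMap.comp_smul, TensorProduct.map_smul_right]

/-- `h : Ω̄^1 → Hom_B(Ω^1, B)` is an `A`-covariant Hermitian metric on `Ω^1`. -/
structure IsCovariantHermitianMetric (h : Bar (Ω 1) →ₗ[ℂ] (Ω 1 →ₗ[ℂ] Ω 0)) : Prop where
  /- `Ω^1` is finitely generated and projective as a left `B`-module (it has a finite dual
  basis). -/
  fgp : ∃ (n : ℕ) (e : Fin n → Ω 1) (f : Fin n → (Ω 1 →ₗ[ℂ] Ω 0)),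
    (∀ i, f i ∈ C.leftHom) ∧ ∀ ω, ω = ∑ i, C.lact (f i ω) (e i)
  /- `h` is a bijection onto `Hom_B(Ω^1, B)`. -/
  bijOn : Set.BijOn h Set.univ C.leftHom
  /- `h` is a bimodule map, where `b · ω̄` is the class of `ω · b^*` and `ω̄ · b` that of `b^* · ω`,
  and `(b · f)(e) = f(e · b)`, `(f · b)(e) = f(e) b` on `Hom_B(Ω^1, B)`. -/
  left_linear : ∀ (b : Ω 0) (ω e : Ω 1),
    h (toBar (Ω 1) (C.ract ω (C.star 0 b))) e = h (toBar (Ω 1) ω) (C.ract e b)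
  right_linear : ∀ (b : Ω 0) (ω e : Ω 1),
    h (toBar (Ω 1) (C.lact (C.star 0 b) ω)) e = C.mulB (h (toBar (Ω 1) ω) e) b
  /- `h` is covariant. -/
  covariant : ∀ (x : Bar (Ω 1)) (e : Ω 1),
    C.homCoact H (h x) e = (h.flip e).lTensor A (C.barCoact H x)
  /- `⟨y, x̄⟩^* = ⟨x, ȳ⟩`, where `⟨y, x̄⟩ = h(x̄)(y)`. -/
  hermitian : ∀ x y : Ω 1, C.star 0 (h (toBar (Ω 1) x) y) = h (toBar (Ω 1) y) x

/-- The map `𝔥_g : Ω̄^1 → Hom_B(Ω^1, B)`, `𝔥_g(ω̄)(η) = (η, ω^*)`, associated with a metric. -/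
def MetricData.toHermitian {C : CalculusData A Ω} (m : C.MetricData) :
    Bar (Ω 1) →ₗ[ℂ] (Ω 1 →ₗ[ℂ] Ω 0) :=
  m.ip.flip ∘ₗ (C.star 1 ∘ₛₗ fromBar (Ω 1) : Bar (Ω 1) →ₗ[ℂ] Ω 1)

end Hermitian

end CalculusData

/-! ### Cocycle deformation -/

section Helpers

variable {A : Type u} [Ring A] [HopfAlgebra ℂ A]
variable {M : Type v} [AddCommGroup M] [Module ℂ M] {N : Type w} [AddCommGroup N] [Module ℂ N]

theorem twistOp_twistOp (F G : A ⊗[ℂ] A →ₗ[ℂ] ℂ)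
    {δM : M →ₗ[ℂ] A ⊗[ℂ] M} {δN : N →ₗ[ℂ] A ⊗[ℂ] N}
    (hM : ∀ m, TensorProduct.assoc ℂ A A M ((comul (R := ℂ)).rTensor M (δM m)) =
      δM.lTensor A (δM m))
    (hN : ∀ n, TensorProduct.assoc ℂ A A N ((comul (R := ℂ)).rTensor N (δN n)) =
      δN.lTensor A (δN n)) (t : M ⊗[ℂ] N) :
    twistOp F δM δN (twistOp G δM δN t) =
      twistOp (toConv G * toConv F).ofConv δM δN t := by
  induction t with
  | zero => simp
  | add x y hx hy => simp only [map_add, hx, hy]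
  | tmul m n =>
    have key : ∀ (X : A ⊗[ℂ] M) (Y : A ⊗[ℂ] N),
        twistOp F δM δN (slice G (TensorProduct.tensorTensorTensorComm ℂ A M A N (X ⊗ₜ Y))) =
        slice F (TensorProduct.tensorTensorTensorComm ℂ A M A N (slice G
          (TensorProduct.tensorTensorTensorComm ℂ A (A ⊗[ℂ] M) A (A ⊗[ℂ] N)
            (δM.lTensor A X ⊗ₜ δN.lTensor A Y)))) := by
      intro X Y
      induction X with
      | zero => simp
      | add x y hx hy => simp only [map_add, TensorProduct.add_tmul, hx, hy]
      | tmul a m =>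
        induction Y with
        | zero => simp
        | add x y hx hy => simp only [map_add, TensorProduct.tmul_add, hx, hy]
        | tmul b n => simp [slice, twistOp, legs]
    have key2 : ∀ (X : A ⊗[ℂ] M) (Y : A ⊗[ℂ] N),
        slice F (TensorProduct.tensorTensorTensorComm ℂ A M A N (slice G
          (TensorProduct.tensorTensorTensorComm ℂ A (A ⊗[ℂ] M) A (A ⊗[ℂ] N)
            (TensorProduct.assoc ℂ A A M ((comul (R := ℂ)).rTensor M X) ⊗ₜ
              TensorProduct.assoc ℂ A A N ((comul (R := ℂ)).rTensor N Y))))) =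
        slice (toConv G * toConv F).ofConv
          (TensorProduct.tensorTensorTensorComm ℂ A M A N (X ⊗ₜ Y)) := by
      intro X Y
      induction X with
      | zero => simp
      | add x y hx hy => simp only [map_add, TensorProduct.add_tmul, hx, hy]
      | tmul a m =>
        induction Y with
        | zero => simp
        | add x y hx hy => simp only [map_add, TensorProduct.tmul_add, hx, hy]
        | tmul b n =>
          simp only [slice, LinearMap.rTensor_tmul, LinearMap.comp_apply,
            TensorProduct.tensorTensorTensorComm_tmul, LinearEquiv.coe_coe, LinearMap.convMul_def,
            TensorProduct.comul_tmul]
          hopf_tensor_induction comul (R := ℂ) a with a₁ a₂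
          hopf_tensor_induction comul (R := ℂ) b with b₁ b₂
          simp [smul_smul, mul_comm]
    have := key (δM m) (δN n)
    rw [← hM, ← hN, key2] at this
    simpa [twistOp, legs] using this

/-- The product of `A` as a coalgebra map. -/
def mulCoalg (A : Type u) [Ring A] [HopfAlgebra ℂ A] : A ⊗[ℂ] A →ₗc[ℂ] A where
  toLinearMap := LinearMap.mul' ℂ A
  counit_comp := by ext a b; simp [mul_comm]
  map_comp_comul := by
    ext a b
    simp only [TensorProduct.AlgebraTensorModule.curry_apply, LinearMap.restrictScalars_self,
      TensorProduct.curry_apply, LinearMap.comp_apply, TensorProduct.comul_tmul,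
      LinearMap.mul'_apply, Bialgebra.comul_mul]
    hopf_tensor_induction comul (R := ℂ) a with a₁ a₂
    hopf_tensor_induction comul (R := ℂ) b with b₁ b₂
    simp

/-- `x ⊗ (y ⊗ z) ↦ ε(z) x ⊗ y` -/
def face12 (A : Type u) [Ring A] [HopfAlgebra ℂ A] : A ⊗[ℂ] (A ⊗[ℂ] A) →ₗc[ℂ] A ⊗[ℂ] A :=
  Coalgebra.TensorProduct.map (CoalgHom.id ℂ A)
    ((Coalgebra.TensorProduct.rid ℂ ℂ A).toCoalgHom.comp
      (Coalgebra.TensorProduct.map (CoalgHom.id ℂ A) (Coalgebra.counitCoalgHom ℂ A)))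

/-- `x ⊗ (y ⊗ z) ↦ ε(x) y ⊗ z` -/
def face23 (A : Type u) [Ring A] [HopfAlgebra ℂ A] : A ⊗[ℂ] (A ⊗[ℂ] A) →ₗc[ℂ] A ⊗[ℂ] A :=
  (Coalgebra.TensorProduct.lid ℂ (A ⊗[ℂ] A)).toCoalgHom.comp
    (Coalgebra.TensorProduct.map (Coalgebra.counitCoalgHom ℂ A) (CoalgHom.id ℂ (A ⊗[ℂ] A)))

/-- `x ⊗ (y ⊗ z) ↦ xy ⊗ z` -/
def faceM1 (A : Type u) [Ring A] [HopfAlgebra ℂ A] : A ⊗[ℂ] (A ⊗[ℂ] A) →ₗc[ℂ] A ⊗[ℂ] A :=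
  (Coalgebra.TensorProduct.map (mulCoalg A) (CoalgHom.id ℂ A)).comp
    (Coalgebra.TensorProduct.assoc ℂ ℂ A A A).symm.toCoalgHom

/-- `x ⊗ (y ⊗ z) ↦ x ⊗ yz` -/
def face1M (A : Type u) [Ring A] [HopfAlgebra ℂ A] : A ⊗[ℂ] (A ⊗[ℂ] A) →ₗc[ℂ] A ⊗[ℂ] A :=
  Coalgebra.TensorProduct.map (CoalgHom.id ℂ A) (mulCoalg A)

/-- Restriction of a functional along a coalgebra map. -/
def pull {C D : Type u} [AddCommGroup C] [Module ℂ C] [Coalgebra ℂ C]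
    [AddCommGroup D] [Module ℂ D] [Coalgebra ℂ D] (p : D →ₗc[ℂ] C) (f : C →ₗ[ℂ] ℂ) :
    WithConv (D →ₗ[ℂ] ℂ) := toConv (f ∘ₗ p.toLinearMap)

theorem pull_mul {C D : Type u} [AddCommGroup C] [Module ℂ C] [Coalgebra ℂ C]
    [AddCommGroup D] [Module ℂ D] [Coalgebra ℂ D] (p : D →ₗc[ℂ] C) (f g : C →ₗ[ℂ] ℂ)
    (hfg : toConv f * toConv g = 1) : pull p f * pull p g = 1 := by
  have h := LinearMap.convMul_comp_coalgHom_distrib (toConv f) (toConv g) p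
  have h2 : pull p f * pull p g = toConv ((1 : WithConv (C →ₗ[ℂ] ℂ)).ofConv ∘ₗ p.toLinearMap) := by
    rw [← hfg, h]; rfl
  rw [h2, LinearMap.convOne_def, LinearMap.convOne_def]
  congr 1
  rw [LinearMap.comp_assoc, p.counit_comp]

theorem TwoCocycle.cocycle_faces (c : TwoCocycle A) :
    pull (face12 A) c.γ * pull (faceM1 A) c.γ = pull (face23 A) c.γ * pull (face1M A) c.γ := by
  have h1 : ∀ x y z : A, (pull (face12 A) c.γ * pull (faceM1 A) c.γ) (x ⊗ₜ (y ⊗ₜ z)) =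
    (toConv c.γ * toConv (c.γ ∘ₗ (TensorProduct.mk ℂ A A).flip z ∘ₗ LinearMap.mul' ℂ A))
      (x ⊗ₜ y) := by
    intro x y z
    simp only [LinearMap.convMul_apply, TensorProduct.comul_tmul, pull]
    hopf_tensor_induction comul (R := ℂ) x with x₁ x₂
    hopf_tensor_induction comul (R := ℂ) y with y₁ y₂
    conv_rhs => rw [← Coalgebra.sum_counit_smul (Coalgebra.Repr.arbitrary ℂ z)]
    rw [← (Coalgebra.Repr.arbitrary ℂ z).eq]
    simp only [TensorProduct.tmul_sum, map_sum]
    simp [face12, faceM1, mulCoalg, Finset.mul_sum, mul_left_comm, mul_assoc]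
  have h2 : ∀ x y z : A, (pull (face23 A) c.γ * pull (face1M A) c.γ) (x ⊗ₜ (y ⊗ₜ z)) =
    (toConv c.γ * toConv (c.γ ∘ₗ TensorProduct.mk ℂ A A x ∘ₗ LinearMap.mul' ℂ A))
      (y ⊗ₜ z) := by
    intro x y z
    simp only [LinearMap.convMul_apply, TensorProduct.comul_tmul, pull]
    hopf_tensor_induction comul (R := ℂ) y with y₁ y₂
    hopf_tensor_induction comul (R := ℂ) z with z₁ z₂
    conv_rhs => rw [← Coalgebra.sum_counit_smul (Coalgebra.Repr.arbitrary ℂ x)]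
    rw [← (Coalgebra.Repr.arbitrary ℂ x).eq]
    simp only [TensorProduct.sum_tmul, map_sum]
    simp [face23, face1M, mulCoalg, Finset.mul_sum, mul_left_comm, mul_assoc]
  have h3 : (pull (face12 A) c.γ * pull (faceM1 A) c.γ).ofConv =
      (pull (face23 A) c.γ * pull (face1M A) c.γ).ofConv := by
    ext x y z
    exact ((h1 x y z).trans (c.cocycle x y z)).trans (h2 x y z).symm
  exact congrArg toConv h3

theorem TwoCocycle.inv_faces (c : TwoCocycle A) :
    pull (faceM1 A) c.inv * pull (face12 A) c.inv =
      pull (face1M A) c.inv * pull (face23 A) c.inv := by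
  have h := c.cocycle_faces
  have a1 := pull_mul (faceM1 A) _ _ c.inv_mul
  have a2 := pull_mul (face12 A) _ _ c.inv_mul
  have a3 := pull_mul (face1M A) _ _ c.mul_inv
  have a4 := pull_mul (face23 A) _ _ c.mul_inv
  have L : (pull (faceM1 A) c.inv * pull (face12 A) c.inv) *
      (pull (face12 A) c.γ * pull (faceM1 A) c.γ) = 1 := by
    rw [mul_assoc, ← mul_assoc (pull (face12 A) c.inv), a2, one_mul, a1]
  have R : (pull (face23 A) c.γ * pull (face1M A) c.γ) *
      (pull (face1M A) c.inv * pull (face23 A) c.inv) = 1 := by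
    rw [mul_assoc, ← mul_assoc (pull (face1M A) c.γ), a3, one_mul, a4]
  rw [h] at L
  exact left_inv_eq_right_inv L R

theorem sum_smul_counit (a : A) : ∑ i ∈ (Coalgebra.Repr.arbitrary ℂ a).index,
    counit (R := ℂ) ((Coalgebra.Repr.arbitrary ℂ a).right i) •
      (Coalgebra.Repr.arbitrary ℂ a).left i = a := by
  have h := congrArg (TensorProduct.rid ℂ A)
    (Coalgebra.sum_tmul_counit_eq (R := ℂ) (Coalgebra.Repr.arbitrary ℂ a))
  simpa only [map_sum, TensorProduct.rid_tmul, one_smul] using h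

/-- `γ̄(g₁h₁ ⊗ k) γ̄(g₂ ⊗ h₂) = γ̄(g ⊗ h₁k₁) γ̄(h₂ ⊗ k₂)` -/
theorem TwoCocycle.inv_cocycle (c : TwoCocycle A) (x y z : A) :
    (toConv (c.inv ∘ₗ (TensorProduct.mk ℂ A A).flip z ∘ₗ LinearMap.mul' ℂ A) * toConv c.inv)
      (x ⊗ₜ y) =
    (toConv (c.inv ∘ₗ TensorProduct.mk ℂ A A x ∘ₗ LinearMap.mul' ℂ A) * toConv c.inv)
      (y ⊗ₜ z) := by
  have h1 : (pull (faceM1 A) c.inv * pull (face12 A) c.inv) (x ⊗ₜ (y ⊗ₜ z)) =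
      (toConv (c.inv ∘ₗ (TensorProduct.mk ℂ A A).flip z ∘ₗ LinearMap.mul' ℂ A) * toConv c.inv)
        (x ⊗ₜ y) := by
    simp only [LinearMap.convMul_apply, TensorProduct.comul_tmul, pull]
    hopf_tensor_induction comul (R := ℂ) x with x₁ x₂
    hopf_tensor_induction comul (R := ℂ) y with y₁ y₂
    conv_rhs => rw [← sum_smul_counit z]
    rw [← (Coalgebra.Repr.arbitrary ℂ z).eq]
    simp only [TensorProduct.tmul_sum, map_sum]
    simp [face12, faceM1, mulCoalg, Finset.sum_mul, mul_left_comm, mul_assoc]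
  have h2 : (pull (face1M A) c.inv * pull (face23 A) c.inv) (x ⊗ₜ (y ⊗ₜ z)) =
      (toConv (c.inv ∘ₗ TensorProduct.mk ℂ A A x ∘ₗ LinearMap.mul' ℂ A) * toConv c.inv)
        (y ⊗ₜ z) := by
    simp only [LinearMap.convMul_apply, TensorProduct.comul_tmul, pull]
    hopf_tensor_induction comul (R := ℂ) y with y₁ y₂
    hopf_tensor_induction comul (R := ℂ) z with z₁ z₂
    conv_rhs => rw [← sum_smul_counit x]
    rw [← (Coalgebra.Repr.arbitrary ℂ x).eq]
    simp only [TensorProduct.sum_tmul, map_sum]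
    simp [face23, face1M, mulCoalg, Finset.sum_mul, mul_left_comm, mul_assoc]
  rw [← h1, ← h2, c.inv_faces]

theorem twistOp_one {δM : M →ₗ[ℂ] A ⊗[ℂ] M} {δN : N →ₗ[ℂ] A ⊗[ℂ] N}
    (hM : ∀ m, slice (counit (R := ℂ)) (δM m) = m) (hN : ∀ n, slice (counit (R := ℂ)) (δN n) = n)
    (t : M ⊗[ℂ] N) : twistOp (1 : WithConv (A ⊗[ℂ] A →ₗ[ℂ] ℂ)).ofConv δM δN t = t := by
  induction t with
  | zero => simp
  | add x y hx hy => simp only [map_add, hx, hy]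
  | tmul m n =>
    have key : ∀ (X : A ⊗[ℂ] M) (Y : A ⊗[ℂ] N),
        slice (1 : WithConv (A ⊗[ℂ] A →ₗ[ℂ] ℂ)).ofConv
          (TensorProduct.tensorTensorTensorComm ℂ A M A N (X ⊗ₜ Y)) =
        slice (counit (R := ℂ)) X ⊗ₜ slice (counit (R := ℂ)) Y := by
      intro X Y
      induction X with
      | zero => simp
      | add x y hx hy => simp only [map_add, TensorProduct.add_tmul, hx, hy]
      | tmul a m =>
        induction Y with
        | zero => simp
        | add x y hx hy => simp only [map_add, TensorProduct.tmul_add, hx, hy]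
        | tmul b n =>
          simp [slice, LinearMap.convOne_def, ← TensorProduct.smul_tmul', smul_smul, mul_comm]
    have := key (δM m) (δN n)
    rw [hM, hN] at this
    simpa [twistOp, legs] using this

end Helpers

namespace CalculusData

section Deformation

variable {A : Type u} [Ring A] [HopfAlgebra ℂ A] [StarRing A] [StarModule ℂ A]
  [IsHopfStarAlgebra A]
variable {Ω : ℕ → Type v} [∀ k, AddCommGroup (Ω k)] [∀ k, Module ℂ (Ω k)]

/-- The twisted calculus `(Ω_γ^•, ∧_γ, d_γ)`, with the same underlying spaces, unit, differential
and coaction, and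
* `ω ∧_γ η = γ(ω₍₋₁₎ ⊗ η₍₋₁₎) ω₍₀₎ ∧ η₍₀₎`,
* `ω^{*_γ} = V̄(ω₍₋₁₎^*) ω₍₀₎^*`.
In degrees `0` and `1` this is the `*`-algebra `B_γ` and the `B_γ`-bimodule `Ω_γ^1`. -/
def twist (C : CalculusData A Ω) (c : TwoCocycle A) : CalculusData A Ω where
  wedge k l := TensorProduct.curry
    (TensorProduct.lift (C.wedge k l) ∘ₗ twistOp c.γ (C.coact k) (C.coact l))
  one := C.one
  d := C.d
  coact := C.coact
  star k := slice c.Vbar ∘ₛₗ (TensorProduct.map (starMap A) (C.star k) ∘ₛₗ C.coact k)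


section Phi

variable {C : CalculusData A Ω}

local notation "τ" => TensorProduct.tensorTensorTensorComm ℂ A _ A _

theorem proj_ract (C : CalculusData A Ω) (e : Ω 1) (b : Ω 0) (e' : Ω 1) :
    C.proj (C.ract e b ⊗ₜ e') = C.proj (e ⊗ₜ C.lact b e') := by
  rw [← sub_eq_zero, ← map_sub]
  exact (Submodule.Quotient.mk_eq_zero _).2 (Submodule.subset_span ⟨e, b, e', rfl⟩)

/-- `(a ⊗ m) ⊗ (b ⊗ n) ↦ ab ⊗ w(m, n)` -/
def mulLeg {M N P : Type*} [AddCommMonoid M] [Module ℂ M]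
    [AddCommMonoid N] [Module ℂ N] [AddCommMonoid P] [Module ℂ P] (w : M →ₗ[ℂ] N →ₗ[ℂ] P) :
    (A ⊗[ℂ] M) ⊗[ℂ] (A ⊗[ℂ] N) →ₗ[ℂ] A ⊗[ℂ] P :=
  (TensorProduct.lift w).lTensor A ∘ₗ (LinearMap.mul' ℂ A).rTensor (M ⊗[ℂ] N) ∘ₗ
    (TensorProduct.tensorTensorTensorComm ℂ A M A N).toLinearMap

theorem coact_ract (hC : C.IsCovariantStarCalculus (HopfStarData.of A)) (e : Ω 1) (b : Ω 0) :
    C.coact 1 (C.ract e b) = mulLeg C.ract (C.coact 1 e ⊗ₜ C.coact 0 b) :=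
  hC.coact_wedge 1 0 e b

theorem coact_lact (hC : C.IsCovariantStarCalculus (HopfStarData.of A)) (b : Ω 0) (e : Ω 1) :
    C.coact 1 (C.lact b e) = mulLeg C.lact (C.coact 0 b ⊗ₜ C.coact 1 e) :=
  hC.coact_wedge 0 1 b e

theorem coact_wedge_slice (hC : C.IsCovariantStarCalculus (HopfStarData.of A))
    (F : A ⊗[ℂ] A →ₗ[ℂ] ℂ) (k l : ℕ) (X : A ⊗[ℂ] Ω k) (Y : A ⊗[ℂ] Ω l) :
    C.coact (k + l) (TensorProduct.lift (C.wedge k l) (slice F (τ (X ⊗ₜ Y)))) =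
      mulLeg (C.wedge k l) (slice F (τ ((C.coact k).lTensor A X ⊗ₜ (C.coact l).lTensor A Y))) := by
  induction X with
  | zero => simp
  | add x y hx hy => simp only [map_add, TensorProduct.add_tmul, hx, hy]
  | tmul a m =>
    induction Y with
    | zero => simp
    | add x y hx hy => simp only [map_add, TensorProduct.tmul_add, hx, hy]
    | tmul b n =>
      have := hC.coact_wedge k l m n
      simp only [slice, LinearMap.comp_apply, LinearMap.rTensor_tmul, LinearMap.lTensor_tmul,
        TensorProduct.tensorTensorTensorComm_tmul, LinearEquiv.coe_coe, TensorProduct.lid_tmul,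
        map_smul, TensorProduct.lift.tmul, this]
      rfl

theorem balanced_le_ker (hC : C.IsCovariantStarCalculus (HopfStarData.of A)) (c : TwoCocycle A) :
    (C.twist c).balanced ≤ C.balanced.comap (twistOp c.γ (C.coact 1) (C.coact 1)) := by
  refine Submodule.span_le.2 ?_
  rintro _ ⟨e, b, e', rfl⟩
  have key : ∀ (X : A ⊗[ℂ] Ω 1) (Y : A ⊗[ℂ] Ω 0) (Z : A ⊗[ℂ] Ω 1),
      C.proj (slice c.γ (τ (mulLeg C.ract (slice c.γ (τ (
        TensorProduct.assoc ℂ A A _ ((comul (R := ℂ)).rTensor _ X) ⊗ₜ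
        TensorProduct.assoc ℂ A A _ ((comul (R := ℂ)).rTensor _ Y)))) ⊗ₜ Z))) =
      C.proj (slice c.γ (τ (X ⊗ₜ mulLeg C.lact (slice c.γ (τ (
        TensorProduct.assoc ℂ A A _ ((comul (R := ℂ)).rTensor _ Y) ⊗ₜ
        TensorProduct.assoc ℂ A A _ ((comul (R := ℂ)).rTensor _ Z))))))) := by
    intro X Y Z
    induction X with
    | zero => simp
    | add x y hx hy => simp only [map_add, TensorProduct.add_tmul, hx, hy]
    | tmul x e =>
    induction Y with
    | zero => simp
    | add x y hx hy => simp only [map_add, TensorProduct.tmul_add, TensorProduct.add_tmul, hx, hy]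
    | tmul y b =>
    induction Z with
    | zero => simp
    | add x y hx hy => simp only [map_add, TensorProduct.tmul_add, hx, hy]
    | tmul z e' =>
    have h1 : (slice c.γ (τ (mulLeg C.ract (slice c.γ (τ (
        TensorProduct.assoc ℂ A A _ ((comul (R := ℂ)).rTensor _ (x ⊗ₜ e)) ⊗ₜ
        TensorProduct.assoc ℂ A A _ ((comul (R := ℂ)).rTensor _ (y ⊗ₜ b))))) ⊗ₜ (z ⊗ₜ e')))) =
        TensorProduct.lid ℂ _ ((toConv c.γ * toConv (c.γ ∘ₗ (TensorProduct.mk ℂ A A).flip z ∘ₗ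
          LinearMap.mul' ℂ A)) (x ⊗ₜ y) ⊗ₜ (C.ract e b ⊗ₜ e')) := by
      simp only [slice, mulLeg, LinearMap.convMul_apply, TensorProduct.comul_tmul,
        LinearMap.rTensor_tmul]
      hopf_tensor_induction comul (R := ℂ) x with x₁ x₂
      hopf_tensor_induction comul (R := ℂ) y with y₁ y₂
      simp [← TensorProduct.smul_tmul', smul_smul]
    have h2 : (slice c.γ (τ ((x ⊗ₜ e) ⊗ₜ mulLeg C.lact (slice c.γ (τ (
        TensorProduct.assoc ℂ A A _ ((comul (R := ℂ)).rTensor _ (y ⊗ₜ b)) ⊗ₜ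
        TensorProduct.assoc ℂ A A _ ((comul (R := ℂ)).rTensor _ (z ⊗ₜ e')))))))) =
        TensorProduct.lid ℂ _ ((toConv c.γ * toConv (c.γ ∘ₗ TensorProduct.mk ℂ A A x ∘ₗ
          LinearMap.mul' ℂ A)) (y ⊗ₜ z) ⊗ₜ (e ⊗ₜ C.lact b e')) := by
      simp only [slice, mulLeg, LinearMap.convMul_apply, TensorProduct.comul_tmul,
        LinearMap.rTensor_tmul]
      hopf_tensor_induction comul (R := ℂ) y with y₁ y₂
      hopf_tensor_induction comul (R := ℂ) z with z₁ z₂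
      simp [smul_smul, mul_comm]
    rw [h1, h2, TensorProduct.lid_tmul, TensorProduct.lid_tmul, map_smul, map_smul, proj_ract,
      c.cocycle x y z]
  have k := key (C.coact 1 e) (C.coact 0 b) (C.coact 1 e')
  rw [hC.coact_coassoc, hC.coact_coassoc, hC.coact_coassoc] at k
  have i1 := coact_wedge_slice hC c.γ 1 0 (C.coact 1 e) (C.coact 0 b)
  have i2 := coact_wedge_slice hC c.γ 0 1 (C.coact 0 b) (C.coact 1 e')
  change twistOp c.γ (C.coact 1) (C.coact 1) _ ∈ C.balanced
  rw [← Submodule.Quotient.mk_eq_zero, map_sub]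
  change C.proj _ = 0
  rw [map_sub, sub_eq_zero]
  have j1 : C.coact 1 ((C.twist c).ract e b) = _ := i1
  have j2 : C.coact 1 ((C.twist c).lact b e') = _ := i2
  simp only [twistOp, legs, LinearMap.comp_apply, TensorProduct.map_tmul, LinearEquiv.coe_coe]
  rw [j1, j2]
  exact k

theorem wedge_eq_twist (hC : C.IsCovariantStarCalculus (HopfStarData.of A)) (c : TwoCocycle A)
    (k l : ℕ) (ω : Ω k) (η : Ω l) :
    C.wedge k l ω η = TensorProduct.lift ((C.twist c).wedge k l)
      (twistOp c.inv (C.coact k) (C.coact l) (ω ⊗ₜ η)) := by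
  have h : TensorProduct.lift ((C.twist c).wedge k l) =
      TensorProduct.lift (C.wedge k l) ∘ₗ twistOp c.γ (C.coact k) (C.coact l) := by
    ext; simp [twist]
  rw [h, LinearMap.comp_apply, twistOp_twistOp _ _ (hC.coact_coassoc k) (hC.coact_coassoc l),
    c.inv_mul, twistOp_one (hC.coact_counit k) (hC.coact_counit l), TensorProduct.lift.tmul]

theorem mulLeg_eq_twist (hC : C.IsCovariantStarCalculus (HopfStarData.of A)) (c : TwoCocycle A)
    (k l : ℕ) (X : A ⊗[ℂ] Ω k) (Y : A ⊗[ℂ] Ω l) :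
    mulLeg (C.wedge k l) (X ⊗ₜ Y) =
      mulLeg (TensorProduct.curry (TensorProduct.lift ((C.twist c).wedge k l) ∘ₗ slice c.inv ∘ₗ
          (TensorProduct.tensorTensorTensorComm ℂ A (Ω k) A (Ω l)).toLinearMap))
        ((C.coact k).lTensor A X ⊗ₜ (C.coact l).lTensor A Y) := by
  induction X with
  | zero => simp
  | add x y hx hy => simp only [map_add, TensorProduct.add_tmul, hx, hy]
  | tmul a m =>
    induction Y with
    | zero => simp
    | add x y hx hy => simp only [map_add, TensorProduct.tmul_add, hx, hy]
    | tmul b n =>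
      simp only [mulLeg, LinearMap.comp_apply, LinearMap.rTensor_tmul, LinearMap.lTensor_tmul,
        TensorProduct.tensorTensorTensorComm_tmul, LinearEquiv.coe_coe, TensorProduct.lift.tmul,
        wedge_eq_twist hC c, TensorProduct.curry_apply]
      rfl

theorem balanced_le_ker_inv (hC : C.IsCovariantStarCalculus (HopfStarData.of A))
    (c : TwoCocycle A) :
    C.balanced ≤ (C.twist c).balanced.comap (twistOp c.inv (C.coact 1) (C.coact 1)) := by
  refine Submodule.span_le.2 ?_
  rintro _ ⟨e, b, e', rfl⟩
  have key : ∀ (X : A ⊗[ℂ] Ω 1) (Y : A ⊗[ℂ] Ω 0) (Z : A ⊗[ℂ] Ω 1),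
      (C.twist c).proj (slice c.inv (τ (mulLeg
        (TensorProduct.curry (TensorProduct.lift (C.twist c).ract ∘ₗ slice c.inv ∘ₗ
          (TensorProduct.tensorTensorTensorComm ℂ A (Ω 1) A (Ω 0)).toLinearMap))
        (TensorProduct.assoc ℂ A A _ ((comul (R := ℂ)).rTensor _ X) ⊗ₜ
        TensorProduct.assoc ℂ A A _ ((comul (R := ℂ)).rTensor _ Y)) ⊗ₜ Z))) =
      (C.twist c).proj (slice c.inv (τ (X ⊗ₜ mulLeg
        (TensorProduct.curry (TensorProduct.lift (C.twist c).lact ∘ₗ slice c.inv ∘ₗ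
          (TensorProduct.tensorTensorTensorComm ℂ A (Ω 0) A (Ω 1)).toLinearMap))
        (TensorProduct.assoc ℂ A A _ ((comul (R := ℂ)).rTensor _ Y) ⊗ₜ
        TensorProduct.assoc ℂ A A _ ((comul (R := ℂ)).rTensor _ Z))))) := by
    intro X Y Z
    induction X with
    | zero => simp
    | add x y hx hy => simp only [map_add, TensorProduct.add_tmul, hx, hy]
    | tmul x e =>
    induction Y with
    | zero => simp
    | add x y hx hy => simp only [map_add, TensorProduct.tmul_add, TensorProduct.add_tmul, hx, hy]
    | tmul y b =>
    induction Z with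
    | zero => simp
    | add x y hx hy => simp only [map_add, TensorProduct.tmul_add, hx, hy]
    | tmul z e' =>
    have h1 : slice c.inv (τ (mulLeg
        (TensorProduct.curry (TensorProduct.lift (C.twist c).ract ∘ₗ slice c.inv ∘ₗ
          (TensorProduct.tensorTensorTensorComm ℂ A (Ω 1) A (Ω 0)).toLinearMap))
        (TensorProduct.assoc ℂ A A _ ((comul (R := ℂ)).rTensor _ (x ⊗ₜ e)) ⊗ₜ
        TensorProduct.assoc ℂ A A _ ((comul (R := ℂ)).rTensor _ (y ⊗ₜ b))) ⊗ₜ (z ⊗ₜ e'))) =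
        TensorProduct.lid ℂ _ ((toConv (c.inv ∘ₗ (TensorProduct.mk ℂ A A).flip z ∘ₗ
          LinearMap.mul' ℂ A) * toConv c.inv) (x ⊗ₜ y) ⊗ₜ ((C.twist c).ract e b ⊗ₜ e')) := by
      simp only [slice, mulLeg, LinearMap.convMul_apply, TensorProduct.comul_tmul,
        LinearMap.rTensor_tmul]
      hopf_tensor_induction comul (R := ℂ) x with x₁ x₂
      hopf_tensor_induction comul (R := ℂ) y with y₁ y₂
      simp [← TensorProduct.smul_tmul', smul_smul, mul_comm]
    have h2 : slice c.inv (τ ((x ⊗ₜ e) ⊗ₜ mulLeg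
        (TensorProduct.curry (TensorProduct.lift (C.twist c).lact ∘ₗ slice c.inv ∘ₗ
          (TensorProduct.tensorTensorTensorComm ℂ A (Ω 0) A (Ω 1)).toLinearMap))
        (TensorProduct.assoc ℂ A A _ ((comul (R := ℂ)).rTensor _ (y ⊗ₜ b)) ⊗ₜ
        TensorProduct.assoc ℂ A A _ ((comul (R := ℂ)).rTensor _ (z ⊗ₜ e'))))) =
        TensorProduct.lid ℂ _ ((toConv (c.inv ∘ₗ TensorProduct.mk ℂ A A x ∘ₗ
          LinearMap.mul' ℂ A) * toConv c.inv) (y ⊗ₜ z) ⊗ₜ (e ⊗ₜ (C.twist c).lact b e')) := by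
      simp only [slice, mulLeg, LinearMap.convMul_apply, TensorProduct.comul_tmul,
        LinearMap.rTensor_tmul]
      hopf_tensor_induction comul (R := ℂ) y with y₁ y₂
      hopf_tensor_induction comul (R := ℂ) z with z₁ z₂
      simp [smul_smul, mul_comm]
    rw [h1, h2, TensorProduct.lid_tmul, TensorProduct.lid_tmul, map_smul, map_smul, proj_ract,
      c.inv_cocycle x y z]
  have k := key (C.coact 1 e) (C.coact 0 b) (C.coact 1 e')
  rw [hC.coact_coassoc, hC.coact_coassoc, hC.coact_coassoc] at k
  have i1 := mulLeg_eq_twist hC c 1 0 (C.coact 1 e) (C.coact 0 b)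
  have i2 := mulLeg_eq_twist hC c 0 1 (C.coact 0 b) (C.coact 1 e')
  change twistOp c.inv (C.coact 1) (C.coact 1) _ ∈ (C.twist c).balanced
  rw [← Submodule.Quotient.mk_eq_zero, map_sub]
  change (C.twist c).proj _ = 0
  rw [map_sub, sub_eq_zero]
  have j1 : C.coact 1 (C.ract e b) = _ := (coact_ract hC e b).trans i1
  have j2 : C.coact 1 (C.lact b e') = _ := (coact_lact hC b e').trans i2
  simp only [twistOp, legs, LinearMap.comp_apply, TensorProduct.map_tmul, LinearEquiv.coe_coe]
  rw [j1, j2]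
  exact k

end Phi

/-- `φ : Ω_γ^1 ⊗_{B_γ} Ω_γ^1 → Ω^1 ⊗_B Ω^1`, `ω ⊗ η ↦ γ(ω₍₋₁₎ ⊗ η₍₋₁₎) ω₍₀₎ ⊗ η₍₀₎`. -/
def phi {C : CalculusData A Ω} (hC : C.IsCovariantStarCalculus (HopfStarData.of A))
    (c : TwoCocycle A) : (C.twist c).FormTensor →ₗ[ℂ] C.FormTensor :=
  (C.twist c).balanced.mapQ C.balanced (twistOp c.γ (C.coact 1) (C.coact 1))
    (balanced_le_ker hC c)

/-- The inverse map `φ⁻¹ : Ω^1 ⊗_B Ω^1 → Ω_γ^1 ⊗_{B_γ} Ω_γ^1`,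
`ω ⊗ η ↦ γ̄(ω₍₋₁₎ ⊗ η₍₋₁₎) ω₍₀₎ ⊗ η₍₀₎`. -/
def phiInv {C : CalculusData A Ω} (hC : C.IsCovariantStarCalculus (HopfStarData.of A))
    (c : TwoCocycle A) : C.FormTensor →ₗ[ℂ] (C.twist c).FormTensor :=
  C.balanced.mapQ (C.twist c).balanced (twistOp c.inv (C.coact 1) (C.coact 1))
    (balanced_le_ker_inv hC c)

/-- The twisted metric `(g_γ, ( , )_γ) = (φ⁻¹(g), ( , ) ∘ φ)` on `Ω_γ^1`. -/
def MetricData.twist {C : CalculusData A Ω}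
    (hC : C.IsCovariantStarCalculus (HopfStarData.of A)) (m : C.MetricData) (c : TwoCocycle A) :
    (C.twist c).MetricData where
  g := phiInv hC c m.g
  pair := m.pair ∘ₗ phi hC c

/-- `𝔑 : \overline{Γ(Ω^1)} → Γ(Ω̄^1)`, `ē ↦ V̄(e₍₋₁₎^*) \overline{e₍₀₎}`. -/
def frakN (C : CalculusData A Ω) (c : TwoCocycle A) : Bar (Ω 1) →ₗ[ℂ] Bar (Ω 1) :=
  slice c.Vbar ∘ₗ C.barCoact (HopfStarData.of A)

/-- `𝔖 : Γ(Hom_B(Ω^1, B)) → Hom_{B_γ}(Γ(Ω^1), B_γ)`,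
`𝔖(f)(v) = γ(v₍₋₂₎ ⊗ S(v₍₋₁₎) f(v₍₀₎)₍₋₁₎) f(v₍₀₎)₍₀₎`. -/
def frakS (C : CalculusData A Ω) (c : TwoCocycle A) :
    (Ω 1 →ₗ[ℂ] Ω 0) →ₗ[ℂ] (Ω 1 →ₗ[ℂ] Ω 0) where
  toFun f := slice c.γ ∘ₗ (TensorProduct.assoc ℂ A A (Ω 0)).symm.toLinearMap ∘ₗ
    (C.homCoact (HopfStarData.of A) f).lTensor A ∘ₗ C.coact 1
  map_add' f g := by ext; simp [LinearMap.lTensor_add]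
  map_smul' r f := by ext; simp [LinearMap.lTensor_smul]

/-- The `γ`-deformation `𝔥_γ = 𝔖 ∘ Γ(𝔥) ∘ 𝔑` of a Hermitian metric `𝔥` on `Ω^1`. -/
def deformHermitian (C : CalculusData A Ω) (c : TwoCocycle A)
    (h : Bar (Ω 1) →ₗ[ℂ] (Ω 1 →ₗ[ℂ] Ω 0)) : Bar (Ω 1) →ₗ[ℂ] (Ω 1 →ₗ[ℂ] Ω 0) :=
  C.frakS c ∘ₗ h ∘ₗ C.frakN c

end Deformation

end CalculusData

end CocycleTwist

end

/-!
# Cocycle twists of real covariant metrics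

All twisted products are instances of one construction. A functional `F` on a coalgebra acts on a
comodule by `v ↦ F(v₍₋₁₎) v₍₀₎` (`act`), and an equivariant map `w : M ⊗ N → X` has the twist
`w_γ(m ⊗ n) = γ(m₍₋₁₎ ⊗ n₍₋₁₎) w(m₍₀₎ ⊗ n₍₀₎)` (`twistMap`). This applies to the products and
actions of the calculus, to `( , )`, and to the projection `Ω^1 ⊗ Ω^1 → Ω^1 ⊗_B Ω^1`, whose twist is
`φ` composed with the projection for `B_γ`. Two lemmas carry identities over to the twist.

* `twistMap_assoc`: an associativity law `w₂(w₁(m ⊗ n) ⊗ p) = w₄(m ⊗ w₃(n ⊗ p))` implies the same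
  law for the twisted maps, by the cocycle identity. Bilinearity of `( , )_γ`, the contraction
  identities and the covariance of `b ↦ b · g_γ` are all of this form. In the last two, one factor is
  `φ(g_γ) = g`, which is coinvariant, so that `γ` disappears from the product with it because it is
  unital (`twistMap_g_left`, `twistMap_g_right`).
* `star_twistMap`: a law `w(m ⊗ n)^* = w'(n^* ⊗ m^*)` implies the same law for the twisted maps and
  the twisted involution `m ↦ V̄ ▷ m^*`. This rests on the identity
  `γ‡ * (V̄ ∘ μ) = (V̄ ⊗ V̄) * γ`, with `γ‡(a ⊗ b)` the complex conjugate of `γ(b^* ⊗ a^*)`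
  (`TwoCocycle.conj_γ_mul_Vbar`). Unitarity turns it into
  `(Ū ∘ μ)(q₁ ⊗ p₁) γ̄(q₂ ⊗ p₂) = γ(S(p₁) ⊗ S(q₁)) Ū(q₂) Ū(p₂)`, which follows from the cocycle
  identity. Applied to the products of the calculus it makes `*_γ` an involution of the twisted
  bimodule; applied to the projection it gives the reality of `g_γ`.

Identities involving the antipode are checked on the entries of matrix corepresentations, which span
`A` (`corep_ext`); there Sweedler sums become finite sums over matrix indices.

For a real covariant metric over any Hopf algebra, `𝔥_g` is a covariant Hermitian metric
(`isCovariantHermitianMetric`): the two contraction identities provide dual bases and the inverse of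
`𝔥_g`, reality gives `(ω, η)^* = (η^*, ω^*)`, and covariance follows from that of `( , )` and the
antipode axiom. The argument is applied to `A` and to `A_γ`; for the latter, associativity and the
antipode axiom of `A_γ` are needed (`TwoCocycle.isHopf_twistedHopf`).

Finally `𝔥_{g_γ} = (𝔥_g)_γ` because the covariance of `𝔥_g` evaluates the coaction on
`Hom_B(Ω^1, B)` in the definition of `𝔖`, after which both sides are
`γ(v₍₋₁₎ ⊗ y₍₋₁₎) (v₍₀₎, y₍₀₎)` with `y = ω^{*_γ}` (`toHermitian_twist`).
-/

noncomputable section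

namespace CocycleTwist

/-! ### Comodules and the action of functionals -/

section Comodules

variable {D E : Type*} [AddCommGroup D] [Module ℂ D] [Coalgebra ℂ D]
  [AddCommGroup E] [Module ℂ E] [Coalgebra ℂ E]
variable {V W M N P X Y Z : Type*} [AddCommGroup V] [Module ℂ V] [AddCommGroup W] [Module ℂ W]
  [AddCommGroup M] [Module ℂ M] [AddCommGroup N] [Module ℂ N] [AddCommGroup P] [Module ℂ P]
  [AddCommGroup X] [Module ℂ X] [AddCommGroup Y] [Module ℂ Y] [AddCommGroup Z] [Module ℂ Z]

/-- `δ` makes `V` a left comodule over the coalgebra `D`. -/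
structure IsCoaction (δ : V →ₗ[ℂ] D ⊗[ℂ] V) : Prop where
  coassoc : ∀ v, TensorProduct.assoc ℂ D D V ((comul (R := ℂ)).rTensor V (δ v)) =
    δ.lTensor D (δ v)
  counit : ∀ v, slice (counit (R := ℂ)) (δ v) = v

/-- The action `v ↦ F(v₍₋₁₎) v₍₀₎` of a functional on a comodule. -/
def act (δ : V →ₗ[ℂ] D ⊗[ℂ] V) (F : WithConv (D →ₗ[ℂ] ℂ)) : V →ₗ[ℂ] V := slice F.ofConv ∘ₗ δ

omit [Coalgebra ℂ D] in
@[simp]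
theorem slice_tmul (F : D →ₗ[ℂ] ℂ) (a : D) (v : V) : slice F (a ⊗ₜ[ℂ] v) = F a • v := by
  simp [slice]

omit [Coalgebra ℂ D] in
theorem act_apply (δ : V →ₗ[ℂ] D ⊗[ℂ] V) (F : WithConv (D →ₗ[ℂ] ℂ)) (v : V) :
    act δ F v = slice F.ofConv (δ v) := rfl

omit [Coalgebra ℂ D] in
theorem slice_lTensor (F : D →ₗ[ℂ] ℂ) (w : V →ₗ[ℂ] W) (t : D ⊗[ℂ] V) :
    slice F (w.lTensor D t) = w (slice F t) := by
  induction t with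
  | zero => simp
  | add x y hx hy => simp only [map_add, hx, hy]
  | tmul a v => simp

omit [Coalgebra ℂ D] [Coalgebra ℂ E] in
theorem slice_rTensor (F : E →ₗ[ℂ] ℂ) (p : D →ₗ[ℂ] E) (t : D ⊗[ℂ] V) :
    slice F (p.rTensor V t) = slice (F ∘ₗ p) t := by
  induction t with
  | zero => simp
  | add x y hx hy => simp only [map_add, hx, hy]
  | tmul a v => simp

omit [Coalgebra ℂ D] in
/-- Functionals on `D` separate the elements of `D ⊗ V`, since `D` is free over the field `ℂ`. -/
theorem ext_slice {s t : D ⊗[ℂ] V} (h : ∀ F : D →ₗ[ℂ] ℂ, slice F s = slice F t) : s = t := by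
  let b := Module.Free.chooseBasis ℂ D
  classical
  apply (TensorProduct.equivFinsuppOfBasisLeft (N := V) b).injective
  ext i
  rw [TensorProduct.equivFinsuppOfBasisLeft_apply, TensorProduct.equivFinsuppOfBasisLeft_apply]
  exact h _

theorem slice_convMul (F G : WithConv (D →ₗ[ℂ] ℂ)) (t : D ⊗[ℂ] V) :
    slice F.ofConv (slice G.ofConv
      (TensorProduct.assoc ℂ D D V ((comul (R := ℂ)).rTensor V t))) =
      slice (G * F).ofConv t := by
  induction t with
  | zero => simp
  | add x y hx hy => simp only [map_add, hx, hy]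
  | tmul a v =>
    simp only [LinearMap.rTensor_tmul, slice_tmul, LinearMap.convMul_def, LinearMap.comp_apply]
    generalize comul (R := ℂ) a = u
    induction u with
    | zero => simp
    | add x y hx hy => simp only [map_add, TensorProduct.add_tmul, add_smul, hx, hy]
    | tmul a₁ a₂ => simp [smul_smul]

/-- The functionals on `D` act from the right: the convolution product is reversed. -/
theorem act_act {δ : V →ₗ[ℂ] D ⊗[ℂ] V} (hδ : IsCoaction δ) (F G : WithConv (D →ₗ[ℂ] ℂ)) (v : V) :
    act δ F (act δ G v) = act δ (G * F) v := by
  simp only [act_apply]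
  rw [← slice_convMul, hδ.coassoc, slice_lTensor]

theorem act_one {δ : V →ₗ[ℂ] D ⊗[ℂ] V} (hδ : IsCoaction δ) (v : V) : act δ 1 v = v := by
  have : (1 : WithConv (D →ₗ[ℂ] ℂ)).ofConv = counit (R := ℂ) := by
    ext; simp [LinearMap.convOne_def]
  rw [act_apply, this, hδ.counit]

omit [Coalgebra ℂ D] [Coalgebra ℂ E] in
/-- Equivariant maps commute with the actions of functionals. -/
theorem act_map {δ : V →ₗ[ℂ] D ⊗[ℂ] V} {ε : W →ₗ[ℂ] E ⊗[ℂ] W} {p : D →ₗ[ℂ] E} {w : V →ₗ[ℂ] W}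
    (h : ∀ v, ε (w v) = TensorProduct.map p w (δ v)) (F : WithConv (E →ₗ[ℂ] ℂ)) (v : V) :
    act ε F (w v) = w (act δ (toConv (F.ofConv ∘ₗ p)) v) := by
  have : TensorProduct.map p w = p.rTensor W ∘ₗ w.lTensor D := by
    rw [LinearMap.rTensor_comp_lTensor]
  simp only [act_apply, h, this, LinearMap.comp_apply]
  rw [slice_rTensor, slice_lTensor]

/-- The tensor product of two comodules, as a comodule over the tensor product coalgebra. -/
def tens (δM : M →ₗ[ℂ] D ⊗[ℂ] M) (δN : N →ₗ[ℂ] E ⊗[ℂ] N) :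
    M ⊗[ℂ] N →ₗ[ℂ] (D ⊗[ℂ] E) ⊗[ℂ] (M ⊗[ℂ] N) :=
  (TensorProduct.tensorTensorTensorComm ℂ D M E N).toLinearMap ∘ₗ TensorProduct.map δM δN

omit [Coalgebra ℂ D] [Coalgebra ℂ E] in
theorem tens_tmul (δM : M →ₗ[ℂ] D ⊗[ℂ] M) (δN : N →ₗ[ℂ] E ⊗[ℂ] N) (m : M) (n : N) :
    tens δM δN (m ⊗ₜ n) = TensorProduct.tensorTensorTensorComm ℂ D M E N (δM m ⊗ₜ δN n) := rfl

theorem IsCoaction.tens {δM : M →ₗ[ℂ] D ⊗[ℂ] M} {δN : N →ₗ[ℂ] E ⊗[ℂ] N}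
    (hM : IsCoaction δM) (hN : IsCoaction δN) : IsCoaction (tens δM δN) where
  coassoc t := by
    induction t with
    | zero => simp
    | add x y hx hy => simp only [map_add, hx, hy]
    | tmul m n =>
      let G : (D ⊗[ℂ] (D ⊗[ℂ] M)) ⊗[ℂ] (E ⊗[ℂ] (E ⊗[ℂ] N)) →ₗ[ℂ]
          (D ⊗[ℂ] E) ⊗[ℂ] ((D ⊗[ℂ] E) ⊗[ℂ] (M ⊗[ℂ] N)) :=
        (TensorProduct.tensorTensorTensorComm ℂ D M E N).toLinearMap.lTensor (D ⊗[ℂ] E) ∘ₗ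
          (TensorProduct.tensorTensorTensorComm ℂ D (D ⊗[ℂ] M) E (E ⊗[ℂ] N)).toLinearMap
      have k1 : ∀ (s : D ⊗[ℂ] M) (t : E ⊗[ℂ] N),
          TensorProduct.assoc ℂ _ _ _ ((comul (R := ℂ)).rTensor _
            (TensorProduct.tensorTensorTensorComm ℂ D M E N (s ⊗ₜ t))) =
          G (TensorProduct.assoc ℂ D D M ((comul (R := ℂ)).rTensor M s) ⊗ₜ
            TensorProduct.assoc ℂ E E N ((comul (R := ℂ)).rTensor N t)) := by
        intro s t
        induction s with
        | zero => simp
        | add x y hx hy => simp only [map_add, TensorProduct.add_tmul, hx, hy]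
        | tmul a m =>
          induction t with
          | zero => simp
          | add x y hx hy => simp only [map_add, TensorProduct.tmul_add, hx, hy]
          | tmul b n =>
            simp only [LinearMap.rTensor_tmul,
              TensorProduct.tensorTensorTensorComm_tmul, TensorProduct.comul_tmul]
            hopf_tensor_induction comul (R := ℂ) a with a₁ a₂
            hopf_tensor_induction comul (R := ℂ) b with b₁ b₂
            simp [G]
      have k2 : ∀ (s : D ⊗[ℂ] M) (t : E ⊗[ℂ] N),
          (CocycleTwist.tens δM δN).lTensor _
            (TensorProduct.tensorTensorTensorComm ℂ D M E N (s ⊗ₜ t)) =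
          G (δM.lTensor D s ⊗ₜ δN.lTensor E t) := by
        intro s t
        induction s with
        | zero => simp
        | add x y hx hy => simp only [map_add, TensorProduct.add_tmul, hx, hy]
        | tmul a m =>
          induction t with
          | zero => simp
          | add x y hx hy => simp only [map_add, TensorProduct.tmul_add, hx, hy]
          | tmul b n => simp [G, tens_tmul]
      rw [tens_tmul, k1, k2, hM.coassoc, hN.coassoc]
  counit t := by
    induction t with
    | zero => simp
    | add x y hx hy => simp only [map_add, hx, hy]
    | tmul m n =>
      have k : ∀ (s : D ⊗[ℂ] M) (t : E ⊗[ℂ] N),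
          slice (Coalgebra.counit (R := ℂ))
            (TensorProduct.tensorTensorTensorComm ℂ D M E N (s ⊗ₜ t)) =
          slice (Coalgebra.counit (R := ℂ)) s ⊗ₜ slice (Coalgebra.counit (R := ℂ)) t := by
        intro s t
        induction s with
        | zero => simp
        | add x y hx hy => simp only [map_add, TensorProduct.add_tmul, hx, hy]
        | tmul a m =>
          induction t with
          | zero => simp
          | add x y hx hy => simp only [map_add, TensorProduct.tmul_add, hx, hy]
          | tmul b n =>
            simp [← TensorProduct.smul_tmul', smul_smul, mul_comm]
      rw [tens_tmul, k, hM.counit, hN.counit]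

/-- The functional `a ⊗ b ↦ F(a) G(b)`. -/
def outer (F : WithConv (D →ₗ[ℂ] ℂ)) (G : WithConv (E →ₗ[ℂ] ℂ)) :
    WithConv (D ⊗[ℂ] E →ₗ[ℂ] ℂ) :=
  toConv (LinearMap.mul' ℂ ℂ ∘ₗ TensorProduct.map F.ofConv G.ofConv)

omit [Coalgebra ℂ D] [Coalgebra ℂ E] in
theorem outer_tmul (F : WithConv (D →ₗ[ℂ] ℂ)) (G : WithConv (E →ₗ[ℂ] ℂ)) (a : D) (b : E) :
    outer F G (a ⊗ₜ b) = F a * G b := rfl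

omit [Coalgebra ℂ D] [Coalgebra ℂ E] in
theorem act_outer (δM : M →ₗ[ℂ] D ⊗[ℂ] M) (δN : N →ₗ[ℂ] E ⊗[ℂ] N)
    (F : WithConv (D →ₗ[ℂ] ℂ)) (G : WithConv (E →ₗ[ℂ] ℂ)) (m : M) (n : N) :
    act (tens δM δN) (outer F G) (m ⊗ₜ n) = act δM F m ⊗ₜ act δN G n := by
  simp only [act_apply, tens_tmul]
  generalize δM m = s
  generalize δN n = t
  induction s with
  | zero => simp
  | add x y hx hy => simp only [map_add, TensorProduct.add_tmul, hx, hy]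
  | tmul a m =>
    induction t with
    | zero => simp
    | add x y hx hy => simp only [map_add, TensorProduct.tmul_add, hx, hy]
    | tmul b n => simp [outer, ← TensorProduct.smul_tmul', smul_smul, mul_comm]

end Comodules

section Faces

variable {A : Type*} [Ring A] [HopfAlgebra ℂ A]
variable {M N P X Y Z : Type*}
  [AddCommGroup M] [Module ℂ M] [AddCommGroup N] [Module ℂ N] [AddCommGroup P] [Module ℂ P]
  [AddCommGroup X] [Module ℂ X] [AddCommGroup Y] [Module ℂ Y] [AddCommGroup Z] [Module ℂ Z]

theorem face12_tmul (x y z : A) :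
    (face12 A).toLinearMap (x ⊗ₜ (y ⊗ₜ z)) = counit (R := ℂ) z • (x ⊗ₜ[ℂ] y) := by
  simp [face12]

theorem face23_tmul (x y z : A) :
    (face23 A).toLinearMap (x ⊗ₜ (y ⊗ₜ z)) = counit (R := ℂ) x • (y ⊗ₜ[ℂ] z) := by
  simp [face23]

theorem faceM1_tmul (x y z : A) :
    (faceM1 A).toLinearMap (x ⊗ₜ (y ⊗ₜ z)) = (x * y) ⊗ₜ[ℂ] z := by
  simp [faceM1, mulCoalg]

theorem face1M_tmul (x y z : A) :
    (face1M A).toLinearMap (x ⊗ₜ (y ⊗ₜ z)) = x ⊗ₜ[ℂ] (y * z) := by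
  simp [face1M, mulCoalg]

/-- `w : M ⊗ N → X` is a morphism of `A`-comodules, where `M ⊗ N` carries the diagonal coaction. -/
def IsEquivariant (δM : M →ₗ[ℂ] A ⊗[ℂ] M) (δN : N →ₗ[ℂ] A ⊗[ℂ] N) (δX : X →ₗ[ℂ] A ⊗[ℂ] X)
    (w : M ⊗[ℂ] N →ₗ[ℂ] X) : Prop :=
  ∀ t, δX (w t) = TensorProduct.map (LinearMap.mul' ℂ A) w (tens δM δN t)

variable {δM : M →ₗ[ℂ] A ⊗[ℂ] M} {δN : N →ₗ[ℂ] A ⊗[ℂ] N} {δP : P →ₗ[ℂ] A ⊗[ℂ] P}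
  {δX : X →ₗ[ℂ] A ⊗[ℂ] X} {δY : Y →ₗ[ℂ] A ⊗[ℂ] Y}

/-- The functional `F(a ⊗ b) ε(c)` acts on the first two factors only. -/
theorem act_face12 (hP : IsCoaction δP) (F : A ⊗[ℂ] A →ₗ[ℂ] ℂ) (m : M) (n : N) (p : P) :
    act (tens δM (tens δN δP)) (pull (face12 A) F) (m ⊗ₜ (n ⊗ₜ p)) =
      TensorProduct.assoc ℂ M N P (act (tens δM δN) (toConv F) (m ⊗ₜ n) ⊗ₜ p) := by
  have k : ∀ (r : A ⊗[ℂ] M) (s : A ⊗[ℂ] N) (t : A ⊗[ℂ] P),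
      slice (F ∘ₗ (face12 A).toLinearMap) (TensorProduct.tensorTensorTensorComm ℂ _ _ _ _ (r ⊗ₜ
        TensorProduct.tensorTensorTensorComm ℂ _ _ _ _ (s ⊗ₜ t))) =
      TensorProduct.assoc ℂ M N P (slice F (TensorProduct.tensorTensorTensorComm ℂ _ _ _ _
        (r ⊗ₜ s)) ⊗ₜ slice (counit (R := ℂ)) t) := by
    intro r s t
    induction r with
    | zero => simp
    | add x y hx hy => simp only [map_add, TensorProduct.add_tmul, hx, hy]
    | tmul a m =>
    induction s with
    | zero => simp
    | add x y hx hy => simp only [map_add, TensorProduct.add_tmul, TensorProduct.tmul_add, hx, hy]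
    | tmul b n =>
    induction t with
    | zero => simp
    | add x y hx hy => simp only [map_add, TensorProduct.tmul_add, hx, hy]
    | tmul c p =>
      simp only [TensorProduct.tensorTensorTensorComm_tmul, slice_tmul, LinearMap.comp_apply,
        face12_tmul]
      simp [← TensorProduct.smul_tmul', smul_smul]
  have := k (δM m) (δN n) (δP p)
  rw [hP.counit] at this
  exact this

/-- The functional `ε(a) F(b ⊗ c)` acts on the last two factors only. -/
theorem act_face23 (hM : IsCoaction δM) (F : A ⊗[ℂ] A →ₗ[ℂ] ℂ) (m : M) (t : N ⊗[ℂ] P) :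
    act (tens δM (tens δN δP)) (pull (face23 A) F) (m ⊗ₜ t) =
      m ⊗ₜ act (tens δN δP) (toConv F) t := by
  have k : ∀ (r : A ⊗[ℂ] M) (s : (A ⊗[ℂ] A) ⊗[ℂ] (N ⊗[ℂ] P)),
      slice (F ∘ₗ (face23 A).toLinearMap) (TensorProduct.tensorTensorTensorComm ℂ _ _ _ _
        (r ⊗ₜ s)) = slice (counit (R := ℂ)) r ⊗ₜ slice F s := by
    intro r s
    induction r with
    | zero => simp
    | add x y hx hy => simp only [map_add, TensorProduct.add_tmul, hx, hy]
    | tmul a m =>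
    induction s with
    | zero => simp
    | add x y hx hy => simp only [map_add, TensorProduct.tmul_add, hx, hy]
    | tmul b n =>
    induction b with
    | zero => simp
    | add x y hx hy => simp only [map_add, TensorProduct.tmul_add, TensorProduct.add_tmul, hx, hy]
    | tmul b c =>
      simp only [TensorProduct.tensorTensorTensorComm_tmul, slice_tmul, LinearMap.comp_apply,
        face23_tmul]
      simp [← TensorProduct.smul_tmul', smul_smul, mul_comm]
  have := k (δM m) (tens δN δP t)
  rw [hM.counit] at this
  exact this

/-- The action of `F(ab ⊗ c)` becomes that of `F` after multiplying the first two factors by an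
equivariant map. -/
theorem act_faceM1 {w : M ⊗[ℂ] N →ₗ[ℂ] X} (hw : IsEquivariant δM δN δX w)
    (F : A ⊗[ℂ] A →ₗ[ℂ] ℂ) (t : M ⊗[ℂ] (N ⊗[ℂ] P)) :
    act (tens δX δP) (toConv F) (w.rTensor P ((TensorProduct.assoc ℂ M N P).symm t)) =
      w.rTensor P ((TensorProduct.assoc ℂ M N P).symm
        (act (tens δM (tens δN δP)) (pull (faceM1 A) F) t)) := by
  refine act_map (w := w.rTensor P ∘ₗ (TensorProduct.assoc ℂ M N P).symm.toLinearMap)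
    (p := (faceM1 A).toLinearMap) (fun v => ?_) (toConv F) t
  induction v with
  | zero => simp
  | add x y hx hy => simp only [map_add, hx, hy]
  | tmul m v =>
  induction v with
  | zero => simp
  | add x y hx hy => simp only [map_add, TensorProduct.tmul_add, hx, hy]
  | tmul n p =>
    simp only [LinearMap.comp_apply, LinearEquiv.coe_coe, TensorProduct.assoc_symm_tmul,
      LinearMap.rTensor_tmul, tens_tmul, hw (m ⊗ₜ n)]
    generalize δM m = r
    generalize δN n = s
    generalize δP p = t
    induction r with
    | zero => simp
    | add x y hx hy => simp only [map_add, TensorProduct.add_tmul, hx, hy]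
    | tmul a m =>
    induction s with
    | zero => simp
    | add x y hx hy => simp only [map_add, TensorProduct.add_tmul, TensorProduct.tmul_add, hx, hy]
    | tmul b n =>
    induction t with
    | zero => simp
    | add x y hx hy => simp only [map_add, TensorProduct.tmul_add, hx, hy]
    | tmul c p =>
      simp only [TensorProduct.tensorTensorTensorComm_tmul, TensorProduct.map_tmul, faceM1_tmul]
      simp

/-- The action of `F(a ⊗ bc)` becomes that of `F` after multiplying the last two factors by an
equivariant map. -/
theorem act_face1M {w : N ⊗[ℂ] P →ₗ[ℂ] Y} (hw : IsEquivariant δN δP δY w)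
    (F : A ⊗[ℂ] A →ₗ[ℂ] ℂ) (t : M ⊗[ℂ] (N ⊗[ℂ] P)) :
    act (tens δM δY) (toConv F) (w.lTensor M t) =
      w.lTensor M (act (tens δM (tens δN δP)) (pull (face1M A) F) t) := by
  refine act_map (p := (face1M A).toLinearMap) (fun v => ?_) (toConv F) t
  induction v with
  | zero => simp
  | add x y hx hy => simp only [map_add, hx, hy]
  | tmul m v =>
  induction v with
  | zero => simp
  | add x y hx hy => simp only [map_add, TensorProduct.tmul_add, hx, hy]
  | tmul n p =>
    simp only [LinearMap.lTensor_tmul, tens_tmul, hw (n ⊗ₜ p)]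
    generalize δM m = r
    generalize δN n = s
    generalize δP p = t
    induction r with
    | zero => simp
    | add x y hx hy => simp only [map_add, TensorProduct.add_tmul, hx, hy]
    | tmul a m =>
    induction s with
    | zero => simp
    | add x y hx hy => simp only [map_add, TensorProduct.add_tmul, TensorProduct.tmul_add, hx, hy]
    | tmul b n =>
    induction t with
    | zero => simp
    | add x y hx hy => simp only [map_add, TensorProduct.tmul_add, hx, hy]
    | tmul c p =>
      simp only [TensorProduct.tensorTensorTensorComm_tmul, TensorProduct.map_tmul, face1M_tmul]
      simp

/-- The twisted product `m ⊗ n ↦ γ(m₍₋₁₎ ⊗ n₍₋₁₎) w(m₍₀₎ ⊗ n₍₀₎)`. -/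
def twistMap (c : TwoCocycle A) (δM : M →ₗ[ℂ] A ⊗[ℂ] M) (δN : N →ₗ[ℂ] A ⊗[ℂ] N)
    (w : M ⊗[ℂ] N →ₗ[ℂ] X) : M ⊗[ℂ] N →ₗ[ℂ] X := w ∘ₗ act (tens δM δN) (toConv c.γ)

/-- The cocycle identity turns an associativity law between covariant products into the same law
between the twisted products. -/
theorem twistMap_assoc (c : TwoCocycle A) (hM : IsCoaction δM) (hN : IsCoaction δN)
    (hP : IsCoaction δP) {w₁ : M ⊗[ℂ] N →ₗ[ℂ] X} (hw₁ : IsEquivariant δM δN δX w₁)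
    {w₂ : X ⊗[ℂ] P →ₗ[ℂ] Z} {w₃ : N ⊗[ℂ] P →ₗ[ℂ] Y} (hw₃ : IsEquivariant δN δP δY w₃)
    {w₄ : M ⊗[ℂ] Y →ₗ[ℂ] Z}
    (h : ∀ m n p, w₂ (w₁ (m ⊗ₜ n) ⊗ₜ p) = w₄ (m ⊗ₜ w₃ (n ⊗ₜ p))) (m : M) (n : N) (p : P) :
    twistMap c δX δP w₂ (twistMap c δM δN w₁ (m ⊗ₜ n) ⊗ₜ p) =
      twistMap c δM δY w₄ (m ⊗ₜ twistMap c δN δP w₃ (n ⊗ₜ p)) := by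
  have hD := hM.tens (hN.tens hP)
  have h' : w₂ ∘ₗ w₁.rTensor P ∘ₗ (TensorProduct.assoc ℂ M N P).symm.toLinearMap =
      w₄ ∘ₗ w₃.lTensor M := by
    ext m n p
    simp [h]
  have e1 : twistMap c δM δN w₁ (m ⊗ₜ n) ⊗ₜ[ℂ] p = w₁.rTensor P ((TensorProduct.assoc ℂ M N P).symm
      (act (tens δM (tens δN δP)) (pull (face12 A) c.γ) (m ⊗ₜ (n ⊗ₜ p)))) := by
    rw [act_face12 hP, LinearEquiv.symm_apply_apply]
    rfl
  have e2 : m ⊗ₜ[ℂ] twistMap c δN δP w₃ (n ⊗ₜ p) = w₃.lTensor M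
      (act (tens δM (tens δN δP)) (pull (face23 A) c.γ) (m ⊗ₜ (n ⊗ₜ p))) := by
    rw [act_face23 hM]
    rfl
  rw [e1, e2, twistMap, twistMap, LinearMap.comp_apply, LinearMap.comp_apply, act_faceM1 hw₁,
    act_face1M hw₃, act_act hD, act_act hD, c.cocycle_faces]
  exact LinearMap.congr_fun h' _

end Faces

/-! ### Matrix coefficients of finite-dimensional corepresentations -/

section Corep

variable {A : Type*} [AddCommGroup A] [Module ℂ A] [Coalgebra ℂ A]

/-- `T` is a matrix corepresentation: `Δ(Tᵢⱼ) = ∑ₖ Tᵢₖ ⊗ Tₖⱼ` and `ε(Tᵢⱼ) = δᵢⱼ`. -/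
structure IsCorep {n : ℕ} (T : Fin n → Fin n → A) : Prop where
  comul_eq : ∀ i j, comul (R := ℂ) (T i j) = ∑ k, T i k ⊗ₜ[ℂ] T k j
  counit_eq : ∀ i j, counit (R := ℂ) (T i j) = if i = j then 1 else 0

theorem comul_rightSlice (φ : A →ₗ[ℂ] ℂ) (u : A ⊗[ℂ] A) :
    comul (R := ℂ) (TensorProduct.rid ℂ A (φ.lTensor A u)) =
      ((TensorProduct.rid ℂ A).toLinearMap ∘ₗ φ.lTensor A).lTensor A
        (TensorProduct.assoc ℂ A A A ((comul (R := ℂ)).rTensor A u)) := by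
  induction u with
  | zero => simp
  | add x y hx hy => simp only [map_add, hx, hy]
  | tmul x y =>
    simp only [LinearMap.lTensor_tmul, LinearMap.rTensor_tmul, TensorProduct.rid_tmul, map_smul]
    generalize comul (R := ℂ) x = v
    induction v with
    | zero => simp
    | add x y hx hy => simp only [map_add, TensorProduct.add_tmul, smul_add, hx, hy]
    | tmul a b => simp

/-- The left legs of `Δ(a)` span a finite-dimensional right subcomodule containing `a`. -/
theorem exists_subcomodule (a : A) : ∃ W : Submodule ℂ A, FiniteDimensional ℂ W ∧ a ∈ W ∧
    ∀ w ∈ W, ∃ t : W ⊗[ℂ] A, comul (R := ℂ) w = W.subtype.rTensor A t := by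
  classical
  let b := Module.Free.chooseBasis ℂ A
  let x : Module.Free.ChooseBasisIndex ℂ A → A :=
    fun s => TensorProduct.rid ℂ A ((b.coord s).lTensor A (comul (R := ℂ) a))
  let f := TensorProduct.equivFinsuppOfBasisRight (M := A) b (comul (R := ℂ) a)
  have hf : ∀ s, f s = x s := fun s => by
    simp only [f, x]
    rw [TensorProduct.equivFinsuppOfBasisRight_apply]
  have hcomul : comul (R := ℂ) a = ∑ s ∈ f.support, x s ⊗ₜ b s := by
    have := (TensorProduct.equivFinsuppOfBasisRight (M := A) b).symm_apply_apply (comul (R := ℂ) a)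
    rw [TensorProduct.equivFinsuppOfBasisRight_symm_apply] at this
    rw [← this, Finsupp.sum]
    exact Finset.sum_congr rfl fun s _ => by rw [← hf]
  let W := Submodule.span ℂ (x '' (f.support : Set _))
  have hxW : ∀ s, x s ∈ W := by
    intro s
    by_cases hs : s ∈ f.support
    · exact Submodule.subset_span ⟨s, hs, rfl⟩
    · rw [← hf, Finsupp.notMem_support_iff.1 hs]
      exact W.zero_mem
  refine ⟨W, FiniteDimensional.span_of_finite ℂ ((f.support.finite_toSet).image x), ?_, ?_⟩
  · have h := congrArg (TensorProduct.rid ℂ A) (Coalgebra.lTensor_counit_comul (R := ℂ) a)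
    rw [hcomul] at h
    simp only [map_sum, LinearMap.lTensor_tmul, TensorProduct.rid_tmul, one_smul] at h
    rw [← h]
    exact W.sum_mem fun s _ => W.smul_mem _ (hxW s)
  · intro w hw
    induction hw using Submodule.span_induction with
    | mem w hw =>
      obtain ⟨s, -, rfl⟩ := hw
      have h := comul_rightSlice (b.coord s) (comul (R := ℂ) a)
      rw [Coalgebra.coassoc_apply, ← LinearMap.lTensor_comp_apply] at h
      conv_rhs at h => rw [hcomul]
      refine ⟨∑ t ∈ f.support, (⟨x t, hxW t⟩ : W) ⊗ₜ (((TensorProduct.rid ℂ A).toLinearMap ∘ₗ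
        (b.coord s).lTensor A) ∘ₗ comul (R := ℂ)) (b t), ?_⟩
      rw [map_sum]
      simp only [LinearMap.rTensor_tmul, Submodule.subtype_apply]
      rw [h, map_sum]
      rfl
    | zero => exact ⟨0, by simp⟩
    | add y z _ _ hy hz =>
      obtain ⟨t, ht⟩ := hy
      obtain ⟨t', ht'⟩ := hz
      exact ⟨t + t', by rw [map_add, map_add, ht, ht']⟩
    | smul r y _ hy =>
      obtain ⟨t, ht⟩ := hy
      exact ⟨r • t, by rw [map_smul, map_smul, ht]⟩

/-- Every element of a coalgebra over a field is a linear combination of the entries of a matrix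
corepresentation. -/
theorem mem_span_corep (a : A) :
    a ∈ Submodule.span ℂ {x : A | ∃ (n : ℕ) (T : Fin n → Fin n → A), IsCorep T ∧
      ∃ i j, x = T i j} := by
  obtain ⟨W, hW, ha, hcom⟩ := exists_subcomodule a
  let n := Module.finrank ℂ W
  let e : Module.Basis (Fin n) ℂ W := Module.finBasis ℂ W
  have h1 : ∀ j, ∃ T : Fin n → A, comul (R := ℂ) (e j : A) = ∑ i, (e i : A) ⊗ₜ[ℂ] T i := by
    intro j
    obtain ⟨t, ht⟩ := hcom (e j) (e j).2
    refine ⟨fun i => TensorProduct.equivFinsuppOfBasisLeft (N := A) e t i, ?_⟩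
    have := (TensorProduct.equivFinsuppOfBasisLeft (N := A) e).symm_apply_apply t
    rw [TensorProduct.equivFinsuppOfBasisLeft_symm_apply,
      Finsupp.sum_fintype _ _ (by simp)] at this
    rw [ht]
    conv_lhs => rw [← this]
    simp
  choose T' hT' using h1
  -- the coefficients of `Δ(eⱼ) = ∑ᵢ eᵢ ⊗ Tᵢⱼ`
  let T : Fin n → Fin n → A := fun i j => T' j i
  have hT : ∀ j, comul (R := ℂ) (e j : A) = ∑ i, (e i : A) ⊗ₜ[ℂ] T i j := hT'
  -- functionals on `A` dual to the basis `e` of `W`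
  have h2 : ∀ k, ∃ ψ : A →ₗ[ℂ] ℂ, ∀ j, ψ (e j) = if j = k then 1 else 0 := by
    intro k
    obtain ⟨ψ, hψ⟩ := LinearMap.exists_extend (e.coord k)
    refine ⟨ψ, fun j => ?_⟩
    have := LinearMap.congr_fun hψ (e j)
    simp only [LinearMap.comp_apply, Submodule.subtype_apply] at this
    rw [this]
    simp [Finsupp.single_apply]
  choose ψ hψ using h2
  have hcorep : IsCorep T := by
    constructor
    · intro k j
      have h := Coalgebra.coassoc_apply (R := ℂ) (e j : A)
      rw [hT j] at h
      simp only [map_sum, LinearMap.rTensor_tmul, LinearMap.lTensor_tmul, hT,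
        TensorProduct.sum_tmul, TensorProduct.assoc_tmul] at h
      have h' := congrArg (fun z => TensorProduct.lid ℂ _ ((ψ k).rTensor _ z)) h
      simp only [map_sum, LinearMap.rTensor_tmul, TensorProduct.lid_tmul, hψ, ite_smul, one_smul,
        zero_smul, Finset.sum_ite_eq', Finset.mem_univ, if_true] at h'
      exact h'.symm
    · intro k j
      have h := congrArg (TensorProduct.rid ℂ A) (Coalgebra.lTensor_counit_comul (R := ℂ) (e j : A))
      rw [hT j] at h
      have h' := congrArg (ψ k) h
      simp only [map_sum, LinearMap.lTensor_tmul, TensorProduct.rid_tmul, one_smul, map_smul, hψ,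
        smul_eq_mul, mul_ite, mul_one, mul_zero, Finset.sum_ite_eq', Finset.mem_univ,
        if_true] at h'
      rw [h']
      simp [eq_comm]
  have h3 : ∀ j, (e j : A) ∈ Submodule.span ℂ {x : A | ∃ (n : ℕ) (T : Fin n → Fin n → A),
      IsCorep T ∧ ∃ i j, x = T i j} := by
    intro j
    have h := congrArg (TensorProduct.lid ℂ A) (Coalgebra.rTensor_counit_comul (R := ℂ) (e j : A))
    rw [hT j] at h
    simp only [map_sum, LinearMap.rTensor_tmul, TensorProduct.lid_tmul, one_smul] at h
    rw [← h]
    exact Submodule.sum_mem _ fun i _ =>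
      Submodule.smul_mem _ _ (Submodule.subset_span ⟨n, T, hcorep, i, j, rfl⟩)
  have h4 : a = ∑ j, e.repr ⟨a, ha⟩ j • (e j : A) := by
    have := congrArg W.subtype (e.sum_repr ⟨a, ha⟩)
    simp only [map_sum, map_smul, Submodule.subtype_apply] at this
    exact this.symm
  rw [h4]
  exact Submodule.sum_mem _ fun j _ => Submodule.smul_mem _ _ (h3 j)

/-- Linear maps on a coalgebra are determined by their values on matrix coefficients. -/
theorem corep_ext {X : Type*} [AddCommGroup X] [Module ℂ X] {f g : A →ₗ[ℂ] X}
    (h : ∀ (n : ℕ) (T : Fin n → Fin n → A), IsCorep T → ∀ i j, f (T i j) = g (T i j)) : f = g := by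
  ext a
  induction mem_span_corep a using Submodule.span_induction with
  | mem x hx =>
    obtain ⟨n, T, hT, i, j, rfl⟩ := hx
    exact h n T hT i j
  | zero => simp
  | add x y _ _ hx hy => rw [map_add, map_add, hx, hy]
  | smul r x _ hx => rw [map_smul, map_smul, hx]

theorem corep_ext₂ {X : Type*} [AddCommGroup X] [Module ℂ X] {f g : A ⊗[ℂ] A →ₗ[ℂ] X}
    (h : ∀ (n : ℕ) (T : Fin n → Fin n → A), IsCorep T →
      ∀ (m : ℕ) (R : Fin m → Fin m → A), IsCorep R →
      ∀ i j k l, f (T i j ⊗ₜ R k l) = g (T i j ⊗ₜ R k l)) : f = g := by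
  apply TensorProduct.curry_injective
  refine corep_ext fun n T hT i j => corep_ext fun m R hR k l => ?_
  exact h n T hT m R hR i j k l

end Corep

/-! ### The antipode and matrix corepresentations -/

section Antipode

variable {A : Type*} [Ring A] [HopfAlgebra ℂ A]

local notation "S" => (HopfAlgebra.antipode ℂ : A →ₗ[ℂ] A)

theorem IsCorep.sum_antipode_mul {n : ℕ} {T : Fin n → Fin n → A} (hT : IsCorep T) (i j : Fin n) :
    ∑ k, S (T i k) * T k j = if i = j then 1 else 0 := by
  have h := HopfAlgebra.mul_antipode_rTensor_comul_apply (R := ℂ) (T i j)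
  rw [hT.comul_eq, hT.counit_eq] at h
  simpa using h

theorem IsCorep.sum_mul_antipode {n : ℕ} {T : Fin n → Fin n → A} (hT : IsCorep T) (i j : Fin n) :
    ∑ k, T i k * S (T k j) = if i = j then 1 else 0 := by
  have h := HopfAlgebra.mul_antipode_lTensor_comul_apply (R := ℂ) (T i j)
  rw [hT.comul_eq, hT.counit_eq] at h
  simpa using h

/-- `Δ(S(T))` and the flipped product are both inverse to the matrix `Δ(T)`. -/
theorem IsCorep.comul_antipode {n : ℕ} {T : Fin n → Fin n → A} (hT : IsCorep T) (i j : Fin n) :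
    comul (R := ℂ) (S (T i j)) = ∑ k, S (T k j) ⊗ₜ[ℂ] S (T i k) := by
  let P : Matrix (Fin n) (Fin n) (A ⊗[ℂ] A) :=
    Matrix.of fun i j => comul (R := ℂ) (T i j)
  let Q : Matrix (Fin n) (Fin n) (A ⊗[ℂ] A) :=
    Matrix.of fun i j => comul (R := ℂ) (S (T i j))
  let R : Matrix (Fin n) (Fin n) (A ⊗[ℂ] A) :=
    Matrix.of fun i j => ∑ k, S (T k j) ⊗ₜ[ℂ] S (T i k)
  have hPQ : P * Q = 1 := by
    ext i j
    simp only [Matrix.mul_apply, P, Q, Matrix.of_apply]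
    simp only [← Bialgebra.comul_mul, ← map_sum, hT.sum_mul_antipode, Matrix.one_apply]
    split_ifs <;> simp
  have hRP : R * P = 1 := by
    ext i j
    simp only [Matrix.mul_apply, P, R, Matrix.of_apply, hT.comul_eq]
    calc ∑ l, (∑ k, S (T k l) ⊗ₜ[ℂ] S (T i k)) * ∑ m, T l m ⊗ₜ[ℂ] T m j
        = ∑ k, ∑ m, (∑ l, S (T k l) * T l m) ⊗ₜ[ℂ] (S (T i k) * T m j) := by
          simp only [Finset.sum_mul, Finset.mul_sum, Algebra.TensorProduct.tmul_mul_tmul,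
            TensorProduct.sum_tmul]
          rw [Finset.sum_comm_cycle, Finset.sum_comm_cycle, Finset.sum_comm]
      _ = 1 ⊗ₜ[ℂ] ∑ k, S (T i k) * T k j := by
          refine (Finset.sum_congr rfl fun k _ => Finset.sum_congr rfl fun m _ => by
            rw [hT.sum_antipode_mul]).trans ?_
          simp [TensorProduct.ite_tmul, TensorProduct.tmul_sum]
      _ = (1 : Matrix (Fin n) (Fin n) (A ⊗[ℂ] A)) i j := by
          rw [hT.sum_antipode_mul, Matrix.one_apply]
          split_ifs <;> simp [Algebra.TensorProduct.one_def]
  have : R = Q := left_inv_eq_right_inv hRP hPQ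
  exact (congrFun (congrFun this i) j).symm

end Antipode

/-! ### The functionals `U` and `Ū` of a 2-cocycle -/

section CocycleIdentities

variable {A : Type*} [Ring A] [HopfAlgebra ℂ A]

local notation "S" => (HopfAlgebra.antipode ℂ : A →ₗ[ℂ] A)

/-- A convolution product evaluated on a given expansion of the coproduct. -/
theorem convMul_apply_of_comul {D : Type*} [AddCommGroup D] [Module ℂ D] [Coalgebra ℂ D]
    {R : Type*} [Ring R] [Algebra ℂ R] (F G : WithConv (D →ₗ[ℂ] R)) {ι : Type*} [Fintype ι]
    {x : D} {x₁ x₂ : ι → D} (hx : comul (R := ℂ) x = ∑ a, x₁ a ⊗ₜ[ℂ] x₂ a) :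
    (F * G) x = ∑ a, F (x₁ a) * G (x₂ a) := by
  rw [LinearMap.convMul_apply, hx]
  simp

theorem convMul_tmul_of_comul (F G : WithConv (A ⊗[ℂ] A →ₗ[ℂ] ℂ))
    {ι κ : Type*} [Fintype ι] [Fintype κ] {x y : A} {x₁ x₂ : ι → A} {y₁ y₂ : κ → A}
    (hx : comul (R := ℂ) x = ∑ a, x₁ a ⊗ₜ[ℂ] x₂ a)
    (hy : comul (R := ℂ) y = ∑ b, y₁ b ⊗ₜ[ℂ] y₂ b) :
    (F * G) (x ⊗ₜ y) = ∑ a, ∑ b, F (x₁ a ⊗ₜ y₁ b) * G (x₂ a ⊗ₜ y₂ b) := by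
  rw [LinearMap.convMul_apply, TensorProduct.comul_tmul, hx, hy]
  simp [TensorProduct.sum_tmul, TensorProduct.tmul_sum]
  rw [Finset.sum_comm]

namespace TwoCocycle

variable (c : TwoCocycle A)

/-- The cocycle identity written out on given expansions of the coproducts. -/
theorem cocycle_of_comul {ι κ μ : Type*} [Fintype ι] [Fintype κ] [Fintype μ] {x y z : A}
    {x₁ x₂ : ι → A} {y₁ y₂ : κ → A} {z₁ z₂ : μ → A}
    (hx : comul (R := ℂ) x = ∑ a, x₁ a ⊗ₜ[ℂ] x₂ a) (hy : comul (R := ℂ) y = ∑ b, y₁ b ⊗ₜ[ℂ] y₂ b)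
    (hz : comul (R := ℂ) z = ∑ d, z₁ d ⊗ₜ[ℂ] z₂ d) :
    ∑ a, ∑ b, c.γ (x₁ a ⊗ₜ y₁ b) * c.γ ((x₂ a * y₂ b) ⊗ₜ z) =
      ∑ b, ∑ d, c.γ (y₁ b ⊗ₜ z₁ d) * c.γ (x ⊗ₜ (y₂ b * z₂ d)) := by
  have h := c.cocycle x y z
  rw [convMul_tmul_of_comul _ _ hx hy, convMul_tmul_of_comul _ _ hy hz] at h
  exact h

theorem inv_one_left (h : A) : c.inv (1 ⊗ₜ h) = counit (R := ℂ) h := by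
  have k : toConv (c.inv ∘ₗ TensorProduct.mk ℂ A A 1) *
      toConv (c.γ ∘ₗ TensorProduct.mk ℂ A A 1) = 1 := by
    ext x
    have := congrArg (fun f => f ((1 : A) ⊗ₜ[ℂ] x)) c.inv_mul
    simp only [LinearMap.convMul_apply, TensorProduct.comul_tmul, Bialgebra.comul_one,
      LinearMap.convOne_apply] at this ⊢
    have e : counit (R := ℂ) ((1 : A) ⊗ₜ[ℂ] x) = counit (R := ℂ) x := by simp
    rw [e] at this
    rw [← this]
    hopf_tensor_induction comul (R := ℂ) x with x₁ x₂
    simp [Algebra.TensorProduct.one_def]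
  have e : toConv (c.γ ∘ₗ TensorProduct.mk ℂ A A 1) = 1 := by
    ext x
    simp [c.unital_left]
  rw [e, mul_one] at k
  have := congrArg (fun f => f h) k
  simpa using this

variable {n m : ℕ} {T : Fin n → Fin n → A} {R : Fin m → Fin m → A}

theorem U_corep (hT : IsCorep T) (i j : Fin n) :
    c.U (T i j) = ∑ k, c.γ (T i k ⊗ₜ S (T k j)) := by
  simp [U, hT.comul_eq]

theorem Ubar_corep (hT : IsCorep T) (i j : Fin n) :
    c.Ubar (T i j) = ∑ k, c.inv (S (T i k) ⊗ₜ T k j) := by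
  simp [Ubar, hT.comul_eq]

/-- The cocycle identity at `h₁ ⊗ S(h₂) ⊗ k`. -/
theorem sum_γ_antipode_mul_γ (hT : IsCorep T) (hR : IsCorep R) (i j : Fin n) (k l : Fin m) :
    ∑ b, ∑ d, c.γ (S (T b j) ⊗ₜ R k d) * ∑ a, c.γ (T i a ⊗ₜ (S (T a b) * R d l)) =
      if k = l then c.U (T i j) else 0 := by
  have h : ∀ a, _ := fun a => c.cocycle_of_comul (hT.comul_eq i a) (hT.comul_antipode a j)
    (hR.comul_eq k l)
  have h' := Finset.sum_congr (rfl : (Finset.univ : Finset (Fin n)) = _) fun a _ => h a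
  have lhs : ∑ a, ∑ p, ∑ q, c.γ (T i p ⊗ₜ S (T q j)) * c.γ ((T p a * S (T a q)) ⊗ₜ R k l) =
      if k = l then c.U (T i j) else 0 := by
    rw [Finset.sum_comm, c.U_corep hT]
    trans ∑ p, if k = l then c.γ (T i p ⊗ₜ S (T p j)) else 0
    swap
    · split_ifs <;> simp
    refine Finset.sum_congr rfl fun p _ => ?_
    rw [Finset.sum_comm]
    simp only [← Finset.mul_sum, ← map_sum, ← TensorProduct.sum_tmul, hT.sum_mul_antipode]
    simp only [TensorProduct.ite_tmul, apply_ite c.γ, map_zero,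
      c.unital_left, hR.counit_eq, mul_ite, mul_zero, mul_one, Finset.sum_ite_eq,
      Finset.mem_univ, if_true]
  rw [← lhs, h']
  simp only [Finset.mul_sum]
  rw [Finset.sum_comm_cycle]

/-- `γ(h₁ ⊗ S(h₂) k) = U(h₁) γ̄(S(h₂) ⊗ k)` for matrix coefficients `h` and `k`, obtained from the
preceding identity by convolving with `γ̄`. -/
theorem sum_γ_mul_antipode_corep (hT : IsCorep T) (hR : IsCorep R) (i j : Fin n) (k l : Fin m) :
    ∑ a, c.γ (T i a ⊗ₜ (S (T a j) * R k l)) = ∑ b, c.U (T i b) * c.inv (S (T b j) ⊗ₜ R k l) := by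
  have hinv : ∀ (b : Fin n) (d : Fin m),
      ∑ q, ∑ r, c.inv (S (T q j) ⊗ₜ R k r) * c.γ (S (T b q) ⊗ₜ R r d) =
        if b = j then if k = d then 1 else 0 else 0 := by
    intro b d
    have h := convMul_tmul_of_comul (toConv c.inv) (toConv c.γ) (hT.comul_antipode b j)
      (hR.comul_eq k d)
    rw [c.inv_mul] at h
    refine h.symm.trans ?_
    simp [hT.counit_eq, hR.counit_eq]
  have h : ∀ q, c.U (T i q) * c.inv (S (T q j) ⊗ₜ R k l) = ∑ r, c.inv (S (T q j) ⊗ₜ R k r) *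
      ∑ b, ∑ d, c.γ (S (T b q) ⊗ₜ R r d) * ∑ a, c.γ (T i a ⊗ₜ (S (T a b) * R d l)) := by
    intro q
    simp_rw [c.sum_γ_antipode_mul_γ hT hR]
    simp [mul_comm]
  simp_rw [h]
  obtain ⟨G, hG⟩ : ∃ G : Fin n → Fin m → ℂ, ∀ b d,
      ∑ a, c.γ (T i a ⊗ₜ (S (T a b) * R d l)) = G b d := ⟨_, fun _ _ => rfl⟩
  simp_rw [hG]
  calc G j k
      = ∑ b, ∑ d, (if b = j then if k = d then 1 else 0 else 0) * G b d := by
        simp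
    _ = ∑ b, ∑ d, ∑ q, ∑ r, c.inv (S (T q j) ⊗ₜ R k r) * (c.γ (S (T b q) ⊗ₜ R r d) * G b d) := by
        refine Finset.sum_congr rfl fun b _ => Finset.sum_congr rfl fun d _ => ?_
        rw [← hinv, Finset.sum_mul]
        refine Finset.sum_congr rfl fun q _ => ?_
        rw [Finset.sum_mul]
        simp only [mul_assoc]
    _ = _ := by
        simp only [Finset.mul_sum]
        rw [Finset.sum_comm_cycle]
        refine Finset.sum_congr rfl fun q _ => ?_
        rw [Finset.sum_comm_cycle]

/-- `γ(h₁ ⊗ S(h₂) k) = U(h₁) γ̄(S(h₂) ⊗ k)` -/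
theorem sum_γ_mul_antipode (hT : IsCorep T) (i j : Fin n) (k : A) :
    ∑ a, c.γ (T i a ⊗ₜ (S (T a j) * k)) = ∑ b, c.U (T i b) * c.inv (S (T b j) ⊗ₜ k) := by
  have : ∑ a, c.γ ∘ₗ TensorProduct.mk ℂ A A (T i a) ∘ₗ LinearMap.mulLeft ℂ (S (T a j)) =
      ∑ b, c.U (T i b) • (c.inv ∘ₗ TensorProduct.mk ℂ A A (S (T b j))) := by
    refine corep_ext fun m R hR k l => ?_
    simpa using c.sum_γ_mul_antipode_corep hT hR i j k l
  simpa using LinearMap.congr_fun this k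

/-- `U * Ū = ε` on matrix coefficients: put `k = h₃` in the preceding identity. -/
theorem sum_U_mul_Ubar (hT : IsCorep T) (i j : Fin n) :
    ∑ b, c.U (T i b) * c.Ubar (T b j) = if i = j then 1 else 0 := by
  simp only [c.Ubar_corep hT, Finset.mul_sum]
  rw [Finset.sum_comm]
  simp only [← c.sum_γ_mul_antipode hT]
  rw [Finset.sum_comm]
  simp only [← map_sum, ← TensorProduct.tmul_sum, hT.sum_antipode_mul]
  simp [TensorProduct.tmul_ite, c.unital_right, hT.counit_eq]

/-- On a matrix corepresentation `Ū` is a right inverse of the finite matrix `U`, hence also a left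
inverse. -/
theorem Ubar_mul_U : toConv c.Ubar * toConv c.U = 1 := by
  apply ofConv_injective
  refine corep_ext fun n T hT i j => ?_
  change (toConv c.Ubar * toConv c.U) (T i j) = (1 : WithConv (A →ₗ[ℂ] ℂ)) (T i j)
  rw [convMul_apply_of_comul _ _ (hT.comul_eq i j)]
  have h : (Matrix.of fun i j => c.U (T i j)) * (Matrix.of fun i j => c.Ubar (T i j)) = 1 := by
    ext i j
    rw [Matrix.mul_apply, Matrix.one_apply]
    exact c.sum_U_mul_Ubar hT i j
  have h' := congrArg (fun M : Matrix (Fin n) (Fin n) ℂ => M i j) (mul_eq_one_comm.1 h)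
  simp only [Matrix.mul_apply, Matrix.one_apply, Matrix.of_apply] at h'
  refine h'.trans ?_
  simp [hT.counit_eq]

/-- `q ⊗ p ↦ S(p) ⊗ S(q)` -/
def antipodeSwap (A : Type*) [Ring A] [HopfAlgebra ℂ A] : A ⊗[ℂ] A →ₗ[ℂ] A ⊗[ℂ] A :=
  TensorProduct.map (HopfAlgebra.antipode ℂ) (HopfAlgebra.antipode ℂ) ∘ₗ
    (TensorProduct.comm ℂ A A).toLinearMap

@[simp]
theorem antipodeSwap_tmul (q p : A) : antipodeSwap A (q ⊗ₜ p) = S p ⊗ₜ S q := rfl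

/-- `antipodeSwap` reverses coproducts, so restriction along it reverses convolution products. -/
theorem convMul_antipodeSwap (F G : A ⊗[ℂ] A →ₗ[ℂ] ℂ) :
    toConv ((toConv F * toConv G).ofConv ∘ₗ antipodeSwap A) =
      toConv (G ∘ₗ antipodeSwap A) * toConv (F ∘ₗ antipodeSwap A) := by
  apply ofConv_injective
  refine corep_ext₂ fun n T hT m R hR i j k l => ?_
  change (toConv F * toConv G) (S (R k l) ⊗ₜ S (T i j)) =
    (toConv (G ∘ₗ antipodeSwap A) * toConv (F ∘ₗ antipodeSwap A)) (T i j ⊗ₜ R k l)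
  rw [convMul_tmul_of_comul _ _ (hR.comul_antipode k l) (hT.comul_antipode i j),
    convMul_tmul_of_comul _ _ (hT.comul_eq i j) (hR.comul_eq k l), Finset.sum_comm]
  refine Finset.sum_congr rfl fun a _ => Finset.sum_congr rfl fun b _ => ?_
  rw [mul_comm]
  rfl

theorem convMul_antipode (F G : A →ₗ[ℂ] ℂ) :
    toConv ((toConv F * toConv G).ofConv ∘ₗ S) = toConv (G ∘ₗ S) * toConv (F ∘ₗ S) := by
  apply ofConv_injective
  refine corep_ext fun n T hT i j => ?_
  change (toConv F * toConv G) (S (T i j)) = (toConv (G ∘ₗ S) * toConv (F ∘ₗ S)) (T i j)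
  rw [convMul_apply_of_comul _ _ (hT.comul_antipode i j),
    convMul_apply_of_comul _ _ (hT.comul_eq i j)]
  refine Finset.sum_congr rfl fun a _ => ?_
  rw [mul_comm]
  rfl

theorem convOne_antipodeSwap :
    toConv ((1 : WithConv (A ⊗[ℂ] A →ₗ[ℂ] ℂ)).ofConv ∘ₗ antipodeSwap A) = 1 := by
  apply ofConv_injective
  ext q p
  simp [LinearMap.convOne_def, mul_comm]

/-- `γ(q₁ ⊗ p₁) U(q₂p₂) = U(q₁) U(p₁) γ̄(S(p₂) ⊗ S(q₂))`: the cocycle identity at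
`q₁ ⊗ p₁ ⊗ S(p₂) S(q₂)`. -/
theorem γ_mul_U : toConv c.γ * toConv (c.U ∘ₗ LinearMap.mul' ℂ A) =
    outer (toConv c.U) (toConv c.U) * toConv (c.inv ∘ₗ antipodeSwap A) := by
  apply ofConv_injective
  refine corep_ext₂ fun n Q hQ m P hP i j k l => ?_
  change (toConv c.γ * toConv (c.U ∘ₗ LinearMap.mul' ℂ A)) (Q i j ⊗ₜ P k l) =
    (outer (toConv c.U) (toConv c.U) * toConv (c.inv ∘ₗ antipodeSwap A)) (Q i j ⊗ₜ P k l)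
  rw [convMul_tmul_of_comul _ _ (hQ.comul_eq i j) (hP.comul_eq k l),
    convMul_tmul_of_comul _ _ (hQ.comul_eq i j) (hP.comul_eq k l)]
  have hU : ∀ a b, c.U (Q a j * P b l) =
      ∑ e, ∑ d, c.γ ((Q a e * P b d) ⊗ₜ (S (P d l) * S (Q e j))) := by
    intro a b
    simp [U, Bialgebra.comul_mul, hQ.comul_eq, hP.comul_eq, Finset.sum_mul, Finset.mul_sum,
      HopfAlgebra.antipode_mul_antidistrib]
    rw [Finset.sum_comm]
  have hSS : ∀ (d : Fin m) (e : Fin n), comul (R := ℂ) (S (P d l) * S (Q e j)) =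
      ∑ x : Fin m × Fin n, (S (P x.1 l) * S (Q x.2 j)) ⊗ₜ[ℂ] (S (P d x.1) * S (Q e x.2)) := by
    intro d e
    rw [Bialgebra.comul_mul, hP.comul_antipode, hQ.comul_antipode, Fintype.sum_prod_type]
    simp [Finset.sum_mul, Finset.mul_sum]
    rw [Finset.sum_comm]
  calc ∑ a, ∑ b, c.γ (Q i a ⊗ₜ P k b) * c.U (Q a j * P b l)
      = ∑ e, ∑ d, ∑ a, ∑ b, c.γ (Q i a ⊗ₜ P k b) *
          c.γ ((Q a e * P b d) ⊗ₜ (S (P d l) * S (Q e j))) := by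
        simp only [hU, Finset.mul_sum]
        rw [Finset.sum_comm_cycle]
        refine Finset.sum_congr rfl fun e _ => ?_
        rw [Finset.sum_comm_cycle]
    _ = ∑ e, ∑ d, ∑ b, ∑ f, ∑ g, c.γ (P k b ⊗ₜ (S (P f l) * S (Q g j))) *
          c.γ (Q i e ⊗ₜ (P b d * (S (P d f) * S (Q e g)))) := by
        refine Finset.sum_congr rfl fun e _ => Finset.sum_congr rfl fun d _ => ?_
        rw [c.cocycle_of_comul (hQ.comul_eq i e) (hP.comul_eq k d) (hSS d e)]
        simp only [Fintype.sum_prod_type]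
    _ = ∑ e, ∑ b, ∑ f, ∑ g, c.γ (P k b ⊗ₜ (S (P f l) * S (Q g j))) *
          c.γ (Q i e ⊗ₜ ((∑ d, P b d * S (P d f)) * S (Q e g))) := by
        simp only [Finset.sum_mul, TensorProduct.tmul_sum, map_sum, Finset.mul_sum, mul_assoc]
        refine Finset.sum_congr rfl fun e _ => ?_
        rw [Finset.sum_comm]
        refine Finset.sum_congr rfl fun b _ => ?_
        rw [Finset.sum_comm]
        refine Finset.sum_congr rfl fun f _ => ?_
        rw [Finset.sum_comm]
    _ = ∑ g, (∑ e, c.γ (Q i e ⊗ₜ S (Q e g))) *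
          ∑ b, c.γ (P k b ⊗ₜ (S (P b l) * S (Q g j))) := by
        have h : ∀ e b, ∑ f, ∑ g, c.γ (P k b ⊗ₜ (S (P f l) * S (Q g j))) *
            c.γ (Q i e ⊗ₜ ((∑ d, P b d * S (P d f)) * S (Q e g))) =
            ∑ g, c.γ (Q i e ⊗ₜ S (Q e g)) * c.γ (P k b ⊗ₜ (S (P b l) * S (Q g j))) := by
          intro e b
          rw [Finset.sum_comm]
          refine Finset.sum_congr rfl fun g _ => ?_
          simp [hP.sum_mul_antipode, TensorProduct.tmul_ite, apply_ite c.γ, mul_comm]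
        simp_rw [h]
        rw [Finset.sum_comm_cycle]
        refine Finset.sum_congr rfl fun g _ => ?_
        rw [Finset.sum_mul_sum]
    _ = _ := by
        simp only [← c.U_corep hQ, c.sum_γ_mul_antipode hP, Finset.mul_sum]
        refine Finset.sum_congr rfl fun a _ => Finset.sum_congr rfl fun b _ => ?_
        rw [← mul_assoc]
        rfl

/-- `Ū(q₁p₁) γ̄(q₂ ⊗ p₂) = γ(S(p₁) ⊗ S(q₁)) Ū(q₂) Ū(p₂)` -/
theorem Ubar_mul_inv : toConv (c.Ubar ∘ₗ LinearMap.mul' ℂ A) * toConv c.inv =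
    toConv (c.γ ∘ₗ antipodeSwap A) * outer (toConv c.Ubar) (toConv c.Ubar) := by
  have h1 : toConv (c.Ubar ∘ₗ LinearMap.mul' ℂ A) * toConv (c.U ∘ₗ LinearMap.mul' ℂ A) = 1 :=
    pull_mul (mulCoalg A) _ _ c.Ubar_mul_U
  have h3 : outer (toConv c.U) (toConv c.U) * outer (toConv c.Ubar) (toConv c.Ubar) = 1 := by
    apply ofConv_injective
    refine corep_ext₂ fun n Q hQ m P hP i j k l => ?_
    change (outer (toConv c.U) (toConv c.U) * outer (toConv c.Ubar) (toConv c.Ubar))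
      (Q i j ⊗ₜ P k l) = (1 : WithConv (A ⊗[ℂ] A →ₗ[ℂ] ℂ)) (Q i j ⊗ₜ P k l)
    rw [convMul_tmul_of_comul _ _ (hQ.comul_eq i j) (hP.comul_eq k l)]
    calc _ = ∑ a, ∑ b, (c.U (Q i a) * c.Ubar (Q a j)) * (c.U (P k b) * c.Ubar (P b l)) := by
          refine Finset.sum_congr rfl fun a _ => Finset.sum_congr rfl fun b _ => ?_
          simp only [outer_tmul]
          exact mul_mul_mul_comm _ _ _ _
      _ = _ := by
          rw [← Finset.sum_mul_sum, c.sum_U_mul_Ubar hQ, c.sum_U_mul_Ubar hP]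
          simp only [LinearMap.convOne_apply, TensorProduct.counit_tmul, hQ.counit_eq,
            hP.counit_eq]
          split_ifs <;> simp
  -- the two sides are a left and a right inverse of `γ * (U ∘ μ)`
  have h4 := c.γ_mul_U
  have h5 : toConv (c.Ubar ∘ₗ LinearMap.mul' ℂ A) * toConv c.inv *
      (toConv c.γ * toConv (c.U ∘ₗ LinearMap.mul' ℂ A)) = 1 := by
    rw [mul_assoc, ← mul_assoc (toConv c.inv), c.inv_mul, one_mul, h1]
  have h6 : outer (toConv c.U) (toConv c.U) * toConv (c.inv ∘ₗ antipodeSwap A) *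
      (toConv (c.γ ∘ₗ antipodeSwap A) * outer (toConv c.Ubar) (toConv c.Ubar)) = 1 := by
    have h2 : toConv (c.inv ∘ₗ antipodeSwap A) * toConv (c.γ ∘ₗ antipodeSwap A) = 1 := by
      rw [← convMul_antipodeSwap, c.mul_inv, convOne_antipodeSwap]
    rw [mul_assoc, ← mul_assoc (toConv (c.inv ∘ₗ antipodeSwap A)), h2, one_mul, h3]
  rw [h4] at h5
  exact left_inv_eq_right_inv h5 h6

end TwoCocycle

end CocycleIdentities

/-! ### The involution and the functionals `V` and `V̄` -/

section Involution

variable {A : Type*} [Ring A] [HopfAlgebra ℂ A] [StarRing A] [StarModule ℂ A]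
  [IsHopfStarAlgebra A]

local notation "S" => (HopfAlgebra.antipode ℂ : A →ₗ[ℂ] A)

theorem antipodeInv_antipode (a : A) : antipodeInv A (S a) = a :=
  (LinearEquiv.ofBijective S IsHopfStarAlgebra.antipode_bijective).symm_apply_apply a

theorem antipode_antipodeInv (a : A) : S (antipodeInv A a) = a :=
  (LinearEquiv.ofBijective S IsHopfStarAlgebra.antipode_bijective).apply_symm_apply a

theorem IsCorep.star {n : ℕ} {T : Fin n → Fin n → A} (hT : IsCorep T) :
    IsCorep fun i j => star (T i j) := by
  have h : ∀ i j, comul (R := ℂ) (Star.star (T i j)) =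
      ∑ k, Star.star (T i k) ⊗ₜ[ℂ] Star.star (T k j) := by
    intro i j
    rw [IsHopfStarAlgebra.comul_star, hT.comul_eq, star_sum]
    simp
  refine ⟨h, fun i j => ?_⟩
  -- apply `ε ∘ *` to the counit axiom for `Tᵢⱼ^*`
  have e := congrArg (TensorProduct.lid ℂ A)
    (Coalgebra.rTensor_counit_comul (R := ℂ) (Star.star (T i j)))
  rw [h] at e
  have e' := congrArg (fun a => starRingEnd ℂ (counit (R := ℂ) (Star.star a))) e
  simp only [map_sum, LinearMap.rTensor_tmul, TensorProduct.lid_tmul, star_sum, star_smul,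
    star_star, one_smul, hT.counit_eq, map_smul, smul_eq_mul, mul_ite, mul_one, mul_zero,
    Finset.sum_ite_eq', Finset.mem_univ, if_true, RCLike.star_def,
    Complex.conj_conj] at e'
  rw [e']
  split_ifs <;> simp

/-- `S ∘ * ∘ S ∘ * = id`: the matrix `S((S(T^*))^*)` is a left inverse of `S(T)`. -/
theorem antipode_star_antipode_star (a : A) : S (star (S (star a))) = a := by
  have : S ∘ₗ ((starMap A ∘ₛₗ S) ∘ₛₗ starMap A : A →ₗ[ℂ] A) = LinearMap.id := by
    refine corep_ext fun n T hT i j => ?_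
    let P : Matrix (Fin n) (Fin n) A := Matrix.of fun i j => S (star (S (star (T i j))))
    let Q : Matrix (Fin n) (Fin n) A := Matrix.of fun i j => S (T i j)
    have hPQ : P * Q = 1 := by
      ext i j
      have h := congrArg star (hT.star.sum_antipode_mul i j)
      have h' := congrArg S h
      simp only [star_sum, star_mul, star_star, map_sum,
        HopfAlgebra.antipode_mul_antidistrib] at h'
      simp only [Matrix.mul_apply, P, Q, Matrix.of_apply, h', Matrix.one_apply]
      split_ifs <;> simp [HopfAlgebra.antipode_one]
    have hQT : Q * Matrix.of T = 1 := by
      ext i j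
      simp only [Matrix.mul_apply, Q, Matrix.of_apply, Matrix.one_apply, hT.sum_antipode_mul]
    exact congrArg (fun M : Matrix (Fin n) (Fin n) A => M i j) (left_inv_eq_right_inv hPQ hQT)
  exact LinearMap.congr_fun this a

theorem antipode_star_antipode (a : A) : S (star (S a)) = star a := by
  have := antipode_star_antipode_star (star a)
  rwa [star_star] at this

theorem antipodeInv_eq (a : A) : antipodeInv A a = star (S (star a)) := by
  rw [← antipodeInv_antipode (star (S (star a))), antipode_star_antipode_star]

/-- The functional `a ↦ conj F(σ(a))` obtained from a conjugate linear map `σ`. -/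
def conjAlong {D E : Type*} [AddCommGroup D] [Module ℂ D] [AddCommGroup E] [Module ℂ E]
    (σ : D →ₛₗ[starRingEnd ℂ] E) (F : E →ₗ[ℂ] ℂ) : D →ₗ[ℂ] ℂ where
  toFun a := starRingEnd ℂ (F (σ a))
  map_add' a b := by simp
  map_smul' r a := by simp

/-- Equivariant conjugate linear maps intertwine the action of `F` with that of its conjugate. -/
theorem act_conj {D E V W : Type*} [AddCommGroup D] [Module ℂ D] [AddCommGroup E] [Module ℂ E]
    [AddCommGroup V] [Module ℂ V] [AddCommGroup W] [Module ℂ W] {δ : V →ₗ[ℂ] D ⊗[ℂ] V}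
    {ε : W →ₗ[ℂ] E ⊗[ℂ] W} {σ : D →ₛₗ[starRingEnd ℂ] E} {s : V →ₛₗ[starRingEnd ℂ] W}
    (h : ∀ v, ε (s v) = TensorProduct.map σ s (δ v)) (F : WithConv (E →ₗ[ℂ] ℂ)) (v : V) :
    act ε F (s v) = s (act δ (toConv (conjAlong σ F.ofConv)) v) := by
  rw [act_apply, act_apply, h]
  generalize δ v = t
  induction t with
  | zero => simp
  | add x y hx hy => simp only [map_add, hx, hy]
  | tmul a v => simp [conjAlong]

/-- The conjugate linear map `a ⊗ b ↦ b^* ⊗ a^*`. -/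
def starSwap (A : Type*) [Ring A] [HopfAlgebra ℂ A] [StarRing A] [StarModule ℂ A] :
    A ⊗[ℂ] A →ₛₗ[starRingEnd ℂ] A ⊗[ℂ] A :=
  (TensorProduct.comm ℂ A A).toLinearMap ∘ₛₗ TensorProduct.map (starMap A) (starMap A)

namespace TwoCocycle

variable (c : TwoCocycle A)

theorem V_antipode (a : A) : c.V (S a) = c.U a := by
  simp [V, antipodeInv_antipode]

theorem Vbar_antipode (a : A) : c.Vbar (S a) = c.Ubar a := by
  simp [Vbar, antipodeInv_antipode]

theorem V_mul_Vbar : toConv c.V * toConv c.Vbar = 1 := by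
  have h := convMul_antipode c.V c.Vbar
  have e1 : c.V ∘ₗ S = c.U := by ext a; exact c.V_antipode a
  have e2 : c.Vbar ∘ₗ S = c.Ubar := by ext a; exact c.Vbar_antipode a
  rw [e1, e2, c.Ubar_mul_U] at h
  ext a
  have h' := congrArg (fun f => f (antipodeInv A a)) h
  refine Eq.trans ?_ (h'.trans ?_)
  · change _ = (toConv c.V * toConv c.Vbar) (S (antipodeInv A a))
    rw [antipode_antipodeInv]
  · have e : counit (R := ℂ) (antipodeInv A a) = counit (R := ℂ) a := by
      conv_rhs => rw [← antipode_antipodeInv a, HopfAlgebra.counit_antipode]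
    simp [e]

theorem Vbar_one : c.Vbar 1 = 1 := by
  rw [← HopfAlgebra.antipode_one (R := ℂ) (A := A), c.Vbar_antipode]
  simp [Ubar, Algebra.TensorProduct.one_def, c.inv_one_left]

variable {c} (hc : c.IsUnitary)
include hc

theorem conj_inv_of_unitary (a b : A) : starRingEnd ℂ (c.inv (a ⊗ₜ b)) =
    c.γ (star (S a) ⊗ₜ star (S b)) := by
  have := congrArg (starRingEnd ℂ) (hc (star (S a)) (star (S b)))
  simp only [antipode_star_antipode, star_star, RingHomCompTriple.comp_apply,
    RingHom.id_apply] at this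
  exact this.symm

/-- The complex conjugate of `V̄(h^*)` is `V(h)`. -/
theorem conjAlong_Vbar : conjAlong (starMap A) c.Vbar = c.V := by
  refine corep_ext fun n T hT i j => ?_
  have e1 : ∀ i j, comul (R := ℂ) (star (S (T i j))) =
      ∑ k, star (S (T k j)) ⊗ₜ[ℂ] star (S (T i k)) := by
    intro i j
    rw [IsHopfStarAlgebra.comul_star, hT.comul_antipode, star_sum]
    simp
  have e2 : comul (R := ℂ) (antipodeInv A (T i j)) =
      ∑ k, antipodeInv A (T k j) ⊗ₜ[ℂ] antipodeInv A (T i k) := by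
    simp only [antipodeInv_eq]
    rw [IsHopfStarAlgebra.comul_star, hT.star.comul_antipode, star_sum]
    simp
  change starRingEnd ℂ (c.Vbar (star (T i j))) = c.U (antipodeInv A (T i j))
  simp only [Vbar, LinearMap.comp_apply, antipodeInv_eq (star (T i j)), star_star, Ubar, U, e1, e2,
    map_sum, LinearMap.rTensor_tmul, LinearMap.lTensor_tmul, conj_inv_of_unitary hc,
    antipode_star_antipode, antipode_antipodeInv]
  simp only [antipodeInv_eq]

/-- `γ‡ * (V̄ ∘ μ) = (V̄ ⊗ V̄) * γ`, where `γ‡(a ⊗ b)` is the complex conjugate of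
`γ(b^* ⊗ a^*)`. This is `TwoCocycle.Ubar_mul_inv` transported along the antipode. -/
theorem conj_γ_mul_Vbar : toConv (conjAlong (starSwap A) c.γ) *
    toConv (c.Vbar ∘ₗ LinearMap.mul' ℂ A) =
      outer (toConv c.Vbar) (toConv c.Vbar) * toConv c.γ := by
  have e1 : conjAlong (starSwap A) c.γ ∘ₗ antipodeSwap A = c.inv := by
    ext q p
    change starRingEnd ℂ (c.γ (star (S q) ⊗ₜ star (S p))) = c.inv (q ⊗ₜ p)
    rw [hc]
    simp [antipode_star_antipode]
  have e2 : (c.Vbar ∘ₗ LinearMap.mul' ℂ A) ∘ₗ antipodeSwap A = c.Ubar ∘ₗ LinearMap.mul' ℂ A := by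
    ext q p
    simp [← HopfAlgebra.antipode_mul_antidistrib, c.Vbar_antipode]
  have e3 : (outer (toConv c.Vbar) (toConv c.Vbar)).ofConv ∘ₗ antipodeSwap A =
      (outer (toConv c.Ubar) (toConv c.Ubar)).ofConv := by
    ext q p
    simp [outer, c.Vbar_antipode, mul_comm]
  have h1 := convMul_antipodeSwap (conjAlong (starSwap A) c.γ) (c.Vbar ∘ₗ LinearMap.mul' ℂ A)
  have h2 := convMul_antipodeSwap (outer (toConv c.Vbar) (toConv c.Vbar)).ofConv c.γ
  rw [e1, e2, c.Ubar_mul_inv] at h1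
  rw [e3] at h2
  have hs : Function.Surjective (antipodeSwap A) :=
    (TensorProduct.map_surjective IsHopfStarAlgebra.antipode_bijective.2
      IsHopfStarAlgebra.antipode_bijective.2).comp (TensorProduct.comm ℂ A A).surjective
  apply ofConv_injective
  refine LinearMap.ext fun t => ?_
  obtain ⟨t, rfl⟩ := hs t
  exact congrArg (fun f => f t) (h1.trans h2.symm)

end TwoCocycle

end Involution

/-! ### The twisted Hopf algebra -/

/-- The axioms of a Hopf algebra (besides those of its coalgebra) on which the covariance of `𝔥_g`
depends. They hold both for `A` and for its cocycle twist. -/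
structure HopfStarData.IsHopf {A : Type*} [AddCommGroup A] [Module ℂ A] [Coalgebra ℂ A]
    (H : HopfStarData A) : Prop where
  mul_assoc : ∀ a b d, H.mul (H.mul a b) d = H.mul a (H.mul b d)
  one_mul : ∀ a, H.mul H.one a = a
  antipode_mul : ∀ a, TensorProduct.lift H.mul (H.antipode.rTensor A (comul (R := ℂ) a)) =
    counit (R := ℂ) a • H.one

section Slices

variable {A : Type*} [Ring A] [HopfAlgebra ℂ A]

/-- Evaluating the third leg turns convolution with a functional of the first two legs into
convolution on `A ⊗ A`. -/
theorem face12_convMul (F : A ⊗[ℂ] A →ₗ[ℂ] ℂ) (G : WithConv (A ⊗[ℂ] (A ⊗[ℂ] A) →ₗ[ℂ] ℂ))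
    (x y z : A) : (pull (face12 A) F * G) (x ⊗ₜ (y ⊗ₜ z)) =
      (toConv F * toConv (G.ofConv ∘ₗ ((TensorProduct.mk ℂ A A).flip z).lTensor A)) (x ⊗ₜ y) := by
  simp only [LinearMap.convMul_apply, TensorProduct.comul_tmul]
  hopf_tensor_induction comul (R := ℂ) x with x₁ x₂
  hopf_tensor_induction comul (R := ℂ) y with y₁ y₂
  conv_rhs => rw [← Coalgebra.sum_counit_smul (Coalgebra.Repr.arbitrary ℂ z)]
  rw [← (Coalgebra.Repr.arbitrary ℂ z).eq]
  simp only [TensorProduct.tmul_sum, map_sum]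
  simp [pull, face12, TensorProduct.tmul_sum, mul_left_comm, mul_assoc]

theorem convMul_face12 (F : A ⊗[ℂ] A →ₗ[ℂ] ℂ) (G : WithConv (A ⊗[ℂ] (A ⊗[ℂ] A) →ₗ[ℂ] ℂ))
    (x y z : A) : (G * pull (face12 A) F) (x ⊗ₜ (y ⊗ₜ z)) =
      (toConv (G.ofConv ∘ₗ ((TensorProduct.mk ℂ A A).flip z).lTensor A) * toConv F) (x ⊗ₜ y) := by
  simp only [LinearMap.convMul_apply, TensorProduct.comul_tmul]
  hopf_tensor_induction comul (R := ℂ) x with x₁ x₂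
  hopf_tensor_induction comul (R := ℂ) y with y₁ y₂
  conv_rhs => rw [← sum_smul_counit z]
  rw [← (Coalgebra.Repr.arbitrary ℂ z).eq]
  simp only [TensorProduct.tmul_sum, map_sum]
  simp [pull, face12, TensorProduct.tmul_sum, Finset.sum_mul, mul_left_comm, mul_assoc]

theorem face23_convMul (F : A ⊗[ℂ] A →ₗ[ℂ] ℂ) (G : WithConv (A ⊗[ℂ] (A ⊗[ℂ] A) →ₗ[ℂ] ℂ))
    (x : A) (t : A ⊗[ℂ] A) : (pull (face23 A) F * G) (x ⊗ₜ t) =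
      (toConv F * toConv (G.ofConv ∘ₗ TensorProduct.mk ℂ A (A ⊗[ℂ] A) x)) t := by
  simp only [LinearMap.convMul_apply, TensorProduct.comul_tmul]
  hopf_tensor_induction comul (R := ℂ) t with t₁ t₂
  conv_rhs => rw [← Coalgebra.sum_counit_smul (Coalgebra.Repr.arbitrary ℂ x)]
  rw [← (Coalgebra.Repr.arbitrary ℂ x).eq]
  simp only [TensorProduct.sum_tmul, map_sum]
  simp [pull, face23, Finset.mul_sum, mul_left_comm, mul_assoc]

theorem convMul_face23 (F : A ⊗[ℂ] A →ₗ[ℂ] ℂ) (G : WithConv (A ⊗[ℂ] (A ⊗[ℂ] A) →ₗ[ℂ] ℂ))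
    (x : A) (t : A ⊗[ℂ] A) : (G * pull (face23 A) F) (x ⊗ₜ t) =
      (toConv (G.ofConv ∘ₗ TensorProduct.mk ℂ A (A ⊗[ℂ] A) x) * toConv F) t := by
  simp only [LinearMap.convMul_apply, TensorProduct.comul_tmul]
  hopf_tensor_induction comul (R := ℂ) t with t₁ t₂
  conv_rhs => rw [← sum_smul_counit x]
  rw [← (Coalgebra.Repr.arbitrary ℂ x).eq]
  simp only [TensorProduct.sum_tmul, map_sum]
  simp [pull, face23, Finset.sum_mul, mul_left_comm, mul_assoc]

theorem pull_faceM1_mul (f : A →ₗ[ℂ] ℂ) :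
    pull (faceM1 A) (f ∘ₗ LinearMap.mul' ℂ A) = pull (face1M A) (f ∘ₗ LinearMap.mul' ℂ A) := by
  apply ofConv_injective
  ext u v w
  change f (LinearMap.mul' ℂ A ((faceM1 A).toLinearMap (u ⊗ₜ (v ⊗ₜ w)))) =
    f (LinearMap.mul' ℂ A ((face1M A).toLinearMap (u ⊗ₜ (v ⊗ₜ w))))
  rw [faceM1_tmul, face1M_tmul]
  simp [mul_assoc]

theorem convMul_one_tmul (F G : A ⊗[ℂ] A →ₗ[ℂ] ℂ) (x : A) :
    (toConv F * toConv G) (1 ⊗ₜ x) = (toConv (F ∘ₗ TensorProduct.mk ℂ A A 1) *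
      toConv (G ∘ₗ TensorProduct.mk ℂ A A 1)) x := by
  simp only [LinearMap.convMul_apply, TensorProduct.comul_tmul, Bialgebra.comul_one]
  hopf_tensor_induction comul (R := ℂ) x with x₁ x₂
  simp [Algebra.TensorProduct.one_def]

end Slices

section ScalarConv

variable {D R X : Type*} [AddCommGroup D] [Module ℂ D] [Coalgebra ℂ D] [Ring R] [Algebra ℂ R]

/-- Convolving with a scalar valued map commutes with composing with a functional. -/
theorem comp_linearMap_convMul (f : R →ₗ[ℂ] ℂ) (p : D →ₗ[ℂ] ℂ) (G : WithConv (D →ₗ[ℂ] R)) :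
    toConv (f ∘ₗ (toConv (Algebra.linearMap ℂ R ∘ₗ p) * G).ofConv) =
      toConv p * toConv (f ∘ₗ G.ofConv) := by
  ext d
  simp only [LinearMap.convMul_def, LinearMap.comp_apply]
  generalize comul (R := ℂ) d = t
  induction t with
  | zero => simp
  | add x y hx hy => simp only [map_add, hx, hy]
  | tmul a b => simp [← Algebra.smul_def]

theorem comp_convMul_linearMap (f : R →ₗ[ℂ] ℂ) (p : D →ₗ[ℂ] ℂ) (G : WithConv (D →ₗ[ℂ] R)) :
    toConv (f ∘ₗ (G * toConv (Algebra.linearMap ℂ R ∘ₗ p)).ofConv) =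
      toConv (f ∘ₗ G.ofConv) * toConv p := by
  ext d
  simp only [LinearMap.convMul_def, LinearMap.comp_apply]
  generalize comul (R := ℂ) d = t
  induction t with
  | zero => simp
  | add x y hx hy => simp only [map_add, hx, hy]
  | tmul a b => simp [← Algebra.commutes, ← Algebra.smul_def, mul_comm]

end ScalarConv

section TwistedHopf

variable {A : Type*} [Ring A] [HopfAlgebra ℂ A] [StarRing A] [StarModule ℂ A]
  [IsHopfStarAlgebra A]

local notation "S" => (HopfAlgebra.antipode ℂ : A →ₗ[ℂ] A)

/-- Linear functionals separate points. -/
theorem dual_ext {X : Type*} [AddCommGroup X] [Module ℂ X] {x y : X}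
    (h : ∀ f : X →ₗ[ℂ] ℂ, f x = f y) : x = y :=
  (Module.forall_dual_apply_eq_zero_iff ℂ (x - y)).1 (fun f => by rw [map_sub, h, sub_self]) |>
    sub_eq_zero.1

omit [IsHopfStarAlgebra A] in
theorem isHopf_of : (HopfStarData.of A).IsHopf where
  mul_assoc a b d := mul_assoc a b d
  one_mul a := one_mul a
  antipode_mul a := by
    have := HopfAlgebra.mul_antipode_rTensor_comul_apply (R := ℂ) a
    rw [Algebra.algebraMap_eq_smul_one] at this
    exact this

namespace TwoCocycle

variable (c : TwoCocycle A)

/-- As functionals on `A ⊗ A`, `f ∘ μ_γ = γ * (f ∘ μ) * γ̄`. -/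
theorem comp_twisted_mul (f : A →ₗ[ℂ] ℂ) :
    toConv (f ∘ₗ TensorProduct.lift c.twistedHopf.mul) =
      toConv c.γ * toConv (f ∘ₗ LinearMap.mul' ℂ A) * toConv c.inv := by
  have e : TensorProduct.lift c.twistedHopf.mul =
      (toConv (Algebra.linearMap ℂ A ∘ₗ c.γ) * toConv (LinearMap.mul' ℂ A) *
        toConv (Algebra.linearMap ℂ A ∘ₗ c.inv)).ofConv :=
    TensorProduct.ext' fun _ _ => rfl
  rw [e, comp_convMul_linearMap, comp_linearMap_convMul]

theorem apply_twisted_mul (f : A →ₗ[ℂ] ℂ) (x y : A) : f (c.twistedHopf.mul x y) =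
    (toConv c.γ * toConv (f ∘ₗ LinearMap.mul' ℂ A) * toConv c.inv) (x ⊗ₜ y) := by
  rw [← c.comp_twisted_mul]
  simp

/-- `F((x ·_γ y) ⊗ z)` as a convolution product of functionals on `A ⊗ (A ⊗ A)`. -/
theorem apply_twisted_mul_left (F : A ⊗[ℂ] A →ₗ[ℂ] ℂ) (x y z : A) :
    F (c.twistedHopf.mul x y ⊗ₜ z) =
      (pull (face12 A) c.γ * pull (faceM1 A) F * pull (face12 A) c.inv) (x ⊗ₜ (y ⊗ₜ z)) := by
  rw [convMul_face12]
  have e : (pull (face12 A) c.γ * pull (faceM1 A) F).ofConv ∘ₗ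
      ((TensorProduct.mk ℂ A A).flip z).lTensor A =
      (toConv c.γ * toConv ((F ∘ₗ (TensorProduct.mk ℂ A A).flip z) ∘ₗ
        LinearMap.mul' ℂ A)).ofConv := by
    ext u v
    have h := face12_convMul c.γ (pull (faceM1 A) F) u v z
    have e' : (pull (faceM1 A) F).ofConv ∘ₗ ((TensorProduct.mk ℂ A A).flip z).lTensor A =
        (F ∘ₗ (TensorProduct.mk ℂ A A).flip z) ∘ₗ LinearMap.mul' ℂ A := by
      ext u v
      exact congrArg F (faceM1_tmul u v z)
    rw [e'] at h
    exact h
  rw [e]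
  exact c.apply_twisted_mul (F ∘ₗ (TensorProduct.mk ℂ A A).flip z) x y

/-- `F(x ⊗ (y ·_γ z))` as a convolution product of functionals on `A ⊗ (A ⊗ A)`. -/
theorem apply_twisted_mul_right (F : A ⊗[ℂ] A →ₗ[ℂ] ℂ) (x y z : A) :
    F (x ⊗ₜ c.twistedHopf.mul y z) =
      (pull (face23 A) c.γ * pull (face1M A) F * pull (face23 A) c.inv) (x ⊗ₜ (y ⊗ₜ z)) := by
  rw [convMul_face23]
  have e : (pull (face23 A) c.γ * pull (face1M A) F).ofConv ∘ₗ TensorProduct.mk ℂ A (A ⊗[ℂ] A) x =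
      (toConv c.γ * toConv ((F ∘ₗ TensorProduct.mk ℂ A A x) ∘ₗ LinearMap.mul' ℂ A)).ofConv := by
    ext u v
    have h := face23_convMul c.γ (pull (face1M A) F) x (u ⊗ₜ v)
    have e' : (pull (face1M A) F).ofConv ∘ₗ TensorProduct.mk ℂ A (A ⊗[ℂ] A) x =
        (F ∘ₗ TensorProduct.mk ℂ A A x) ∘ₗ LinearMap.mul' ℂ A := by
      ext u v
      exact congrArg F (face1M_tmul x u v)
    rw [e'] at h
    exact h
  rw [e]
  exact c.apply_twisted_mul (F ∘ₗ TensorProduct.mk ℂ A A x) y z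

theorem pull_convMul {C D : Type u} [AddCommGroup C] [Module ℂ C] [Coalgebra ℂ C]
    [AddCommGroup D] [Module ℂ D] [Coalgebra ℂ D] (p : D →ₗc[ℂ] C) (F G : WithConv (C →ₗ[ℂ] ℂ)) :
    pull p (F * G).ofConv = pull p F.ofConv * pull p G.ofConv := by
  rw [pull, LinearMap.convMul_comp_coalgHom_distrib]
  rfl

/-- Both sides are `γ`-conjugates of `f(xyz)`, by the two sides of the cocycle identity. -/
theorem twisted_mul_assoc (x y z : A) :
    c.twistedHopf.mul (c.twistedHopf.mul x y) z = c.twistedHopf.mul x (c.twistedHopf.mul y z) := by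
  refine dual_ext fun f => ?_
  rw [c.apply_twisted_mul, c.apply_twisted_mul]
  have h1 := c.apply_twisted_mul_left
    (toConv c.γ * toConv (f ∘ₗ LinearMap.mul' ℂ A) * toConv c.inv).ofConv x y z
  have h2 := c.apply_twisted_mul_right
    (toConv c.γ * toConv (f ∘ₗ LinearMap.mul' ℂ A) * toConv c.inv).ofConv x y z
  refine h1.trans (Eq.trans ?_ h2.symm)
  simp only [pull_convMul]
  rw [pull_faceM1_mul]
  simp only [← mul_assoc]
  rw [c.cocycle_faces]
  simp only [mul_assoc]
  rw [c.inv_faces]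

theorem twisted_one_mul (x : A) : c.twistedHopf.mul c.twistedHopf.one x = x := by
  refine dual_ext fun f => ?_
  rw [c.apply_twisted_mul]
  change (toConv (toConv c.γ * toConv (f ∘ₗ LinearMap.mul' ℂ A)).ofConv * toConv c.inv)
    (1 ⊗ₜ x) = f x
  rw [convMul_one_tmul]
  have e1 : toConv (c.inv ∘ₗ TensorProduct.mk ℂ A A 1) = 1 := by
    ext y
    simp [c.inv_one_left]
  have e2 : toConv (c.γ ∘ₗ TensorProduct.mk ℂ A A 1) = 1 := by
    ext y
    simp [c.unital_left]
  rw [e1, mul_one]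
  refine (convMul_one_tmul c.γ (f ∘ₗ LinearMap.mul' ℂ A) x).trans ?_
  rw [e2, one_mul]
  simp

/-- `(N_F X)ᵢⱼ = ∑ X_ab F(S(T_ia) ⊗ T_bj)`, which for `X = x(T)` represents
`h ↦ F(S(h₁) ⊗ h₃) x(h₂)`. -/
def sandwich {n : ℕ} (T : Fin n → Fin n → A) (F : WithConv (A ⊗[ℂ] A →ₗ[ℂ] ℂ))
    (X : Fin n → Fin n → ℂ) : Fin n → Fin n → ℂ :=
  fun i j => ∑ a, ∑ b, X a b * F (S (T i a) ⊗ₜ T b j)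

omit [StarRing A] [StarModule ℂ A] [IsHopfStarAlgebra A] in
/-- As the antipode reverses coproducts, `F ↦ sandwich T F` is an action of the convolution
algebra. -/
theorem sandwich_mul {n : ℕ} {T : Fin n → Fin n → A} (hT : IsCorep T)
    (F G : WithConv (A ⊗[ℂ] A →ₗ[ℂ] ℂ)) (X : Fin n → Fin n → ℂ) :
    sandwich T (F * G) X = sandwich T G (sandwich T F X) := by
  funext i j
  simp only [sandwich, convMul_tmul_of_comul F G (hT.comul_antipode _ _) (hT.comul_eq _ _),
    Finset.sum_mul, Finset.mul_sum]
  calc ∑ a, ∑ b, ∑ d, ∑ e, X a b * (F (S (T d a) ⊗ₜ T b e) * G (S (T i d) ⊗ₜ T e j))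
      = ∑ d, ∑ a, ∑ b, ∑ e, X a b * (F (S (T d a) ⊗ₜ T b e) * G (S (T i d) ⊗ₜ T e j)) :=
        Finset.sum_comm_cycle
    _ = _ := by
        refine Finset.sum_congr rfl fun d _ => ?_
        rw [Finset.sum_comm_cycle]
        simp only [mul_assoc]

/-- The left antipode axiom `S_γ(h₁) ·_γ h₂ = ε(h) 1`. On matrix coefficients, `Ū` is the image of
the identity matrix under the action of `γ̄`, and `γ̄ * (γ * (f ∘ μ) * γ̄) = (f ∘ μ) * γ̄`, so that
the middle of the product collapses to `f(1) Ū` by the antipode axiom of `A`. -/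
theorem twisted_antipode_mul (h : A) :
    TensorProduct.lift c.twistedHopf.mul (c.twistedHopf.antipode.rTensor A (comul (R := ℂ) h)) =
      counit (R := ℂ) h • c.twistedHopf.one := by
  have key : TensorProduct.lift c.twistedHopf.mul ∘ₗ c.twistedHopf.antipode.rTensor A ∘ₗ
      comul (R := ℂ) = (counit (R := ℂ)).smulRight c.twistedHopf.one := by
    refine corep_ext fun n T hT i j => dual_ext fun f => ?_
    have hS : ∀ i j, c.twistedHopf.antipode (T i j) =
        ∑ b, ∑ a, (c.U (T i a) * c.Ubar (T b j)) • S (T a b) := by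
      intro i j
      change (toConv (Algebra.linearMap ℂ A ∘ₗ c.U) * toConv S *
        toConv (Algebra.linearMap ℂ A ∘ₗ c.Ubar)) (T i j) = _
      rw [convMul_apply_of_comul _ _ (hT.comul_eq i j)]
      refine Finset.sum_congr rfl fun b _ => ?_
      rw [convMul_apply_of_comul _ _ (hT.comul_eq i b), Finset.sum_mul]
      refine Finset.sum_congr rfl fun a _ => ?_
      change algebraMap ℂ A _ * S (T a b) * algebraMap ℂ A _ = _
      rw [← Algebra.commutes, ← mul_assoc, ← map_mul, ← Algebra.smul_def, mul_comm]
    let F := toConv c.γ * toConv (f ∘ₗ LinearMap.mul' ℂ A) * toConv c.inv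
    let X : Fin n → Fin n → ℂ := fun i j => c.Ubar (T i j)
    have hF : ∀ x y, f (c.twistedHopf.mul x y) = F (x ⊗ₜ y) := c.apply_twisted_mul f
    let I : Fin n → Fin n → ℂ := fun i j => if i = j then 1 else 0
    have hX : X = sandwich T (toConv c.inv) I := by
      funext i j
      simp [X, sandwich, I, c.Ubar_corep hT]
    have hf : sandwich T (toConv (f ∘ₗ LinearMap.mul' ℂ A)) I = f 1 • I := by
      funext i j
      simp only [sandwich, I, ite_mul, one_mul, zero_mul, Finset.sum_ite_eq, Finset.mem_univ,
        if_true]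
      change ∑ a, f (S (T i a) * T a j) = f 1 * _
      rw [← map_sum, hT.sum_antipode_mul]
      by_cases h : i = j <;> simp [h]
    have hlin : ∀ (G : WithConv (A ⊗[ℂ] A →ₗ[ℂ] ℂ)) (r : ℂ) (Y : Fin n → Fin n → ℂ),
        sandwich T G (r • Y) = r • sandwich T G Y := by
      intro G r Y
      funext i j
      simp [sandwich, Finset.mul_sum, mul_assoc]
    have hFX : sandwich T F X = f 1 • X := by
      have : toConv c.inv * F = toConv (f ∘ₗ LinearMap.mul' ℂ A) * toConv c.inv := by
        simp only [F]
        rw [← mul_assoc, ← mul_assoc, c.inv_mul, one_mul]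
      conv_lhs => rw [hX, ← sandwich_mul hT, this, sandwich_mul hT, hf, hlin, ← hX]
    calc f (TensorProduct.lift c.twistedHopf.mul
          (c.twistedHopf.antipode.rTensor A (comul (R := ℂ) (T i j))))
        = ∑ k, ∑ b, ∑ a, c.U (T i a) * (c.Ubar (T b k) * F (S (T a b) ⊗ₜ T k j)) := by
          simp only [hT.comul_eq, map_sum, LinearMap.rTensor_tmul, TensorProduct.lift.tmul, hS,
            LinearMap.sum_apply, map_smul, LinearMap.smul_apply, hF, smul_eq_mul, mul_assoc]
      _ = ∑ a, c.U (T i a) * sandwich T F X a j := by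
          simp only [sandwich, Finset.mul_sum, X]
          rw [Finset.sum_comm_cycle]
          refine Finset.sum_congr rfl fun a _ => ?_
          rw [Finset.sum_comm]
      _ = f ((counit (R := ℂ)).smulRight c.twistedHopf.one (T i j)) := by
          rw [hFX]
          simp only [Pi.smul_apply, smul_eq_mul, X, mul_left_comm _ (f 1)]
          rw [← Finset.mul_sum, c.sum_U_mul_Ubar hT]
          simp only [LinearMap.smulRight_apply, hT.counit_eq, map_smul, smul_eq_mul]
          rw [mul_comm]
          rfl
  exact LinearMap.congr_fun key h

theorem isHopf_twistedHopf : c.twistedHopf.IsHopf where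
  mul_assoc := c.twisted_mul_assoc
  one_mul := c.twisted_one_mul
  antipode_mul := c.twisted_antipode_mul

/-- `f(a^{*_γ}) = (V̄ * f * V)(a^*)` -/
theorem apply_twisted_star (f : A →ₗ[ℂ] ℂ) (a : A) :
    f (c.twistedHopf.star a) = (toConv c.Vbar * toConv f * toConv c.V) (star a) := by
  have e : toConv c.Vbar * toConv f * toConv c.V = toConv (f ∘ₗ
      (toConv (Algebra.linearMap ℂ A ∘ₗ c.Vbar) * toConv (LinearMap.id : A →ₗ[ℂ] A) *
        toConv (Algebra.linearMap ℂ A ∘ₗ c.V)).ofConv) := by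
    rw [comp_convMul_linearMap, comp_linearMap_convMul]
    rfl
  rw [e]
  rfl

end TwoCocycle

end TwistedHopf

/-! ### The Hermitian metric of a real covariant metric -/

namespace CalculusData

section FirstOrderStar

variable {A : Type*} [AddCommGroup A] [Module ℂ A]
variable {Ω : ℕ → Type*} [∀ k, AddCommGroup (Ω k)] [∀ k, Module ℂ (Ω k)]

/-- The part of the axioms of a covariant `*`-calculus which concerns the involution in degrees `0`
and `1`. Unlike the full axioms, it is established for the twisted calculus as well. -/
structure IsFirstOrderStar (H : HopfStarData A) (C : CalculusData A Ω) : Prop where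
  star_star : ∀ (k : ℕ) (ω : Ω k), C.star k (C.star k ω) = ω
  star_mulB : ∀ a b : Ω 0, C.star 0 (C.mulB a b) = C.mulB (C.star 0 b) (C.star 0 a)
  star_lact : ∀ (b : Ω 0) (ω : Ω 1), C.star 1 (C.lact b ω) = C.ract (C.star 1 ω) (C.star 0 b)
  star_ract : ∀ (ω : Ω 1) (b : Ω 0), C.star 1 (C.ract ω b) = C.lact (C.star 0 b) (C.star 1 ω)
  coact_star : ∀ (k : ℕ) (ω : Ω k),
    C.coact k (C.star k ω) = TensorProduct.map H.star (C.star k) (C.coact k ω)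

theorem form_injective (k : ℕ) : Function.Injective (form (Ω := Ω) k) :=
  DFinsupp.single_injective

theorem IsCovariantStarCalculus.isCoaction [Coalgebra ℂ A] {H : HopfStarData A}
    {C : CalculusData A Ω} (hC : C.IsCovariantStarCalculus H) (k : ℕ) : IsCoaction (C.coact k) :=
  ⟨hC.coact_coassoc k, hC.coact_counit k⟩

theorem IsCovariantStarCalculus.isFirstOrderStar [Coalgebra ℂ A] {H : HopfStarData A}
    {C : CalculusData A Ω} (hC : C.IsCovariantStarCalculus H) : C.IsFirstOrderStar H where
  star_star := hC.star_star
  star_mulB a b := form_injective 0 (by simpa [mulB] using hC.star_wedge 0 0 a b)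
  star_lact b ω := form_injective 1 (by simpa [lact, ract] using hC.star_wedge 0 1 b ω)
  star_ract ω b := form_injective 1 (by simpa [lact, ract] using hC.star_wedge 1 0 ω b)
  coact_star := hC.coact_star

end FirstOrderStar

namespace MetricData

section Pairing

variable {A : Type*} [AddCommGroup A] [Module ℂ A]
variable {Ω : ℕ → Type*} [∀ k, AddCommGroup (Ω k)] [∀ k, Module ℂ (Ω k)]
variable {C : CalculusData A Ω} {H : HopfStarData A} {m : C.MetricData}

theorem ip_apply (m : C.MetricData) (ω η : Ω 1) : m.ip ω η = m.pair (C.proj (ω ⊗ₜ η)) := rfl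

theorem lift_ip (m : C.MetricData) : TensorProduct.lift m.ip = m.pair ∘ₗ C.proj :=
  TensorProduct.ext' fun _ _ => rfl

theorem ip_ract (m : C.MetricData) (ω : Ω 1) (b : Ω 0) (η : Ω 1) :
    m.ip (C.ract ω b) η = m.ip ω (C.lact b η) := by
  rw [ip_apply, ip_apply, ← sub_eq_zero, ← map_sub, ← map_sub]
  have : C.proj (C.ract ω b ⊗ₜ η - ω ⊗ₜ C.lact b η) = 0 :=
    (Submodule.Quotient.mk_eq_zero _).2 (Submodule.subset_span ⟨ω, b, η, rfl⟩)
  rw [this, map_zero]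

theorem toHermitian_toBar (m : C.MetricData) (ω η : Ω 1) :
    m.toHermitian (toBar (Ω 1) ω) η = m.ip η (C.star 1 ω) := rfl

theorem exists_repr (m : C.MetricData) : ∃ (n : ℕ) (x y : Fin n → Ω 1),
    C.proj (∑ i, x i ⊗ₜ y i) = m.g := by
  obtain ⟨t, ht⟩ := Submodule.Quotient.mk_surjective C.balanced m.g
  obtain ⟨n, x, y, rfl⟩ := TensorProduct.exists_sum_tmul_eq t
  exact ⟨n, x, y, ht⟩

theorem IsRealCovariantMetric.sum_ip_lact (hm : m.IsRealCovariantMetric H) {n : ℕ}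
    {x y : Fin n → Ω 1} (h : C.proj (∑ i, x i ⊗ₜ y i) = m.g) (ω : Ω 1) :
    ∑ i, C.lact (m.ip ω (x i)) (y i) = ω := by
  simpa [contractLeft] using hm.contract_left _ h ω

theorem IsRealCovariantMetric.sum_ract_ip (hm : m.IsRealCovariantMetric H) {n : ℕ}
    {x y : Fin n → Ω 1} (h : C.proj (∑ i, x i ⊗ₜ y i) = m.g) (ω : Ω 1) :
    ∑ i, C.ract (x i) (m.ip (y i) ω) = ω := by
  simpa [contractRight] using hm.contract_right _ h ω

/-- Reality of `g` amounts to `(ω, η)^* = (η^*, ω^*)`. -/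
theorem IsRealCovariantMetric.star_ip (hm : m.IsRealCovariantMetric H) (hC : C.IsFirstOrderStar H)
    (ω η : Ω 1) : C.star 0 (m.ip ω η) = m.ip (C.star 1 η) (C.star 1 ω) := by
  obtain ⟨n, x, y, h⟩ := m.exists_repr
  have h' : C.proj (∑ i, C.star 1 (y i) ⊗ₜ C.star 1 (x i)) = m.g := by
    simpa [flipStar] using hm.real _ h
  -- expand `η = ∑ xᵢ (yᵢ, η)` and `ω = ∑ (xᵢ^*, ω^*)^* yᵢ`
  have hη : ∑ i, C.lact (C.star 0 (m.ip (y i) η)) (C.star 1 (x i)) = C.star 1 η := by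
    conv_rhs => rw [← hm.sum_ract_ip h η]
    simp only [map_sum, hC.star_ract]
  have hω : ∑ i, C.lact (C.star 0 (m.ip (C.star 1 (x i)) (C.star 1 ω))) (y i) = ω := by
    have := congrArg (C.star 1) (hm.sum_ract_ip h' (C.star 1 ω))
    simpa only [map_sum, hC.star_ract, hC.star_star] using this
  conv_lhs => rw [← hω]
  conv_rhs => rw [← hη]
  simp only [map_sum, LinearMap.sum_apply, hm.left_linear, hC.star_mulB, hC.star_star]

end Pairing

section Hermitian

variable {A : Type*} [AddCommGroup A] [Module ℂ A] [Coalgebra ℂ A]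
variable {Ω : ℕ → Type*} [∀ k, AddCommGroup (Ω k)] [∀ k, Module ℂ (Ω k)]
variable {C : CalculusData A Ω} {H : HopfStarData A} {m : C.MetricData}

/-- `S(e₍₋₁₎) (e₍₀₎, y)₍₋₁₎ ⊗ (e₍₀₎, y)₍₀₎ = y₍₋₁₎ ⊗ (e, y₍₀₎)`. -/
theorem IsRealCovariantMetric.homCoact_ip (hm : m.IsRealCovariantMetric H) (hH : H.IsHopf)
    (hδ : IsCoaction (C.coact 1)) (e y : Ω 1) :
    C.homCoact H (m.ip.flip y) e = (m.ip e).lTensor A (C.coact 1 y) := by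
  let K : (A ⊗[ℂ] Ω 1) →ₗ[ℂ] (A ⊗[ℂ] Ω 1) →ₗ[ℂ] A ⊗[ℂ] Ω 0 :=
    TensorProduct.curry ((TensorProduct.lift m.ip).lTensor A ∘ₗ
      (TensorProduct.lift H.mul).rTensor (Ω 1 ⊗[ℂ] Ω 1) ∘ₗ
        (TensorProduct.tensorTensorTensorComm ℂ A (Ω 1) A (Ω 1)).toLinearMap)
  let J : A ⊗[ℂ] (A ⊗[ℂ] Ω 0) →ₗ[ℂ] A ⊗[ℂ] Ω 0 := (TensorProduct.lift H.mul).rTensor (Ω 0) ∘ₗ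
    (TensorProduct.assoc ℂ A A (Ω 0)).symm.toLinearMap ∘ₗ H.antipode.rTensor (A ⊗[ℂ] Ω 0)
  have hK : ∀ e, C.coact 0 (m.ip e y) = K (C.coact 1 e) (C.coact 1 y) := by
    intro e
    rw [ip_apply, hm.pair_covariant, ← lift_ip]
    rfl
  have h1 : C.homCoact H (m.ip.flip y) e =
      J ((K.flip (C.coact 1 y) ∘ₗ C.coact 1).lTensor A (C.coact 1 e)) := by
    have : C.coact 0 ∘ₗ m.ip.flip y = K.flip (C.coact 1 y) ∘ₗ C.coact 1 :=
      LinearMap.ext fun e => hK e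
    change ((TensorProduct.lift H.mul).rTensor (Ω 0) ∘ₗ
      (TensorProduct.assoc ℂ A A (Ω 0)).symm.toLinearMap ∘ₗ
        TensorProduct.map H.antipode (C.coact 0 ∘ₗ m.ip.flip y) ∘ₗ C.coact 1) e = _
    rw [this, ← LinearMap.rTensor_comp_lTensor]
    rfl
  have h2 : ∀ (X Y : A ⊗[ℂ] Ω 1), J ((K.flip Y).lTensor A
      (TensorProduct.assoc ℂ A A (Ω 1) ((comul (R := ℂ)).rTensor (Ω 1) X))) =
      (m.ip (slice (counit (R := ℂ)) X)).lTensor A Y := by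
    intro X Y
    induction X with
    | zero => simp
    | add x y hx hy => simp only [map_add, hx, hy, LinearMap.lTensor_add, LinearMap.add_apply]
    | tmul a e =>
    induction Y with
    | zero => simp
    | add x y hx hy => simp only [map_add, hx, hy, LinearMap.lTensor_add, LinearMap.add_apply]
    | tmul b z =>
      have h3 : ∀ s : A ⊗[ℂ] A, J ((K.flip (b ⊗ₜ z)).lTensor A
          (TensorProduct.assoc ℂ A A (Ω 1) (s ⊗ₜ e))) =
          H.mul (TensorProduct.lift H.mul (H.antipode.rTensor A s)) b ⊗ₜ m.ip e z := by
        intro s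
        induction s with
        | zero => simp
        | add x y hx hy =>
          simp only [map_add, TensorProduct.add_tmul, hx, hy, LinearMap.add_apply]
        | tmul u v => simp [J, K, hH.mul_assoc]
      rw [LinearMap.rTensor_tmul, h3, hH.antipode_mul]
      simp [hH.one_mul, TensorProduct.smul_tmul]
  rw [h1, LinearMap.lTensor_comp_apply, ← hδ.coassoc, h2, hδ.counit]

/-- The Hermitian metric associated with a real covariant metric. Only the Hopf algebra axioms and
the first order part of the calculus are used, so that this applies before and after twisting. -/
theorem IsRealCovariantMetric.isCovariantHermitianMetric (hm : m.IsRealCovariantMetric H)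
    (hH : H.IsHopf) (hC : C.IsFirstOrderStar H) (hδ : IsCoaction (C.coact 1)) :
    C.IsCovariantHermitianMetric H m.toHermitian where
  fgp := by
    obtain ⟨n, x, y, h⟩ := m.exists_repr
    exact ⟨n, y, fun i => m.ip.flip (x i), fun i b ω => hm.left_linear b ω (x i),
      fun ω => (hm.sum_ip_lact h ω).symm⟩
  bijOn := by
    obtain ⟨n, x, y, h⟩ := m.exists_repr
    refine ⟨fun z _ b ω => hm.left_linear b ω _, fun z _ z' _ hz => ?_, fun f hf => ?_⟩
    · have : C.star 1 (fromBar (Ω 1) z) = C.star 1 (fromBar (Ω 1) z') := by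
        rw [← hm.sum_ract_ip h (C.star 1 (fromBar (Ω 1) z)),
          ← hm.sum_ract_ip h (C.star 1 (fromBar (Ω 1) z'))]
        exact Finset.sum_congr rfl fun i _ =>
          congrArg (C.ract (x i)) (LinearMap.congr_fun hz (y i))
      have h' := congrArg (C.star 1) this
      rwa [hC.star_star, hC.star_star] at h'
    -- a left linear `f` is `(·, ∑ xᵢ f(yᵢ))`
    · refine ⟨toBar (Ω 1) (C.star 1 (∑ i, C.ract (x i) (f (y i)))), trivial, ?_⟩
      ext η
      rw [toHermitian_toBar, hC.star_star]
      conv_rhs => rw [← hm.sum_ip_lact h η]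
      simp only [map_sum, hm.right_linear]
      exact Finset.sum_congr rfl fun i _ => (hf _ _).symm
  left_linear b ω e := by
    rw [toHermitian_toBar, toHermitian_toBar, hC.star_ract, hC.star_star, ip_ract]
  right_linear b ω e := by
    rw [toHermitian_toBar, toHermitian_toBar, hC.star_lact, hC.star_star, hm.right_linear]
  covariant z e := by
    refine (hm.homCoact_ip hH hδ e (C.star 1 (fromBar (Ω 1) z))).trans ?_
    rw [hC.coact_star]
    change _ = (m.toHermitian.flip e).lTensor A
      (TensorProduct.map H.star (toBar (Ω 1)).toLinearMap (C.coact 1 (fromBar (Ω 1) z)))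
    induction C.coact 1 (fromBar (Ω 1) z) with
    | zero => simp
    | add x y hx hy => simp only [map_add, hx, hy]
    | tmul a η => rfl
  hermitian x y := by
    rw [toHermitian_toBar, toHermitian_toBar, hm.star_ip hC, hC.star_star]

end Hermitian

end MetricData

end CalculusData

/-! ### Twisting equivariant products -/

section TwistMap

variable {A : Type*} [Ring A] [HopfAlgebra ℂ A] [StarRing A] [StarModule ℂ A]
  [IsHopfStarAlgebra A]
variable {M N Z : Type*} [AddCommGroup M] [Module ℂ M] [AddCommGroup N] [Module ℂ N]
  [AddCommGroup Z] [Module ℂ Z] {δM : M →ₗ[ℂ] A ⊗[ℂ] M} {δN : N →ₗ[ℂ] A ⊗[ℂ] N}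
  {δZ : Z →ₗ[ℂ] A ⊗[ℂ] Z}

omit [IsHopfStarAlgebra A] in
theorem isEquivariant_iff {w : M ⊗[ℂ] N →ₗ[ℂ] Z} : IsEquivariant δM δN δZ w ↔
    ∀ t, δZ (w t) = w.lTensor A (tensorCoact (HopfStarData.of A) δM δN t) := by
  have : TensorProduct.map (LinearMap.mul' ℂ A) w =
      w.lTensor A ∘ₗ (LinearMap.mul' ℂ A).rTensor (M ⊗[ℂ] N) := by
    rw [LinearMap.lTensor_comp_rTensor]
  unfold IsEquivariant
  rw [this]
  rfl

/-- `γ(m₍₋₁₎ ⊗ n₍₋₁₎) m₍₀₎ ⊗ n₍₀₎` intertwines the diagonal coactions for the two products of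
`A`. -/
theorem tensorCoact_twistOp (c : TwoCocycle A) (hM : IsCoaction δM) (hN : IsCoaction δN)
    (t : M ⊗[ℂ] N) : (twistOp c.γ δM δN).lTensor A (tensorCoact c.twistedHopf δM δN t) =
      tensorCoact (HopfStarData.of A) δM δN (twistOp c.γ δM δN t) := by
  refine ext_slice fun F => ?_
  have h := hM.tens hN
  have e1 : slice F (tensorCoact c.twistedHopf δM δN t) =
      act (tens δM δN) (toConv c.γ * toConv (F ∘ₗ LinearMap.mul' ℂ A) * toConv c.inv) t := by
    rw [← c.comp_twisted_mul]
    exact slice_rTensor F _ _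
  have e2 : slice F (tensorCoact (HopfStarData.of A) δM δN (twistOp c.γ δM δN t)) =
      act (tens δM δN) (toConv (F ∘ₗ LinearMap.mul' ℂ A)) (act (tens δM δN) (toConv c.γ) t) :=
    slice_rTensor F _ _
  rw [slice_lTensor, e1, e2]
  refine (act_act h (toConv c.γ) _ t).trans ?_
  rw [act_act h, mul_assoc, c.inv_mul, mul_one]

/-- If `w(m ⊗ n)^* = w'(n^* ⊗ m^*)`, the same holds for the twisted products and the twisted
involutions. -/
theorem star_twistMap {c : TwoCocycle A} (hc : c.IsUnitary) (hM : IsCoaction δM)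
    (hN : IsCoaction δN) {sM : M →ₛₗ[starRingEnd ℂ] M} {sN : N →ₛₗ[starRingEnd ℂ] N}
    {sZ : Z →ₛₗ[starRingEnd ℂ] Z}
    (hsM : ∀ m, δM (sM m) = TensorProduct.map (starMap A) sM (δM m))
    (hsN : ∀ n, δN (sN n) = TensorProduct.map (starMap A) sN (δN n))
    {w : M ⊗[ℂ] N →ₗ[ℂ] Z} {w' : N ⊗[ℂ] M →ₗ[ℂ] Z} (hw' : IsEquivariant δN δM δZ w')
    (h : ∀ m n, sZ (w (m ⊗ₜ n)) = w' (sN n ⊗ₜ sM m)) (m : M) (n : N) :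
    act δZ (toConv c.Vbar) (sZ (twistMap c δM δN w (m ⊗ₜ n))) =
      twistMap c δN δM w' (act δN (toConv c.Vbar) (sN n) ⊗ₜ act δM (toConv c.Vbar) (sM m)) := by
  -- `m ⊗ n ↦ n^* ⊗ m^*`
  let s : M ⊗[ℂ] N →ₛₗ[starRingEnd ℂ] N ⊗[ℂ] M :=
    (TensorProduct.comm ℂ M N).toLinearMap ∘ₛₗ TensorProduct.map sM sN
  have hs : ∀ t, tens δN δM (s t) = TensorProduct.map (starSwap A) s (tens δM δN t) := by
    intro t
    induction t with
    | zero => simp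
    | add x y hx hy => simp only [map_add, hx, hy]
    | tmul m n =>
    have e : s (m ⊗ₜ n) = sN n ⊗ₜ sM m := rfl
    rw [e, tens_tmul, tens_tmul, hsM, hsN]
    generalize δM m = x
    generalize δN n = y
    induction x with
    | zero => simp
    | add x y hx hy => simp only [map_add, TensorProduct.tmul_add, TensorProduct.add_tmul, hx, hy]
    | tmul a m =>
    induction y with
    | zero => simp
    | add x y hx hy => simp only [map_add, TensorProduct.tmul_add, TensorProduct.add_tmul, hx, hy]
    | tmul b n => rfl
  have hwt : ∀ t, sZ (w t) = w' (s t) := by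
    intro t
    induction t with
    | zero => simp
    | add x y hx hy => simp only [map_add, hx, hy]
    | tmul m n => exact h m n
  have hγ : conjAlong (starSwap A) (conjAlong (starSwap A) c.γ) = c.γ := by
    ext a b
    change starRingEnd ℂ (starRingEnd ℂ (c.γ (star (star a) ⊗ₜ star (star b)))) = c.γ (a ⊗ₜ b)
    simp
  have hsγ := act_conj hs (toConv (conjAlong (starSwap A) c.γ)) (m ⊗ₜ n)
  rw [ofConv_toConv, hγ] at hsγ
  have hV := act_map hw' (toConv c.Vbar)
  have hT := hN.tens hM
  calc act δZ (toConv c.Vbar) (sZ (w (act (tens δM δN) (toConv c.γ) (m ⊗ₜ n))))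
      = w' (act (tens δN δM) (toConv (conjAlong (starSwap A) c.γ) *
          toConv (c.Vbar ∘ₗ LinearMap.mul' ℂ A)) (s (m ⊗ₜ n))) := by
        rw [hwt, ← hsγ, hV, ← act_act hT]
    _ = w' (act (tens δN δM) (toConv c.γ) (act (tens δN δM)
          (outer (toConv c.Vbar) (toConv c.Vbar)) (sN n ⊗ₜ sM m))) := by
        rw [TwoCocycle.conj_γ_mul_Vbar hc, act_act hT]
        rfl
    _ = _ := by
        rw [act_outer]
        rfl

end TwistMap

/-! ### The tensor square of the one-forms -/

namespace CalculusData

section FormTensor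

section Quotient

variable {A : Type*} [AddCommGroup A] [Module ℂ A]
variable {Ω : ℕ → Type*} [∀ k, AddCommGroup (Ω k)] [∀ k, Module ℂ (Ω k)]
variable {C : CalculusData A Ω}

theorem proj_surjective (C : CalculusData A Ω) : Function.Surjective C.proj :=
  Submodule.Quotient.mk_surjective C.balanced

/-- The universal property of `Ω^1 ⊗_B Ω^1`, for linear and conjugate linear maps. -/
theorem exists_lift_proj {σ : ℂ →+* ℂ} {Q : Type*} [AddCommGroup Q] [Module ℂ Q]
    (K : Ω 1 ⊗[ℂ] Ω 1 →ₛₗ[σ] Q)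
    (hK : ∀ ω b η, K (C.ract ω b ⊗ₜ η) = K (ω ⊗ₜ C.lact b η)) :
    ∃ L : C.FormTensor →ₛₗ[σ] Q, ∀ t, L (C.proj t) = K t := by
  refine ⟨C.balanced.liftQ K (Submodule.span_le.2 ?_), fun t => rfl⟩
  rintro _ ⟨ω, b, η, rfl⟩
  simp [hK]

end Quotient

variable {A : Type*} [Ring A] [HopfAlgebra ℂ A] [StarRing A] [StarModule ℂ A]
variable {Ω : ℕ → Type*} [∀ k, AddCommGroup (Ω k)] [∀ k, Module ℂ (Ω k)]
variable {C : CalculusData A Ω}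
variable (hC : C.IsCovariantStarCalculus (HopfStarData.of A))
include hC

theorem lact_lact (a b : Ω 0) (ω : Ω 1) : C.lact (C.mulB a b) ω = C.lact a (C.lact b ω) :=
  form_injective 1 (hC.wedge_assoc 0 0 1 a b ω)

theorem ract_ract (ω : Ω 1) (a b : Ω 0) : C.ract (C.ract ω a) b = C.ract ω (C.mulB a b) :=
  form_injective 1 (hC.wedge_assoc 1 0 0 ω a b)

theorem lact_ract (a : Ω 0) (ω : Ω 1) (b : Ω 0) :
    C.ract (C.lact a ω) b = C.lact a (C.ract ω b) :=
  form_injective 1 (hC.wedge_assoc 0 1 0 a ω b)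

theorem one_lact (ω : Ω 1) : C.lact C.one ω = ω :=
  form_injective 1 (hC.one_wedge 1 ω)

theorem isEquivariant_wedge (k l : ℕ) : IsEquivariant (C.coact k) (C.coact l) (C.coact (k + l))
    (TensorProduct.lift (C.wedge k l)) := by
  refine isEquivariant_iff.2 fun t => ?_
  induction t with
  | zero => simp
  | add x y hx hy => simp only [map_add, hx, hy]
  | tmul ω η => exact hC.coact_wedge k l ω η

theorem isEquivariant_mulB : IsEquivariant (C.coact 0) (C.coact 0) (C.coact 0)
    (TensorProduct.lift C.mulB) := isEquivariant_wedge hC 0 0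

theorem isEquivariant_lact : IsEquivariant (C.coact 0) (C.coact 1) (C.coact 1)
    (TensorProduct.lift C.lact) := isEquivariant_wedge hC 0 1

theorem isEquivariant_ract : IsEquivariant (C.coact 1) (C.coact 0) (C.coact 1)
    (TensorProduct.lift C.ract) := isEquivariant_wedge hC 1 0

/-- The diagonal coaction descends to `Ω^1 ⊗_B Ω^1`. -/
theorem exists_coact_proj [IsHopfStarAlgebra A] : ∃ δ : C.FormTensor →ₗ[ℂ] A ⊗[ℂ] C.FormTensor,
    IsEquivariant (C.coact 1) (C.coact 1) δ C.proj := by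
  obtain ⟨δ, hδ⟩ := exists_lift_proj (C := C)
    (C.proj.lTensor A ∘ₗ tensorCoact (HopfStarData.of A) (C.coact 1) (C.coact 1)) (by
      intro ω b η
      refine ext_slice fun F => ?_
      have e : ∀ t, slice F (C.proj.lTensor A (tensorCoact (HopfStarData.of A) (C.coact 1)
          (C.coact 1) t)) = C.proj (act (tens (C.coact 1) (C.coact 1))
            (toConv (F ∘ₗ LinearMap.mul' ℂ A)) t) := fun t =>
        (slice_lTensor _ _ _).trans (congrArg _ (slice_rTensor F _ _))
      have h : C.proj ∘ₗ (TensorProduct.lift C.ract).rTensor (Ω 1) ∘ₗ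
          (TensorProduct.assoc ℂ (Ω 1) (Ω 0) (Ω 1)).symm.toLinearMap =
          C.proj ∘ₗ (TensorProduct.lift C.lact).lTensor (Ω 1) := by
        ext ω b η
        exact proj_ract C ω b η
      have h1 := act_faceM1 (δP := C.coact 1) (isEquivariant_ract hC)
        (F ∘ₗ LinearMap.mul' ℂ A) (ω ⊗ₜ (b ⊗ₜ η))
      have h2 := act_face1M (δM := C.coact 1) (isEquivariant_lact hC)
        (F ∘ₗ LinearMap.mul' ℂ A) (ω ⊗ₜ (b ⊗ₜ η))
      refine (e _).trans (Eq.trans ?_ (e _).symm)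
      refine (congrArg C.proj h1).trans (Eq.trans ?_ (congrArg C.proj h2).symm)
      rw [pull_faceM1_mul]
      exact LinearMap.congr_fun h _)
  exact ⟨δ, isEquivariant_iff.2 hδ⟩

end FormTensor

end CalculusData

/-! ### The twisted calculus -/

namespace CalculusData

section Twist

variable {A : Type*} [Ring A] [HopfAlgebra ℂ A] [StarRing A] [StarModule ℂ A]
  [IsHopfStarAlgebra A]
variable {Ω : ℕ → Type*} [∀ k, AddCommGroup (Ω k)] [∀ k, Module ℂ (Ω k)]
variable {C : CalculusData A Ω} (hC : C.IsCovariantStarCalculus (HopfStarData.of A))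

theorem twist_mulB (C : CalculusData A Ω) (c : TwoCocycle A) (a b : Ω 0) :
    (C.twist c).mulB a b = twistMap c (C.coact 0) (C.coact 0) (TensorProduct.lift C.mulB)
      (a ⊗ₜ b) := rfl

theorem twist_lact (C : CalculusData A Ω) (c : TwoCocycle A) (b : Ω 0) (ω : Ω 1) :
    (C.twist c).lact b ω = twistMap c (C.coact 0) (C.coact 1) (TensorProduct.lift C.lact)
      (b ⊗ₜ ω) := rfl

theorem twist_ract (C : CalculusData A Ω) (c : TwoCocycle A) (ω : Ω 1) (b : Ω 0) :
    (C.twist c).ract ω b = twistMap c (C.coact 1) (C.coact 0) (TensorProduct.lift C.ract)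
      (ω ⊗ₜ b) := rfl

include hC

/-- The twisted involution is `*` followed by the action of `V̄`. -/
theorem twist_star (c : TwoCocycle A) (k : ℕ) (ω : Ω k) :
    (C.twist c).star k ω = act (C.coact k) (toConv c.Vbar) (C.star k ω) :=
  congrArg (slice c.Vbar) (hC.coact_star k ω).symm

/-- Covariance of the twisted involution: `V̄ * f * V * V̄ = V̄ * f` for every functional `f`. -/
theorem coact_twist_star (c : TwoCocycle A) (k : ℕ) (ω : Ω k) :
    C.coact k ((C.twist c).star k ω) =
      TensorProduct.map c.twistedHopf.star ((C.twist c).star k) (C.coact k ω) := by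
  have hδ := hC.isCoaction k
  refine ext_slice fun F => ?_
  have key : ∀ t : A ⊗[ℂ] Ω k,
      slice F (TensorProduct.map c.twistedHopf.star ((C.twist c).star k) t) =
        act (C.coact k) (toConv c.Vbar) (slice (toConv c.Vbar * toConv F * toConv c.V).ofConv
          (TensorProduct.map (starMap A) (C.star k) t)) := by
    intro t
    induction t with
    | zero => simp
    | add x y hx hy => simp only [map_add, hx, hy]
    | tmul a η =>
      simp only [TensorProduct.map_tmul, slice_tmul, map_smul, twist_star hC,
        c.apply_twisted_star]
      rfl
  have h : TensorProduct.map (starMap A) (C.star k) (C.coact k ω) = C.coact k (C.star k ω) :=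
    (hC.coact_star k ω).symm
  rw [key, h, twist_star hC, ← act_apply, ← act_apply (δ := C.coact k)]
  refine (act_act hδ (toConv F) (toConv c.Vbar) _).trans (Eq.symm ?_)
  refine (act_act hδ _ _ _).trans ?_
  rw [mul_assoc, c.V_mul_Vbar, mul_one]

theorem isFirstOrderStar_twist {c : TwoCocycle A} (hc : c.IsUnitary) :
    (C.twist c).IsFirstOrderStar c.twistedHopf where
  star_star k ω := by
    have hV : conjAlong (starMap A) c.V = c.Vbar := by
      rw [← TwoCocycle.conjAlong_Vbar hc]
      ext a
      change starRingEnd ℂ (starRingEnd ℂ (c.Vbar (Star.star (Star.star a)))) = c.Vbar a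
      simp
    have h := act_conj (hC.coact_star k) (toConv c.V) (C.star k ω)
    have e : conjAlong (HopfStarData.of A).star c.V = c.Vbar := hV
    rw [ofConv_toConv, e, hC.star_star] at h
    rw [twist_star hC, twist_star hC, ← h, act_act (hC.isCoaction k), c.V_mul_Vbar,
      act_one (hC.isCoaction k)]
  star_mulB a b := by
    rw [twist_star hC, twist_star hC, twist_star hC, twist_mulB, twist_mulB]
    exact star_twistMap hc (hC.isCoaction 0) (hC.isCoaction 0) (hC.coact_star 0) (hC.coact_star 0)
      (isEquivariant_mulB hC) hC.isFirstOrderStar.star_mulB a b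
  star_lact b ω := by
    rw [twist_star hC, twist_star hC, twist_star hC, twist_lact, twist_ract]
    exact star_twistMap hc (hC.isCoaction 0) (hC.isCoaction 1) (hC.coact_star 0) (hC.coact_star 1)
      (isEquivariant_ract hC) hC.isFirstOrderStar.star_lact b ω
  star_ract ω b := by
    rw [twist_star hC, twist_star hC, twist_star hC, twist_ract, twist_lact]
    exact star_twistMap hc (hC.isCoaction 1) (hC.isCoaction 0) (hC.coact_star 1) (hC.coact_star 0)
      (isEquivariant_lact hC) hC.isFirstOrderStar.star_ract ω b
  coact_star k ω := coact_twist_star hC c k ω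

/-! ### The twisted metric -/

theorem phi_proj (c : TwoCocycle A) (t : Ω 1 ⊗[ℂ] Ω 1) :
    phi hC c ((C.twist c).proj t) = twistMap c (C.coact 1) (C.coact 1) C.proj t := rfl

theorem phi_phiInv (c : TwoCocycle A) (f : C.FormTensor) : phi hC c (phiInv hC c f) = f := by
  obtain ⟨t, rfl⟩ := C.proj_surjective f
  change C.proj (twistOp c.γ _ _ (twistOp c.inv _ _ t)) = _
  rw [twistOp_twistOp _ _ (hC.coact_coassoc 1) (hC.coact_coassoc 1), c.inv_mul,
    twistOp_one (hC.coact_counit 1) (hC.coact_counit 1)]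

theorem phiInv_phi (c : TwoCocycle A) (f : (C.twist c).FormTensor) :
    phiInv hC c (phi hC c f) = f := by
  obtain ⟨t, rfl⟩ := (C.twist c).proj_surjective f
  change (C.twist c).proj (twistOp c.inv _ _ (twistOp c.γ _ _ t)) = _
  rw [twistOp_twistOp _ _ (hC.coact_coassoc 1) (hC.coact_coassoc 1), c.mul_inv,
    twistOp_one (hC.coact_counit 1) (hC.coact_counit 1)]

namespace MetricData

variable {m : C.MetricData} (c : TwoCocycle A)

theorem twist_ip (ω η : Ω 1) : (m.twist hC c).ip ω η =
    twistMap c (C.coact 1) (C.coact 1) (TensorProduct.lift m.ip) (ω ⊗ₜ η) := by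
  rw [lift_ip]
  rfl

/-- `t` represents `g_γ` if and only if `φ` carries it to `g`. -/
theorem phi_proj_eq {t : Ω 1 ⊗[ℂ] Ω 1} :
    (C.twist c).proj t = (m.twist hC c).g ↔
      twistMap c (C.coact 1) (C.coact 1) C.proj t = m.g := by
  rw [← phi_proj hC]
  refine ⟨fun h => ?_, fun h => ?_⟩
  · rw [h]
    exact phi_phiInv hC c m.g
  · rw [← phiInv_phi hC c ((C.twist c).proj t), h]
    rfl

variable (hm : m.IsRealCovariantMetric (HopfStarData.of A))
include hm

omit hC in
omit [IsHopfStarAlgebra A] in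
theorem IsRealCovariantMetric.isEquivariant_ip :
    IsEquivariant (C.coact 1) (C.coact 1) (C.coact 0) (TensorProduct.lift m.ip) := by
  rw [isEquivariant_iff, lift_ip]
  exact hm.pair_covariant

omit [IsHopfStarAlgebra A] in
/-- `g` is coinvariant. -/
theorem IsRealCovariantMetric.coact_g {δ : C.FormTensor →ₗ[ℂ] A ⊗[ℂ] C.FormTensor}
    (hδ : IsEquivariant (C.coact 1) (C.coact 1) δ C.proj) : δ m.g = 1 ⊗ₜ m.g := by
  obtain ⟨t, ht⟩ := C.proj_surjective m.g
  have h1 : C.actOn t C.one = t := by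
    have : C.lact C.one = LinearMap.id := LinearMap.ext (one_lact hC)
    change (C.lact C.one).rTensor (Ω 1) t = t
    rw [this, LinearMap.rTensor_id, LinearMap.id_apply]
  have h := hm.coev_covariant t ht C.one
  rw [hC.coact_one, h1, ← isEquivariant_iff.1 hδ, ht, LinearMap.lTensor_tmul,
    LinearMap.comp_apply, h1, ht] at h
  exact h

omit [IsHopfStarAlgebra A] in
/-- As `g` is coinvariant and `γ` unital, a twisted product with `g` is the untwisted one. -/
theorem IsRealCovariantMetric.twistMap_g_left {δ : C.FormTensor →ₗ[ℂ] A ⊗[ℂ] C.FormTensor}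
    (hδ : IsEquivariant (C.coact 1) (C.coact 1) δ C.proj) {k : ℕ} {Z : Type*} [AddCommGroup Z]
    [Module ℂ Z] (w : Ω k ⊗[ℂ] C.FormTensor →ₗ[ℂ] Z) (ω : Ω k) :
    twistMap c (C.coact k) δ w (ω ⊗ₜ m.g) = w (ω ⊗ₜ m.g) := by
  have h : ∀ t : A ⊗[ℂ] Ω k, slice c.γ (TensorProduct.tensorTensorTensorComm ℂ A (Ω k) A
      C.FormTensor (t ⊗ₜ (1 ⊗ₜ m.g))) = slice (counit (R := ℂ)) t ⊗ₜ m.g := by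
    intro t
    induction t with
    | zero => simp
    | add x y hx hy => simp only [map_add, TensorProduct.add_tmul, hx, hy]
    | tmul a η => simp [c.unital_right, TensorProduct.smul_tmul']
  rw [twistMap, LinearMap.comp_apply, act_apply, tens_tmul, hm.coact_g hC hδ]
  refine congrArg w ((h _).trans ?_)
  rw [hC.coact_counit]

omit [IsHopfStarAlgebra A] in
theorem IsRealCovariantMetric.twistMap_g_right {δ : C.FormTensor →ₗ[ℂ] A ⊗[ℂ] C.FormTensor}
    (hδ : IsEquivariant (C.coact 1) (C.coact 1) δ C.proj) {k : ℕ} {Z : Type*} [AddCommGroup Z]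
    [Module ℂ Z] (w : C.FormTensor ⊗[ℂ] Ω k →ₗ[ℂ] Z) (ω : Ω k) :
    twistMap c δ (C.coact k) w (m.g ⊗ₜ ω) = w (m.g ⊗ₜ ω) := by
  have h : ∀ t : A ⊗[ℂ] Ω k, slice c.γ (TensorProduct.tensorTensorTensorComm ℂ A C.FormTensor A
      (Ω k) ((1 ⊗ₜ m.g) ⊗ₜ t)) = m.g ⊗ₜ slice (counit (R := ℂ)) t := by
    intro t
    induction t with
    | zero => simp
    | add x y hx hy => simp only [map_add, TensorProduct.tmul_add, hx, hy]
    | tmul a η => simp [c.unital_left]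
  rw [twistMap, LinearMap.comp_apply, act_apply, tens_tmul, hm.coact_g hC hδ]
  refine congrArg w ((h _).trans ?_)
  rw [hC.coact_counit]

/-- The contraction of `ω` with a representative of `g_γ` is the twisted product of `ω` and `g`
under the contraction map `w₄ : Ω^1 ⊗ (Ω^1 ⊗_B Ω^1) → Ω^1`. -/
theorem IsRealCovariantMetric.twist_contractLeft {t : Ω 1 ⊗[ℂ] Ω 1}
    (ht : (C.twist c).proj t = (m.twist hC c).g) (ω : Ω 1) :
    (m.twist hC c).contractLeft ω t = ω := by
  obtain ⟨δ, hδ⟩ := exists_coact_proj hC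
  let K : Ω 1 ⊗[ℂ] (Ω 1 ⊗[ℂ] Ω 1) →ₗ[ℂ] Ω 1 := TensorProduct.lift C.lact ∘ₗ
    (TensorProduct.lift m.ip).rTensor (Ω 1) ∘ₗ
      (TensorProduct.assoc ℂ (Ω 1) (Ω 1) (Ω 1)).symm.toLinearMap
  obtain ⟨L, hL⟩ := exists_lift_proj (C := C) (TensorProduct.curry K).flip (by
    intro x b y
    ext ω
    change C.lact (m.ip ω (C.ract x b)) y = C.lact (m.ip ω x) (C.lact b y)
    rw [hm.right_linear, lact_lact hC])
  let w₄ : Ω 1 ⊗[ℂ] C.FormTensor →ₗ[ℂ] Ω 1 := TensorProduct.lift L.flip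
  have hw₄ : ∀ s, w₄ (ω ⊗ₜ C.proj s) = m.contractLeft ω s := by
    intro s
    have e : w₄ (ω ⊗ₜ C.proj s) = K (ω ⊗ₜ s) := LinearMap.congr_fun (hL s) ω
    rw [e]
    clear e
    induction s with
    | zero => simp
    | add x y hx hy => simp only [map_add, TensorProduct.tmul_add, hx, hy]
    | tmul x y => rfl
  have h : ∀ s, (m.twist hC c).contractLeft ω s = twistMap c (C.coact 1) δ w₄
      (ω ⊗ₜ twistMap c (C.coact 1) (C.coact 1) C.proj s) := by
    intro s
    induction s with
    | zero => simp
    | add x y hx hy => simp only [map_add, TensorProduct.tmul_add, hx, hy]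
    | tmul x y =>
      rw [← twistMap_assoc c (hC.isCoaction 1) (hC.isCoaction 1) (hC.isCoaction 1)
        hm.isEquivariant_ip (w₂ := TensorProduct.lift C.lact) (w₄ := w₄) hδ
        (fun ω x y => (LinearMap.congr_fun (hL (x ⊗ₜ y)) ω).symm), ← twist_ip hC c]
      rfl
  rw [h, (phi_proj_eq hC c).1 ht, hm.twistMap_g_left hC c hδ]
  obtain ⟨s, hs⟩ := C.proj_surjective m.g
  rw [← hs, hw₄, hm.contract_left s hs]

/-- The mirror image of `twist_contractLeft`, with `w₂ : (Ω^1 ⊗_B Ω^1) ⊗ Ω^1 → Ω^1`. -/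
theorem IsRealCovariantMetric.twist_contractRight {t : Ω 1 ⊗[ℂ] Ω 1}
    (ht : (C.twist c).proj t = (m.twist hC c).g) (ω : Ω 1) :
    (m.twist hC c).contractRight ω t = ω := by
  obtain ⟨δ, hδ⟩ := exists_coact_proj hC
  let K : (Ω 1 ⊗[ℂ] Ω 1) ⊗[ℂ] Ω 1 →ₗ[ℂ] Ω 1 := TensorProduct.lift C.ract ∘ₗ
    (TensorProduct.lift m.ip).lTensor (Ω 1) ∘ₗ
      (TensorProduct.assoc ℂ (Ω 1) (Ω 1) (Ω 1)).toLinearMap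
  obtain ⟨L, hL⟩ := exists_lift_proj (C := C) (TensorProduct.curry K) (by
    intro x b y
    ext ω
    change C.ract (C.ract x b) (m.ip y ω) = C.ract x (m.ip (C.lact b y) ω)
    rw [hm.left_linear, ract_ract hC])
  let w₂ : C.FormTensor ⊗[ℂ] Ω 1 →ₗ[ℂ] Ω 1 := TensorProduct.lift L
  have hw₂ : ∀ s, w₂ (C.proj s ⊗ₜ ω) = m.contractRight ω s := by
    intro s
    have e : w₂ (C.proj s ⊗ₜ ω) = K (s ⊗ₜ ω) := LinearMap.congr_fun (hL s) ω
    rw [e]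
    clear e
    induction s with
    | zero => simp
    | add x y hx hy => simp only [map_add, TensorProduct.add_tmul, hx, hy]
    | tmul x y => rfl
  have h : ∀ s, (m.twist hC c).contractRight ω s = twistMap c δ (C.coact 1) w₂
      (twistMap c (C.coact 1) (C.coact 1) C.proj s ⊗ₜ ω) := by
    intro s
    induction s with
    | zero => simp
    | add x y hx hy => simp only [map_add, TensorProduct.add_tmul, hx, hy]
    | tmul x y =>
      rw [twistMap_assoc c (hC.isCoaction 1) (hC.isCoaction 1) (hC.isCoaction 1) hδ
        hm.isEquivariant_ip (w₂ := w₂) (w₄ := TensorProduct.lift C.ract)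
        (fun x y ω => LinearMap.congr_fun (hL (x ⊗ₜ y)) ω), ← twist_ip hC c]
      rfl
  rw [h, (phi_proj_eq hC c).1 ht, hm.twistMap_g_right hC c hδ]
  obtain ⟨s, hs⟩ := C.proj_surjective m.g
  rw [← hs, hw₂, hm.contract_right s hs]

/-- `φ` is a comodule map and carries `b ·_γ g_γ` to `b · g`; here `w₄` is the left action of `B` on
`Ω^1 ⊗_B Ω^1`. -/
theorem IsRealCovariantMetric.twist_coev_covariant {t : Ω 1 ⊗[ℂ] Ω 1}
    (ht : (C.twist c).proj t = (m.twist hC c).g) (b : Ω 0) :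
    (C.twist c).proj.lTensor A (tensorCoact c.twistedHopf (C.coact 1) (C.coact 1)
      ((C.twist c).actOn t b)) =
        ((C.twist c).proj ∘ₗ (C.twist c).actOn t).lTensor A (C.coact 0 b) := by
  obtain ⟨δ, hδ⟩ := exists_coact_proj hC
  let K : Ω 0 ⊗[ℂ] (Ω 1 ⊗[ℂ] Ω 1) →ₗ[ℂ] C.FormTensor := C.proj ∘ₗ
    (TensorProduct.lift C.lact).rTensor (Ω 1) ∘ₗ
      (TensorProduct.assoc ℂ (Ω 0) (Ω 1) (Ω 1)).symm.toLinearMap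
  obtain ⟨L, hL⟩ := exists_lift_proj (C := C) (TensorProduct.curry K).flip (by
    intro x a y
    ext b
    change C.proj (C.lact b (C.ract x a) ⊗ₜ y) = C.proj (C.lact b x ⊗ₜ C.lact a y)
    rw [← lact_ract hC, proj_ract])
  let w₄ : Ω 0 ⊗[ℂ] C.FormTensor →ₗ[ℂ] C.FormTensor := TensorProduct.lift L.flip
  have hw₄ : ∀ b s, w₄ (b ⊗ₜ C.proj s) = C.proj (C.actOn s b) := by
    intro b s
    have e : w₄ (b ⊗ₜ C.proj s) = K (b ⊗ₜ s) := LinearMap.congr_fun (hL s) b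
    rw [e]
    clear e
    change _ = C.proj ((C.lact b).rTensor (Ω 1) s)
    induction s with
    | zero => simp
    | add x y hx hy => simp only [map_add, TensorProduct.tmul_add, hx, hy]
    | tmul x y => rfl
  have h : ∀ b s, phi hC c ((C.twist c).proj ((C.twist c).actOn s b)) =
      twistMap c (C.coact 0) δ w₄ (b ⊗ₜ twistMap c (C.coact 1) (C.coact 1) C.proj s) := by
    intro b s
    rw [phi_proj hC]
    change twistMap c _ _ C.proj (((C.twist c).lact b).rTensor (Ω 1) s) = _
    induction s with
    | zero => simp
    | add x y hx hy => simp only [map_add, TensorProduct.tmul_add, hx, hy]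
    | tmul x y =>
      rw [← twistMap_assoc c (hC.isCoaction 0) (hC.isCoaction 1) (hC.isCoaction 1)
        (isEquivariant_lact hC) (w₂ := C.proj) (w₄ := w₄) hδ
        (fun b x y => (LinearMap.congr_fun (hL (x ⊗ₜ y)) b).symm), ← twist_lact]
      rfl
  obtain ⟨s, hs⟩ := C.proj_surjective m.g
  have h' : ∀ b, phi hC c ((C.twist c).proj ((C.twist c).actOn t b)) = C.proj (C.actOn s b) := by
    intro b
    rw [h, (phi_proj_eq hC c).1 ht, hm.twistMap_g_left hC c hδ, ← hs, hw₄]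
  -- it suffices to compare the images under the bijection `id ⊗ φ`
  have hinj : Function.Injective ((phi hC c).lTensor A) := by
    have e : phiInv hC c ∘ₗ phi hC c = LinearMap.id := LinearMap.ext (phiInv_phi hC c)
    refine Function.LeftInverse.injective (g := (phiInv hC c).lTensor A) fun x => ?_
    rw [← LinearMap.lTensor_comp_apply, e, LinearMap.lTensor_id, LinearMap.id_apply]
  apply hinj
  rw [← LinearMap.lTensor_comp_apply, ← LinearMap.lTensor_comp_apply]
  have e1 : phi hC c ∘ₗ (C.twist c).proj = C.proj ∘ₗ twistOp c.γ (C.coact 1) (C.coact 1) := rfl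
  have e2 : phi hC c ∘ₗ (C.twist c).proj ∘ₗ (C.twist c).actOn t = C.proj ∘ₗ C.actOn s :=
    LinearMap.ext h'
  rw [e2, e1, LinearMap.lTensor_comp_apply, tensorCoact_twistOp c (hC.isCoaction 1)
    (hC.isCoaction 1), ← hm.coev_covariant s hs, ← isEquivariant_iff.1 hδ,
    ← isEquivariant_iff.1 hδ, ← h']
  rfl

/-- `φ` intertwines `flipStar` for the twisted calculus with the twist of the involution `sF` of
`Ω^1 ⊗_B Ω^1`, which fixes the coinvariant real element `g`. -/
theorem IsRealCovariantMetric.twist_real (hc : c.IsUnitary) {t : Ω 1 ⊗[ℂ] Ω 1}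
    (ht : (C.twist c).proj t = (m.twist hC c).g) :
    (C.twist c).proj ((C.twist c).flipStar t) = (m.twist hC c).g := by
  obtain ⟨δ, hδ⟩ := exists_coact_proj hC
  obtain ⟨sF, hsF⟩ := exists_lift_proj (C := C)
    (C.proj ∘ₛₗ C.flipStar : Ω 1 ⊗[ℂ] Ω 1 →ₛₗ[starRingEnd ℂ] C.FormTensor) (by
      intro ω b η
      change C.proj (C.star 1 η ⊗ₜ C.star 1 (C.ract ω b)) =
        C.proj (C.star 1 (C.lact b η) ⊗ₜ C.star 1 ω)
      rw [hC.isFirstOrderStar.star_ract, hC.isFirstOrderStar.star_lact, proj_ract])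
  have h : ∀ t, twistMap c (C.coact 1) (C.coact 1) C.proj ((C.twist c).flipStar t) =
      act δ (toConv c.Vbar) (sF (twistMap c (C.coact 1) (C.coact 1) C.proj t)) := by
    intro t
    induction t with
    | zero => simp
    | add x y hx hy => simp only [map_add, hx, hy]
    | tmul x y =>
      rw [star_twistMap hc (hC.isCoaction 1) (hC.isCoaction 1) (hC.coact_star 1) (hC.coact_star 1)
        hδ (fun x y => hsF (x ⊗ₜ y)), ← twist_star hC, ← twist_star hC]
      rfl
  obtain ⟨s, hs⟩ := C.proj_surjective m.g
  have hg : sF m.g = m.g := by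
    rw [← hs, hsF, hs]
    exact hm.real s hs
  rw [phi_proj_eq hC, h, (phi_proj_eq hC c).1 ht, hg, act_apply, hm.coact_g hC hδ]
  simp [c.Vbar_one]

theorem IsRealCovariantMetric.twist (hc : c.IsUnitary) :
    (m.twist hC c).IsRealCovariantMetric c.twistedHopf where
  left_linear b ω η := by
    simp only [twist_ip, twist_lact, twist_mulB]
    exact twistMap_assoc c (hC.isCoaction 0) (hC.isCoaction 1) (hC.isCoaction 1)
      (isEquivariant_lact hC) hm.isEquivariant_ip hm.left_linear b ω η
  right_linear b ω η := by
    simp only [twist_ip, twist_ract, twist_mulB]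
    exact (twistMap_assoc c (hC.isCoaction 1) (hC.isCoaction 1) (hC.isCoaction 0)
      hm.isEquivariant_ip (isEquivariant_ract hC) (fun ω η b => (hm.right_linear b ω η).symm)
      ω η b).symm
  contract_left t ht ω := hm.twist_contractLeft hC c ht ω
  contract_right t ht ω := hm.twist_contractRight hC c ht ω
  pair_covariant t := by
    have h := hm.pair_covariant (twistOp c.γ (C.coact 1) (C.coact 1) t)
    rw [← tensorCoact_twistOp c (hC.isCoaction 1) (hC.isCoaction 1),
      ← LinearMap.lTensor_comp_apply] at h
    exact h
  coev_covariant t ht b := hm.twist_coev_covariant hC c ht b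
  real t ht := hm.twist_real hC c hc ht

/-! ### Comparison of the Hermitian metrics -/

omit hC hm in
/-- Under `x̄ ↦ x^*`, the map `𝔑` becomes the action of `V̄`. -/
theorem star_fromBar_frakN (z : Bar (Ω 1)) :
    C.star 1 (fromBar (Ω 1) (C.frakN c z)) = (C.twist c).star 1 (fromBar (Ω 1) z) := by
  let σ : Bar (Ω 1) →ₗ[ℂ] Ω 1 := C.star 1 ∘ₛₗ fromBar (Ω 1)
  have h : ∀ t : A ⊗[ℂ] Ω 1, σ.lTensor A (TensorProduct.map (starMap A)
      (toBar (Ω 1)).toLinearMap t) = TensorProduct.map (starMap A) (C.star 1) t := by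
    intro t
    induction t with
    | zero => simp
    | add x y hx hy => simp only [map_add, hx, hy]
    | tmul a ω => rfl
  change σ (slice c.Vbar (C.barCoact (HopfStarData.of A) z)) = _
  rw [← slice_lTensor]
  exact congrArg (slice c.Vbar) (h (C.coact 1 (fromBar (Ω 1) z)))

/-- The deformed Hermitian metric of a metric is the Hermitian metric of the twisted metric: both
send `z` and `v` to `γ(v₍₋₁₎ ⊗ y₍₋₁₎) (v₍₀₎, y₍₀₎)`, where `y` is the image of `z` under the twisted
involution. -/
theorem IsRealCovariantMetric.toHermitian_twist :
    (m.twist hC c).toHermitian = C.deformHermitian c m.toHermitian := by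
  ext z v
  let y : Ω 1 := (C.twist c).star 1 (fromBar (Ω 1) z)
  have hz : m.toHermitian (C.frakN c z) = m.ip.flip y :=
    congrArg m.ip.flip (star_fromBar_frakN c z)
  let G : A ⊗[ℂ] Ω 1 →ₗ[ℂ] Ω 1 →ₗ[ℂ] A ⊗[ℂ] Ω 0 := (LinearMap.lTensorHom A ∘ₗ m.ip).flip
  have hG : C.homCoact (HopfStarData.of A) (m.ip.flip y) = G (C.coact 1 y) :=
    LinearMap.ext fun e => hm.homCoact_ip isHopf_of (hC.isCoaction 1) e y
  have key : ∀ X Y : A ⊗[ℂ] Ω 1, slice c.γ ((TensorProduct.assoc ℂ A A (Ω 0)).symm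
      ((G Y).lTensor A X)) = TensorProduct.lift m.ip
        (slice c.γ (TensorProduct.tensorTensorTensorComm ℂ A (Ω 1) A (Ω 1) (X ⊗ₜ Y))) := by
    intro X Y
    induction X with
    | zero => simp
    | add x y hx hy => simp only [map_add, TensorProduct.add_tmul, hx, hy]
    | tmul a e =>
    induction Y with
    | zero => simp
    | add x y hx hy =>
      simp only [map_add, TensorProduct.tmul_add, LinearMap.lTensor_add, LinearMap.add_apply, hx,
        hy]
    | tmul b η => simp [G]
  change (m.twist hC c).ip v y = slice c.γ ((TensorProduct.assoc ℂ A A (Ω 0)).symm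
    ((C.homCoact (HopfStarData.of A) (m.toHermitian (C.frakN c z))).lTensor A (C.coact 1 v)))
  rw [hz, hG, key, twist_ip hC c]
  rfl

end MetricData

end Twist

end CalculusData

end CocycleTwist

end

theorem mainTheorem4 {A : Type*} [Ring A] [HopfAlgebra ℂ A] [StarRing A] [StarModule ℂ A]
    [CocycleTwist.IsHopfStarAlgebra A]
    {Ω : ℕ → Type*} [∀ k, AddCommGroup (Ω k)] [∀ k, Module ℂ (Ω k)]
    (C : CocycleTwist.CalculusData A Ω)
    (hC : C.IsCovariantStarCalculus (CocycleTwist.HopfStarData.of A))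
    (m : C.MetricData) (hm : m.IsRealCovariantMetric (CocycleTwist.HopfStarData.of A))
    (c : CocycleTwist.TwoCocycle A) (hc : c.IsUnitary) :
    (m.twist hC c).IsRealCovariantMetric c.twistedHopf ∧
      C.IsCovariantHermitianMetric (CocycleTwist.HopfStarData.of A) m.toHermitian ∧
      (C.twist c).IsCovariantHermitianMetric c.twistedHopf (m.twist hC c).toHermitian ∧
      (m.twist hC c).toHermitian = C.deformHermitian c m.toHermitian := by
  have hm' := hm.twist hC c hc
  exact ⟨hm',
    hm.isCovariantHermitianMetric CocycleTwist.isHopf_of hC.isFirstOrderStar (hC.isCoaction 1),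
    hm'.isCovariantHermitianMetric c.isHopf_twistedHopf
      (CocycleTwist.CalculusData.isFirstOrderStar_twist hC hc) (hC.isCoaction 1),
    hm.toHermitian_twist hC c⟩
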